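/- Let $p$ be a prime and let $F$ be a nonarchimedean local field with ring of integers $\mathcal O_F$, uniformizer $\pi_F$, normalized valuation $\nu_F$ and residue field $k_F$ of cardinality $p^f$. Let $D$ be a central division algebra over $F$ of dimension $d^2$ with $d>1$, with reduced norm $\mathrm{Nrd}\colon D\to F$, valuation $\nu_D=\frac1d\,\nu_F\circ\mathrm{Nrd}$, ring of integers $\mathcal O_D$, uniformizer $\varpi_D$ and residue field $k_D=\mathcal O_D/\varpi_D\mathcal O_D$. Put $I_1=1+\varpi_D\mathcal O_D\subset D^\times$ and $I_{1,\mathrm{Nrd}=1}=\{x\in I_1:\mathrm{Nrd}(x)=1\}$. Let $\overline{\mathbb F}_p$ be an algebraic closure of $\mathbb F_p$ with the discrete topology, and let $H^1(G,\overline{\mathbb F}_p)$ denote continuous group cohomology with trivial action. Assume one of the following: (a) ($p$-adic case) $F$ has characteristic $0$, $e$ is its absolute ramification index (so $p\mathcal O_F=\pi_F^e\mathcal O_F$), and $p>de+1$; (b) (function-field case) $F$ has characteristic $p$, and $\gcd(p,d)=1$. Then restriction to the subgroups $I_{1,\mathrm{Nrd}=1}$ and $1+\pi_F\mathcal O_F$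 of $I_1$ is an isomorphism of $\overline{\mathbb F}_p$-vector spaces $$H^1(I_1,\overline{\mathbb F}_p)\;\cong\; H^1(I_{1,\mathrm{Nrd}=1},\overline{\mathbb F}_p)\oplus H^1(1+\pi_F\mathcal O_F,\overline{\mathbb F}_p).$$ Moreover, as $\overline{\mathbb F}_p$-vector spaces, $$H^1(I_{1,\mathrm{Nrd}=1},\overline{\mathbb F}_p)\cong \mathrm{Hom}(k_D,\overline{\mathbb F}_p)\cong\overline{\mathbb F}_p^{\,df},$$ where $\mathrm{Hom}$ denotes homomorphisms of additive groups, and $H^1(1+\pi_F\mathcal O_F,\overline{\mathbb F}_p)$ is isomorphic to $\overline{\mathbb F}_p^{\,ef}$ in case (a) and to the countable direct sum $\bigoplus_{i\in\mathbb N}\overline{\mathbb F}_p$ in case (b). -/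

import Mathlib

open scoped TensorProduct Valued
open ValuativeRel
universe u

/-! ### Central division algebras split over an algebraic closure -/

section Splitting
variable (F D : Type*) [Field F] [DivisionRing D] [Algebra F D] [Algebra.IsCentral F D]

theorem isSimpleRing_tensor (L : Type*) [Field L] [Algebra F L] :
    IsSimpleRing (L ⊗[F] D) := by
  classical
  let b := Module.Basis.ofVectorSpace F L
  let φ := TensorProduct.equivFinsuppOfBasisLeft (N := D) b
  have hr : ∀ (x : L ⊗[F] D) (c : D) i, φ (x * (1 ⊗ₜ c)) i = φ x i * c := by
    intro x c i
    induction x with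
    | zero => simp
    | tmul l d => simp [φ]
    | add x y hx hy => rw [add_mul, map_add, Finsupp.add_apply, hx, hy, map_add,
        Finsupp.add_apply, add_mul]
  have hl : ∀ (x : L ⊗[F] D) (c : D) i, φ ((1 ⊗ₜ c) * x) i = c * φ x i := by
    intro x c i
    induction x with
    | zero => simp
    | tmul l d => simp [φ]
    | add x y hx hy => rw [mul_add, map_add, Finsupp.add_apply, hx, hy, map_add,
        Finsupp.add_apply, mul_add]
  apply IsSimpleRing.of_eq_bot_or_eq_top
  intro I
  by_contra hI
  rw [not_or] at hI
  obtain ⟨hbot, htop⟩ := hI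
  have hex : ∃ n : ℕ, ∃ x ∈ I, x ≠ 0 ∧ (φ x).support.card = n := by
    by_contra hcon
    apply hbot
    rw [eq_bot_iff]
    intro x hx
    by_contra hx0
    exact hcon ⟨_, x, hx, hx0, rfl⟩
  obtain ⟨x, hxI, hx0, hxn⟩ := Nat.find_spec hex
  have hmin : ∀ y ∈ I, (φ y).support.card < (φ x).support.card → y = 0 := by
    intro y hy hlt
    by_contra hy0
    exact Nat.find_min hex (hxn ▸ hlt) ⟨y, hy, hy0, rfl⟩
  obtain ⟨i, hi⟩ : ∃ i, φ x i ≠ 0 := by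
    by_contra hcon
    push Not at hcon
    exact hx0 (φ.injective (by ext i; simp [hcon i]))
  obtain ⟨y, hy⟩ : ∃ y, y = x * (1 ⊗ₜ[F] (φ x i)⁻¹) := ⟨_, rfl⟩
  have hyI : y ∈ I := hy ▸ I.mul_mem_right _ _ hxI
  have hyi : φ y i = 1 := by rw [hy, hr, mul_inv_cancel₀ hi]
  have hyc : ∀ (c : D) j, c * φ y j = φ y j * c := by
    intro c
    have h0 : (1 ⊗ₜ[F] c) * y - y * (1 ⊗ₜ[F] c) = 0 := by
      apply hmin
      · exact I.sub_mem (I.mul_mem_left _ _ hyI) (I.mul_mem_right _ _ hyI)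
      · apply Finset.card_lt_card
        refine (Finset.ssubset_iff_of_subset ?_).2 ⟨i, by simpa using hi, ?_⟩
        · intro j hj
          rw [Finsupp.mem_support_iff] at hj ⊢
          intro hj0
          apply hj
          have hyj : φ y j = 0 := by rw [hy, hr, hj0, zero_mul]
          rw [map_sub, Finsupp.sub_apply, hl, hr, hyj, mul_zero, zero_mul, sub_zero]
        · rw [Finsupp.notMem_support_iff, map_sub, Finsupp.sub_apply, hl, hr, hyi, mul_one, one_mul, sub_self]
    intro j
    have := congrArg (fun z => φ z j) h0
    simp only [map_sub, Finsupp.sub_apply, hl, hr, map_zero, Finsupp.zero_apply] at this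
    exact sub_eq_zero.1 this
  have hyF : ∀ j, ∃ a : F, algebraMap F D a = φ y j := by
    intro j
    have : φ y j ∈ Subalgebra.center F D := by
      rw [Subalgebra.mem_center_iff]
      intro c
      exact hyc c j
    exact Algebra.mem_bot.1 (Algebra.IsCentral.out this)
  have hyl : ∃ l : L, y = l ⊗ₜ 1 := by
    choose a ha using hyF
    refine ⟨∑ j ∈ (φ y).support, a j • b j, ?_⟩
    calc y = φ.symm (φ y) := (φ.symm_apply_apply y).symm
      _ = ∑ j ∈ (φ y).support, b j ⊗ₜ[F] (φ y j) := by
        rw [TensorProduct.equivFinsuppOfBasisLeft_symm_apply]; rfl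
      _ = _ := by
        rw [TensorProduct.sum_tmul]
        refine Finset.sum_congr rfl fun j _ => ?_
        rw [← ha j, TensorProduct.smul_tmul, Algebra.algebraMap_eq_smul_one]
  obtain ⟨l, hl'⟩ := hyl
  have hl0 : l ≠ 0 := by
    rintro rfl
    rw [hl'] at hyi
    simp at hyi
  apply htop
  rw [eq_top_iff]
  intro z _
  have : z = (z * (l⁻¹ ⊗ₜ 1)) * y := by
    rw [mul_assoc, hl', Algebra.TensorProduct.tmul_mul_tmul, inv_mul_cancel₀ hl0, one_mul,
      ← Algebra.TensorProduct.one_def, mul_one]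
  rw [this]
  exact I.mul_mem_left _ _ hyI

theorem exists_splitting [FiniteDimensional F D] : ∃ n : ℕ, Nonempty
    (AlgebraicClosure F ⊗[F] D ≃ₐ[AlgebraicClosure F]
      Matrix (Fin n) (Fin n) (AlgebraicClosure F)) := by
  have := isSimpleRing_tensor F D (AlgebraicClosure F)
  obtain ⟨n, -, h⟩ := IsSimpleRing.exists_algEquiv_matrix_of_isAlgClosed (AlgebraicClosure F)
    (AlgebraicClosure F ⊗[F] D)
  exact ⟨n, h⟩
end Splitting

/-! ### The valuation of the norm form is ultrametric -/

section Val
variable (F D : Type*) [Field F] [ValuativeRel F] [TopologicalSpace F]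
  [IsNonarchimedeanLocalField F] [DivisionRing D] [Algebra F D] [FiniteDimensional F D]

theorem isOpen_valuation_lt_one : IsOpen {x : F | valuation F x < 1} := by
  rw [isOpen_iff_mem_nhds]
  intro x hx
  rw [IsValuativeTopology.mem_nhds_iff]
  refine ⟨1, ?_⟩
  rintro _ ⟨y, hy, rfl⟩
  exact (valuation F).map_add_lt hx (by simpa using hy)

theorem valuation_eq_mem_nhds {a : F} (ha : a ≠ 0) :
    {x : F | valuation F x = valuation F a} ∈ nhds a := by
  rw [IsValuativeTopology.mem_nhds_iff]
  refine ⟨Units.mk0 (valuation F a) (by simpa using ha), ?_⟩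
  rintro _ ⟨y, hy, rfl⟩
  exact (valuation F).map_add_eq_of_lt_left hy

theorem valuation_bounds_of_isCompact {X : Type*} [TopologicalSpace X] {S : Set X}
    (hS : IsCompact S) {f : X → F} (hf : Continuous f) (h0 : ∀ x ∈ S, f x ≠ 0) :
    ∃ γ C : ValueGroupWithZero F, γ ≠ 0 ∧
      ∀ x ∈ S, γ ≤ valuation F (f x) ∧ valuation F (f x) ≤ C := by
  refine hS.induction_on (p := fun s => ∃ γ C : ValueGroupWithZero F, γ ≠ 0 ∧
      ∀ x ∈ s, γ ≤ valuation F (f x) ∧ valuation F (f x) ≤ C) ?_ ?_ ?_ ?_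
  · exact ⟨1, 1, one_ne_zero, by simp⟩
  · rintro s t hst ⟨γ, C, hγ, h⟩
    exact ⟨γ, C, hγ, fun x hx => h x (hst hx)⟩
  · rintro s t ⟨γ, C, hγ, h⟩ ⟨γ', C', hγ', h'⟩
    refine ⟨min γ γ', max C C', ?_, ?_⟩
    · rcases min_choice γ γ' with h | h <;> rw [h] <;> assumption
    · rintro x (hx | hx)
      · exact ⟨(min_le_left _ _).trans (h x hx).1, (h x hx).2.trans (le_max_left _ _)⟩
      · exact ⟨(min_le_right _ _).trans (h' x hx).1, (h' x hx).2.trans (le_max_right _ _)⟩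
  · intro x hx
    refine ⟨f ⁻¹' {y | valuation F y = valuation F (f x)}, mem_nhdsWithin_of_mem_nhds
      (hf.continuousAt (valuation_eq_mem_nhds F (h0 x hx))), valuation F (f x),
      valuation F (f x), by simpa using h0 x hx, ?_⟩
    intro y hy
    exact ⟨hy.ge, hy.le⟩

/-- The norm form of a finite-dimensional division algebra over a local field does not increase
valuations above `1` under `z ↦ z + 1`. -/
theorem valuation_norm_add_one_le {z : D} (hz : valuation F (Algebra.norm F z) ≤ 1) :
    valuation F (Algebra.norm F (z + 1)) ≤ 1 := by
  classical
  let v := valuation F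
  let b := Module.finBasis F D
  let n := Module.finrank F D
  let N : (Fin n → F) → F := fun c => Algebra.norm F (b.equivFun.symm c)
  have hn : n ≠ 0 := Module.finrank_pos.ne'
  have hN : Continuous N := by
    have : N = fun c => (∑ i, c i • Algebra.leftMulMatrix b (b i)).det := by
      funext c
      simp only [N, Algebra.norm_eq_matrix_det b, Module.Basis.equivFun_symm_apply, map_sum,
        map_smul]
    rw [this]
    refine Continuous.matrix_det ?_
    refine continuous_finsetSum _ fun i _ => ?_
    exact (continuous_apply i).smul continuous_const
  let S : Set (Fin n → F) := Set.pi Set.univ (fun _ => {x : F | v x ≤ 1}) \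
    Set.pi Set.univ (fun _ => {x : F | v x < 1})
  have hS : IsCompact S :=
    (isCompact_univ_pi fun _ => IsNonarchimedeanLocalField.isCompact_closedBall F 1).diff
      (isOpen_set_pi Set.finite_univ fun _ _ => isOpen_valuation_lt_one F)
  have hS0 : ∀ c ∈ S, N c ≠ 0 := by
    intro c hc h
    rw [Algebra.norm_eq_zero_iff, LinearEquiv.map_eq_zero_iff] at h
    subst h
    apply hc.2
    intro i _
    simp [v]
  obtain ⟨γ, C, hγ, hγC⟩ := valuation_bounds_of_isCompact F hS hN hS0
  -- the maximum norm of the coordinates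
  let m : D → ValueGroupWithZero F := fun x => Finset.univ.sup fun i => v (b.equivFun x i)
  have hm : ∀ x i, v (b.equivFun x i) ≤ m x := fun x i =>
    Finset.le_sup (f := fun i => v (b.equivFun x i)) (Finset.mem_univ i)
  have hm0 : ∀ x, x ≠ 0 → ∃ a : F, a ≠ 0 ∧ v a = m x ∧ b.equivFun (a⁻¹ • x) ∈ S := by
    intro x hx
    have : Nonempty (Fin n) := ⟨⟨0, Nat.pos_of_ne_zero hn⟩⟩
    obtain ⟨i, -, hi⟩ := Finset.exists_mem_eq_sup Finset.univ Finset.univ_nonempty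
      (fun i => v (b.equivFun x i))
    change m x = _ at hi
    have hne : b.equivFun x i ≠ 0 := by
      intro h0
      apply hx
      rw [← LinearEquiv.map_eq_zero_iff b.equivFun]
      funext j
      have := hm x j
      rw [hi, h0, map_zero, le_zero_iff] at this
      simpa [v] using this
    refine ⟨_, hne, hi.symm, ?_, ?_⟩
    · intro j _
      have hj := hm x j
      rw [hi] at hj
      have hpos : v (b.equivFun x i) ≠ 0 := by simpa [v] using hne
      simp only [map_smul, Pi.smul_apply, smul_eq_mul, Set.mem_ofPred_eq, map_mul, map_inv₀]
      rw [inv_mul_le_iff₀ (zero_lt_iff.2 hpos), mul_one]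
      exact hj
    · intro h
      have h1 := h i (Set.mem_univ _)
      rw [map_smul, Pi.smul_apply, smul_eq_mul, inv_mul_cancel₀ hne] at h1
      exact absurd h1 (by simp)
  have hbd : ∀ x, x ≠ 0 → γ * m x ^ n ≤ v (Algebra.norm F x) ∧
      v (Algebra.norm F x) ≤ C * m x ^ n := by
    intro x hx
    obtain ⟨a, ha, hax, hS'⟩ := hm0 x hx
    have h := hγC _ hS'
    have hx' : Algebra.norm F x = N (b.equivFun (a⁻¹ • x)) * a ^ n := by
      simp only [N, LinearEquiv.symm_apply_apply]
      rw [← Algebra.norm_algebraMap (S := D), ← map_mul, ← Algebra.commutes, ← Algebra.smul_def,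
        smul_inv_smul₀ ha]
    rw [hx', map_mul, map_pow, hax]
    exact ⟨mul_le_mul_left h.1 _, mul_le_mul_left h.2 _⟩
  by_contra hcon
  rw [not_le] at hcon
  have hz0 : z ≠ 0 := by
    rintro rfl
    simp at hcon
  have hw0 : z + 1 ≠ 0 := by
    intro h
    rw [h] at hcon
    simp [Algebra.norm_zero] at hcon
  have hmadd : ∀ k, ∃ i, m ((z + 1) ^ k) ≤ m (z ^ i) := by
    intro k
    obtain ⟨i, -, hi⟩ := Finset.exists_max_image (Finset.range (k + 1)) (fun i => m (z ^ i))
      ⟨0, by simp⟩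
    refine ⟨i, ?_⟩
    refine Finset.sup_le fun j _ => ?_
    rw [(Commute.one_right z).add_pow, map_sum, Finset.sum_apply]
    refine v.map_sum_le fun l hl => ?_
    rw [one_pow, mul_one, ← nsmul_eq_mul', map_nsmul, Pi.smul_apply, nsmul_eq_mul, map_mul]
    refine (mul_le_of_le_one_left' ?_).trans ((hm _ j).trans (hi l hl))
    induction k.choose l with
    | zero => simp
    | succ q ih =>
      rw [Nat.cast_succ]
      exact v.map_add_le ih v.map_one.le
  have hfin : ∀ k, v (Algebra.norm F (z + 1)) ^ k ≤ C * γ⁻¹ := by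
    intro k
    obtain ⟨i, hi⟩ := hmadd k
    have h1 := (hbd _ (pow_ne_zero k hw0)).2
    have h2 := (hbd _ (pow_ne_zero i hz0)).1
    rw [map_pow, map_pow] at h1 h2
    refine h1.trans (mul_le_mul_right ((pow_le_pow_left₀ zero_le hi n).trans ?_) _)
    rw [← one_mul γ⁻¹, le_mul_inv_iff₀ (zero_lt_iff.2 hγ), mul_comm]
    exact h2.trans (pow_le_one₀ zero_le hz)
  obtain ⟨k, hk⟩ := MulArchimedean.arch (C * γ⁻¹) hcon
  have h3 := hfin (k + 1)
  have h4 : v (Algebra.norm F (z + 1)) ^ k < v (Algebra.norm F (z + 1)) ^ (k + 1) :=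
    pow_lt_pow_right₀ hcon (Nat.lt_succ_self k)
  exact absurd (h3.trans hk) (not_le.2 h4)
end Val

/-! ### The division algebra, its valuation and its groups of units -/

section Groups

variable (F : Type*) (D : Type*) [Field F] [DivisionRing D] [Algebra F D]

/-- The reduced norm of a central division algebra `D` over `F`: choose a splitting
`F̄ ⊗ D ≃ Mₙ(F̄)` and put `Nrd x = det (1 ⊗ x)`. By the Skolem–Noether theorem the choice does not
matter. The values lie in `F`; here they are viewed in `F̄`. -/
noncomputable def reducedNorm [Algebra.IsCentral F D] [FiniteDimensional F D] :
    D →* AlgebraicClosure F where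
  toFun x := ((exists_splitting F D).choose_spec.some (1 ⊗ₜ[F] x)).det
  map_one' := by rw [← Algebra.TensorProduct.one_def, map_one, Matrix.det_one]
  map_mul' x y := by
    rw [← Matrix.det_mul, ← map_mul, Algebra.TensorProduct.tmul_mul_tmul, one_mul]

variable [ValuativeRel F] [TopologicalSpace F] [IsNonarchimedeanLocalField F]

/-- The valuation of a finite-dimensional division algebra `D` over a local field `F`, written
multiplicatively: `x ↦ v_F (N_{D/F} x)`. If `D` is central of dimension `d ^ 2` then
`N_{D/F} = Nrd ^ d`, so this is (a power of) the valuation `(1 / d) ν_F ∘ Nrd`. -/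
noncomputable def divisionValuation [FiniteDimensional F D] :
    Valuation D (ValueGroupWithZero F) where
  toFun x := valuation F (Algebra.norm F x)
  map_zero' := by rw [Algebra.norm_zero, map_zero]
  map_one' := by rw [map_one, map_one]
  map_mul' x y := by rw [map_mul, map_mul]
  map_add_le_max' x y := by
    have key : ∀ a b : D, valuation F (Algebra.norm F a) ≤ valuation F (Algebra.norm F b) →
        valuation F (Algebra.norm F (a + b)) ≤ valuation F (Algebra.norm F b) := by
      intro a b hab
      rcases eq_or_ne b 0 with rfl | hb
      · rw [add_zero]
        exact hab
      · have hb' : valuation F (Algebra.norm F b) ≠ 0 := by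
          simpa using hb
        have h1 : valuation F (Algebra.norm F (a * b⁻¹)) ≤ 1 := by
          have h2 : valuation F (Algebra.norm F (a * b⁻¹)) * valuation F (Algebra.norm F b) =
              valuation F (Algebra.norm F a) := by
            rw [← map_mul, ← map_mul, inv_mul_cancel_right₀ hb]
          by_contra hcon
          rw [not_le] at hcon
          have h3 := mul_lt_mul_of_pos_right hcon (zero_lt_iff.2 hb')
          rw [h2, one_mul] at h3
          exact absurd hab (not_le.2 h3)
        have h4 : a + b = (a * b⁻¹ + 1) * b := by
          rw [add_mul, inv_mul_cancel_right₀ hb, one_mul]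
        rw [h4, map_mul, map_mul]
        exact mul_le_of_le_one_left' (valuation_norm_add_one_le F D h1)
    rcases le_total (valuation F (Algebra.norm F x)) (valuation F (Algebra.norm F y)) with h | h
    · exact (key x y h).trans (le_max_right _ _)
    · rw [add_comm]
      exact (key y x h).trans (le_max_left _ _)

/-- The ring of integers `O_D`. -/
noncomputable abbrev divisionIntegers [FiniteDimensional F D] : Subring D :=
  (divisionValuation F D).integer

/-- The maximal ideal of `O_D`, that is, `ϖ_D O_D` for any uniformizer `ϖ_D`. -/
noncomputable def divisionMaximalIdeal [FiniteDimensional F D] : Ideal (divisionIntegers F D) where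
  carrier := {x | divisionValuation F D (x : D) < 1}
  zero_mem' := by simp
  add_mem' {x y} hx hy := by simpa using (divisionValuation F D).map_add_lt hx hy
  smul_mem' c x hx := by
    have hc : divisionValuation F D (c : D) ≤ 1 := c.2
    have hx' : divisionValuation F D (x : D) < 1 := hx
    change divisionValuation F D ((c : D) * (x : D)) < 1
    rw [map_mul]
    exact (mul_le_of_le_one_left' hc).trans_lt hx'

instance divisionMaximalIdeal_isTwoSided [FiniteDimensional F D] :
    (divisionMaximalIdeal F D).IsTwoSided where
  mul_mem_of_left {x} y hx := by
    have hy : divisionValuation F D (y : D) ≤ 1 := y.2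
    have hx' : divisionValuation F D (x : D) < 1 := hx
    change divisionValuation F D ((x : D) * (y : D)) < 1
    rw [map_mul]
    exact (mul_le_of_le_one_right' hy).trans_lt hx'

/-- The residue ring `k_D = O_D / ϖ_D O_D`. -/
abbrev divisionResidueRing [FiniteDimensional F D] : Type _ :=
  divisionIntegers F D ⧸ divisionMaximalIdeal F D

/-- The subgroup `1 + m` of the units of a ring with valuation `v`, where `m = {x | v x < 1}`. -/
def oneUnits {R Γ : Type*} [Ring R] [LinearOrderedCommGroupWithZero Γ] (v : Valuation R Γ) :
    Subgroup Rˣ where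
  carrier := {u | v ((u : R) - 1) < 1}
  one_mem' := by simp
  mul_mem' {x y} hx hy := by
    have hy1 : v (y : R) = 1 := by
      rw [← add_sub_cancel 1 (y : R)]
      exact v.map_one_add_of_lt hy
    have h : ((x * y : Rˣ) : R) - 1 = ((x : R) - 1) * y + ((y : R) - 1) := by
      rw [Units.val_mul, sub_mul, one_mul, sub_add_sub_cancel]
    change v _ < 1
    rw [h]
    refine v.map_add_lt ?_ hy
    rw [map_mul, hy1, mul_one]
    exact hx
  inv_mem' {x} hx := by
    have hx1 : v (x : R) = 1 := by
      rw [← add_sub_cancel 1 (x : R)]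
      exact v.map_one_add_of_lt hx
    change v _ < 1
    have h : v (((x⁻¹ : Rˣ) : R) - 1) = v ((x : R) - 1) := by
      rw [v.map_sub_swap, ← mul_one (v (1 - _)), ← hx1, ← map_mul, sub_mul, one_mul,
        Units.inv_mul]
    rw [h]
    exact hx

/-- `1 + π_F O_F`, as a subgroup of `Fˣ`. -/
noncomputable abbrev oneUnitsField : Subgroup Fˣ := oneUnits (valuation F)

/-- `I₁ = 1 + ϖ_D O_D`, as a subgroup of `Dˣ`. -/
noncomputable abbrev oneUnitsDivision [FiniteDimensional F D] : Subgroup Dˣ :=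
  oneUnits (divisionValuation F D)

/-- The subgroup of `I₁` of elements of reduced norm `1`. -/
noncomputable def oneUnitsNrdOne [Algebra.IsCentral F D] [FiniteDimensional F D] : Subgroup Dˣ :=
  oneUnitsDivision F D ⊓ ((reducedNorm F D).comp (Units.coeHom D)).ker

theorem oneUnitsNrdOne_le [Algebra.IsCentral F D] [FiniteDimensional F D] :
    oneUnitsNrdOne F D ≤ oneUnitsDivision F D := inf_le_left

theorem map_mem_oneUnitsDivision [FiniteDimensional F D] {u : Fˣ} (hu : u ∈ oneUnitsField F) :
    Units.map (algebraMap F D : F →* D) u ∈ oneUnitsDivision F D := by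
  have hu' : valuation F ((u : F) - 1) < 1 := hu
  change valuation F (Algebra.norm F (algebraMap F D (u : F) - 1)) < 1
  rw [← map_one (algebraMap F D), ← map_sub, Algebra.norm_algebraMap, map_pow]
  exact pow_lt_one₀ zero_le hu' Module.finrank_pos.ne'

variable [TopologicalSpace D] [IsModuleTopology F D]

instance oneUnitsDivision_isTopologicalGroup [FiniteDimensional F D] :
    IsTopologicalGroup (oneUnitsDivision F D) :=
  have := IsModuleTopology.isTopologicalRing F D
  inferInstance

instance oneUnitsNrdOne_isTopologicalGroup [Algebra.IsCentral F D] [FiniteDimensional F D] :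
    IsTopologicalGroup (oneUnitsNrdOne F D) :=
  have := IsModuleTopology.isTopologicalRing F D
  inferInstance

/-- The inclusion of the elements of reduced norm `1` of `I₁` into `I₁`. -/
noncomputable def nrdOneInclusion [Algebra.IsCentral F D] [FiniteDimensional F D] :
    oneUnitsNrdOne F D →ₜ* oneUnitsDivision F D where
  toMonoidHom := Subgroup.inclusion (oneUnitsNrdOne_le F D)
  continuous_toFun := continuous_inclusion (oneUnitsNrdOne_le F D)

/-- The inclusion of `1 + π_F O_F` into `I₁`. -/
noncomputable def fieldInclusion [FiniteDimensional F D] :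
    oneUnitsField F →ₜ* oneUnitsDivision F D where
  toMonoidHom := ((Units.map (algebraMap F D : F →* D)).comp (oneUnitsField F).subtype).codRestrict
    _ fun u => map_mem_oneUnitsDivision F D u.2
  continuous_toFun := by
    refine Continuous.subtype_mk ?_ _
    exact (Continuous.units_map (algebraMap F D : F →* D) (continuous_algebraMap F D)).comp
      continuous_subtype_val

end Groups

/-! ### First continuous cohomology with trivial coefficients -/

section Cohomology

variable (K : Type u) [Field K] [TopologicalSpace K] [IsTopologicalRing K]

/-- The additive group of `K` as a trivial representation of `G`. -/
abbrev trivialTopRep (G : Type u) [Group G] : TopRep K G :=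
  TopRep.of (ContRepresentation.trivial K G K)

/-- The continuous cohomology group `H¹(G, K)` with trivial action on `K`. -/
noncomputable abbrev contH1 (G : Type u) [Group G] [TopologicalSpace G] [IsTopologicalGroup G] :
    TopModuleCat K :=
  continuousCohomology 1 (trivialTopRep K G)

variable {G H : Type u} [Group G] [TopologicalSpace G] [IsTopologicalGroup G]
  [Group H] [TopologicalSpace H] [IsTopologicalGroup H]

/-- The pull-back (restriction) map `H¹(G, K) → H¹(H, K)` along a continuous homomorphism `H → G`. -/
noncomputable def contH1Map (φ : H →ₜ* G) : contH1 K G →ₗ[K] contH1 K H :=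
  (ContinuousCohomology.map (X := trivialTopRep K G) (Y := trivialTopRep K H) φ
    (TopRep.ofHom ⟨ContinuousLinearMap.id K K, fun _ => rfl⟩) 1).hom.toLinearMap

end Cohomology

/-! With trivial action a degree-one coboundary is zero, so `H¹(G, K)` is the space of continuous
homomorphisms `G → K`, and each of these is trivial on an open subgroup because `K` is discrete. The
proof computes with such homomorphisms along the filtration `Uⁿ = 1 + ϖⁿ O_D` of `I₁` and its
analogue for `F`. Both sets of hypotheses give `p ∤ d`.

Splitting. Principal units have roots of every order prime to `p`
(`IsLocalValuation.exists_pow_eq`). Hence the reduced norm of an element of `I₁` is a `d`-th power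
from `1 + π O_F`, and `I₁` is the product of its elements of reduced norm one and the central
subgroup `1 + π O_F`. A homomorphism is thus determined by its two restrictions, and any two glue
because `d` is invertible in `K` (`contHom_comap_prod_bijective`).

Reduced norm one. Extend a homomorphism by zero on `1 + π O_F`; the extension vanishes on `U²`, by
descending induction. On `Uⁿ / Uⁿ⁺¹ ≅ k_D` with `n ≥ 2` it is an additive map `H`, and the
commutators of `1 + aϖ` and `1 + bϖⁿ⁻¹` give `H (a σ(b)) = H (b σⁿ⁻¹(a))`, where `σ` is conjugation
by `ϖ`. If `σⁿ ≠ 1` this forces `H = 0`. If `σⁿ = 1`, then `H` is `σ`-invariant, so `d H(a) = H (Tr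
a)`, and `Tr a` comes from `1 + π O_F`. So only `U¹ / U² ≅ k_D` contributes. The input is that `σ`
has order `d` and `π` is a unit times `ϖ ^ d` (`division_structure`), which follows from
Cayley–Hamilton and a count of lattice indices.

The field. In characteristic zero with `e + 1 < p`, homomorphisms kill the units in `1 + π ^ (e + 1)
O_F`, and the quotient is elementary abelian of order `p ^ (e f)`. In characteristic `p`, the
homomorphisms form a countable union of finite-dimensional spaces, and `1 + π ^ m` with `p ∤ m`
yields a new homomorphism at every such level. -/

open scoped Topology

/-! ### Continuous homomorphisms to the coefficient field. -/

section ContHom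

variable (K : Type u) [Field K] [TopologicalSpace K] [IsTopologicalRing K]

/-- Continuous homomorphisms from a topological group to the additive group of `K`. -/
def contHom (G : Type u) [Group G] [TopologicalSpace G] : Submodule K (Additive G →+ K) where
  carrier := {f | Continuous fun g : G => f (Additive.ofMul g)}
  zero_mem' := continuous_const
  add_mem' hf hg := Continuous.add hf hg
  smul_mem' _ _ hf := continuous_const.mul hf

variable {K}

namespace contHom

variable {G H : Type u} [Group G] [TopologicalSpace G] [Group H] [TopologicalSpace H]

instance : FunLike (contHom K G) G K where
  coe f g := f.1 (Additive.ofMul g)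
  coe_injective _ _ h := Subtype.ext (AddMonoidHom.ext fun x => congrFun h x.toMul)

theorem continuous (f : contHom K G) : Continuous (f : G → K) := f.2

@[ext] protected theorem ext {f g : contHom K G} (h : ∀ x : G, f x = g x) : f = g :=
  DFunLike.ext f g h

@[simp] protected theorem map_mul (f : contHom K G) (x y : G) : f (x * y) = f x + f y :=
  f.1.map_add (Additive.ofMul x) (Additive.ofMul y)

@[simp] protected theorem map_one (f : contHom K G) : f 1 = 0 := f.1.map_zero

@[simp] protected theorem map_inv (f : contHom K G) (x : G) : f x⁻¹ = - f x := f.1.map_neg (Additive.ofMul x)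

@[simp] protected theorem map_pow (f : contHom K G) (x : G) (n : ℕ) : f (x ^ n) = n * f x :=
  (f.1.map_nsmul n (Additive.ofMul x)).trans (nsmul_eq_mul _ _)

@[simp] theorem add_apply (f g : contHom K G) (x : G) : (f + g) x = f x + g x := rfl

@[simp] theorem smul_apply (c : K) (f : contHom K G) (x : G) : (c • f) x = c * f x := rfl

@[simp] theorem zero_apply (x : G) : (0 : contHom K G) x = 0 := rfl

/-- Build a continuous homomorphism from a function. -/
def mk (f : G → K) (hf : Continuous f) (hmul : ∀ x y, f (x * y) = f x + f y) : contHom K G :=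
  ⟨AddMonoidHom.mk' (fun x => f x.toMul) fun x y => hmul x.toMul y.toMul, hf⟩

/-- Restriction of continuous homomorphisms. -/
def comap (φ : H →ₜ* G) : contHom K G →ₗ[K] contHom K H where
  toFun f := mk (fun x => f (φ x)) (f.2.comp φ.continuous_toFun)
    fun x y => by rw [map_mul, contHom.map_mul]
  map_add' _ _ := rfl
  map_smul' _ _ := rfl

@[simp] theorem comap_apply (φ : H →ₜ* G) (f : contHom K G) (x : H) : comap φ f x = f (φ x) := rfl

end contHom

end ContHom

/-! ### Degree-one cohomology as continuous homomorphisms. -/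

section Cohomology

open CategoryTheory TopRep ContRepresentation ContinuousCohomology

variable (K : Type u) [Field K] [TopologicalSpace K] [IsTopologicalRing K]
variable (G H : Type u) [Group G] [TopologicalSpace G] [IsTopologicalGroup G]
  [Group H] [TopologicalSpace H] [IsTopologicalGroup H]

/-- The value at `(g, h)` of a homogeneous `1`-cochain. -/
def cochainEval (σ : (homogeneousCochains (trivialTopRep K G)).X 1) (g h : G) : K :=
  ((σ.1 : C(G, C(G, K))) g) h

variable {K G H}

theorem cochainEval_invariant (σ : (homogeneousCochains (trivialTopRep K G)).X 1) (a g h : G) :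
    cochainEval K G σ (a⁻¹ * g) (a⁻¹ * h) = cochainEval K G σ g h := by
  have := DFunLike.ext_iff.1 (DFunLike.ext_iff.1 (σ.2 a) g) h
  exact this

theorem cochain_zero_invariant (τ : (homogeneousCochains (trivialTopRep K G)).X 0) (a g : G) :
    (τ.1 : C(G, K)) (a⁻¹ * g) = (τ.1 : C(G, K)) g := by
  have := DFunLike.ext_iff.1 (τ.2 a) g
  exact this

/-- An invariant homogeneous `0`-cochain is a constant function, so its coboundary vanishes. Hence
classes in degree one are the same as cocycles. -/
theorem homogeneousCochains_d_zero_one :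
    (homogeneousCochains (trivialTopRep K G)).d 0 1 = 0 := by
  ext τ
  apply Subtype.ext
  refine ContinuousMap.ext fun g => ContinuousMap.ext fun h => ?_
  have h1 := homogeneousCochains.d_apply (trivialTopRep K G) 0 τ
  have h2 : ((((homogeneousCochains (trivialTopRep K G)).d 0 1).hom τ).1 : C(G, C(G, K))) g h
     = (τ.1 : C(G, K)) h - (τ.1 : C(G, K)) g := by
    rw [h1]
    rfl
  refine h2.trans ?_
  have h3 := cochain_zero_invariant τ (g * h⁻¹) g
  rw [mul_inv_rev, inv_inv, mul_assoc, inv_mul_cancel, mul_one] at h3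
  rw [h3, sub_self]
  rfl

theorem cochain_d_one_apply (σ : (homogeneousCochains (trivialTopRep K G)).X 1) (a b c : G) :
    (((((homogeneousCochains (trivialTopRep K G)).d 1 2).hom σ).1 : C(G, C(G, C(G, K)))) a b) c
     = cochainEval K G σ b c - (cochainEval K G σ a c - cochainEval K G σ a b) := by
  rw [homogeneousCochains.d_apply (trivialTopRep K G) 1 σ]
  rfl

/-- The homogeneous cochain `(g, h) ↦ f h - f g` of a continuous homomorphism `f`. -/
def cochainOfContHom (f : contHom K G) : (homogeneousCochains (trivialTopRep K G)).X 1 :=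
  ⟨(⟨fun g => (⟨f, f.2⟩ : C(G, K)) - ContinuousMap.const G (f g),
    continuous_const.sub (ContinuousMap.continuous_const'.comp f.2)⟩ : C(G, C(G, K))), by
    intro a
    refine ContinuousMap.ext fun g => ContinuousMap.ext fun h => ?_
    change f (a⁻¹ * h) - f (a⁻¹ * g) = f h - f g
    simp⟩

theorem cochainEval_cochainOfContHom (f : contHom K G) (g h : G) :
    cochainEval K G (cochainOfContHom f) g h = f h - f g := rfl

theorem d_cochainOfContHom (f : contHom K G) :
    ((homogeneousCochains (trivialTopRep K G)).d 1 2).hom (cochainOfContHom f) = 0 := by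
  apply Subtype.ext
  refine ContinuousMap.ext fun a => ContinuousMap.ext fun b => ContinuousMap.ext fun c => ?_
  refine (cochain_d_one_apply (cochainOfContHom f) a b c).trans ?_
  simp only [cochainEval_cochainOfContHom]
  change _ = (0 : K)
  ring

theorem cochainEval_of_mem_ker {σ : (homogeneousCochains (trivialTopRep K G)).X 1}
    (hσ : ((homogeneousCochains (trivialTopRep K G)).d 1 2).hom σ = 0) (a b c : G) :
    cochainEval K G σ a c = cochainEval K G σ a b + cochainEval K G σ b c := by
  have h := cochain_d_one_apply σ a b c
  rw [hσ] at h
  have h' : (0 : K) = _ := h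
  linear_combination h'

/-- Homogeneous continuous `1`-cocycles are continuous homomorphisms. -/
def kerEquivContHom :
    ((homogeneousCochains (trivialTopRep K G)).d 1 2).hom.ker ≃ₗ[K] contHom K G where
  toFun σ := contHom.mk (cochainEval K G σ.1 1) (map_continuous (σ.1.1 1 : C(G, K)))
    fun x y => by
      rw [cochainEval_of_mem_ker σ.2 1 x (x * y)]
      -- Invariance translates the pair `(x, x * y)` back to `(1, y)`.
      conv_lhs => rw [← cochainEval_invariant _ x x]
      rw [inv_mul_cancel, inv_mul_cancel_left]
  map_add' _ _ := rfl
  map_smul' _ _ := rfl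
  invFun f := ⟨cochainOfContHom f, d_cochainOfContHom f⟩
  left_inv σ := by
    apply Subtype.ext
    apply Subtype.ext
    refine ContinuousMap.ext fun a => ContinuousMap.ext fun b => ?_
    change cochainEval K G σ.1 1 b - cochainEval K G σ.1 1 a = cochainEval K G σ.1 a b
    rw [cochainEval_of_mem_ker σ.2 1 a b, add_sub_cancel_left]
  right_inv f := by
    apply contHom.ext
    intro x
    change f x - f 1 = f x
    simp

instance : IsIso (π (trivialTopRep K G) 1) :=
  (homogeneousCochains (trivialTopRep K G)).isIso_homologyπ 0 1 (by simp)
    homogeneousCochains_d_zero_one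

variable (K G) in
/-- Cocycles in the sense of homological algebra form the kernel of the differential. -/
noncomputable def cocyclesOneIso : cocycles (trivialTopRep K G) 1 ≅
    TopModuleCat.of K ((homogeneousCochains (trivialTopRep K G)).d 1 2).hom.ker :=
  Limits.KernelFork.mapIsoOfIsLimit
    ((homogeneousCochains (trivialTopRep K G)).cyclesIsKernel 1 2 (by simp))
    (TopModuleCat.isLimitKer _) (Iso.refl _)

theorem cocyclesOneIso_hom_kerι : (cocyclesOneIso K G).hom ≫ TopModuleCat.kerι _ =
    (homogeneousCochains (trivialTopRep K G)).iCycles 1 :=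
  (Limits.KernelFork.mapOfIsLimit_ι
    (.ofι ((homogeneousCochains (trivialTopRep K G)).iCycles 1)
      ((homogeneousCochains (trivialTopRep K G)).iCycles_d 1 2))
    (TopModuleCat.isLimitKer ((homogeneousCochains (trivialTopRep K G)).d 1 2))
    (𝟙 (Arrow.mk ((homogeneousCochains (trivialTopRep K G)).d 1 2)))).trans (Category.comp_id _)

variable (K G) in
/-- `H¹(G, K)` with trivial action is the space of continuous homomorphisms `G → K`. -/
noncomputable def contH1Equiv : contH1 K G ≃ₗ[K] contHom K G :=
  ((asIso (π (trivialTopRep K G) 1)).symm ≪≫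
    cocyclesOneIso K G).toContinuousLinearEquiv.toLinearEquiv.trans kerEquivContHom

/-- `contH1Equiv` is assembled from inverses of abstract isomorphisms; this formula on classes of
cocycles makes it usable. -/
theorem contH1Equiv_π_apply (z : cocycles (trivialTopRep K G) 1) (g : G) :
    contH1Equiv K G ((π (trivialTopRep K G) 1).hom z) g =
      cochainEval K G (((homogeneousCochains (trivialTopRep K G)).iCycles 1).hom z) 1 g := by
  have h1 : (inv (π (trivialTopRep K G) 1)).hom ((π (trivialTopRep K G) 1).hom z) = z :=
    congr($(IsIso.hom_inv_id (π (trivialTopRep K G) 1)).hom z)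
  have h2 : ((cocyclesOneIso K G).hom.hom z).1 =
    ((homogeneousCochains (trivialTopRep K G)).iCycles 1).hom z :=
    congr($(cocyclesOneIso_hom_kerι (K := K) (G := G)).hom z)
  rw [← h2]
  change cochainEval K G ((cocyclesOneIso K G).hom.hom
    ((inv (π (trivialTopRep K G) 1)).hom ((π (trivialTopRep K G) 1).hom z))).1 1 g = _
  rw [h1]

/-- Naturality: it turns the statement about restriction maps in cohomology into one about
restricting homomorphisms. Every class comes from a cocycle, where both sides are explicit. -/
theorem contH1Equiv_contH1Map (φ : H →ₜ* G) (x : contH1 K G) :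
    contH1Equiv K H (contH1Map K φ x) = contHom.comap φ (contH1Equiv K G x) := by
  obtain ⟨z, rfl⟩ : ∃ z, (π (trivialTopRep K G) 1).hom z = x :=
    ⟨(inv (π (trivialTopRep K G) 1)).hom x, congr($(IsIso.inv_hom_id (π (trivialTopRep K G) 1)).hom x)⟩
  set f : TopRep.res (φ : H →* G) (trivialTopRep K G) ⟶ trivialTopRep K H :=
    TopRep.ofHom ⟨ContinuousLinearMap.id K K, fun _ => rfl⟩ with hf
  have h1 : contH1Map K φ ((π (trivialTopRep K G) 1).hom z) =
      (π (trivialTopRep K H) 1).hom ((cocyclesMap φ f 1).hom z) :=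
    congr($(π_map φ f 1).hom z)
  have h2 : ((homogeneousCochains (trivialTopRep K H)).iCycles 1).hom ((cocyclesMap φ f 1).hom z) =
      ((cochainsMap φ f).f 1).hom (((homogeneousCochains (trivialTopRep K G)).iCycles 1).hom z) :=
    congr($(HomologicalComplex.cyclesMap_i (cochainsMap φ f) 1).hom z)
  rw [h1]
  apply contHom.ext
  intro g
  rw [contH1Equiv_π_apply, h2, contHom.comap_apply, contH1Equiv_π_apply]
  change cochainEval K G _ (φ 1) (φ g) = _
  rw [map_one]

end Cohomology

/-! ### Valuations of locally compact division rings -/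


/-- `v` is a discrete valuation with uniformizer `ϖ` and compact unit ball, defining the
topology of the division ring `R`. -/
structure IsLocalValuation {R Γ : Type*} [DivisionRing R] [TopologicalSpace R]
    [LinearOrderedCommGroupWithZero Γ] (v : Valuation R Γ) (ϖ : R) : Prop where
  ne_zero : ϖ ≠ 0
  lt_one : v ϖ < 1
  exists_zpow : ∀ x, x ≠ 0 → ∃ n : ℤ, v x = v ϖ ^ n
  isCompact : IsCompact {x | v x ≤ 1}
  mem_nhds_zero : ∀ s : Set R, s ∈ 𝓝 0 ↔ ∃ n : ℕ, {x | v x ≤ v ϖ ^ n} ⊆ s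

section Topology
variable (F D : Type*) [Field F] [ValuativeRel F] [TopologicalSpace F]
  [IsNonarchimedeanLocalField F] [DivisionRing D] [Algebra F D]

theorem t2Space_of_isNonarchimedeanLocalField : T2Space F := by
  let := IsTopologicalAddGroup.rightUniformSpace F
  have := isUniformAddGroup_of_addCommGroup (G := F)
  infer_instance

theorem continuous_norm_equivFun_symm {ι : Type*} [Fintype ι] (b : Module.Basis ι F D) :
    Continuous fun c : ι → F => Algebra.norm F (b.equivFun.symm c) := by
  classical
  have : (fun c : ι → F => Algebra.norm F (b.equivFun.symm c)) =
      fun c => (∑ i, c i • Algebra.leftMulMatrix b (b i)).det := by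
    funext c
    simp only [Algebra.norm_eq_matrix_det b, Module.Basis.equivFun_symm_apply, map_sum, map_smul]
  rw [this]
  refine Continuous.matrix_det ?_
  refine continuous_finsetSum _ fun i _ => ?_
  exact (continuous_apply i).smul continuous_const

variable [FiniteDimensional F D]

/-- Comparison of the norm form with the maximum norm of the coordinates. -/
theorem exists_norm_form_bounds {ι : Type*} [Fintype ι] (b : Module.Basis ι F D) :
    ∃ γ C : ValueGroupWithZero F, γ ≠ 0 ∧ ∀ (x : D) (μ : ValueGroupWithZero F),
      ((∀ i, valuation F (b.equivFun x i) ≤ μ) →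
        valuation F (Algebra.norm F x) ≤ C * μ ^ Module.finrank F D) ∧
      ((∃ i, μ ≤ valuation F (b.equivFun x i)) →
        γ * μ ^ Module.finrank F D ≤ valuation F (Algebra.norm F x)) := by
  classical
  let v := valuation F
  let n := Module.finrank F D
  let N : (ι → F) → F := fun c => Algebra.norm F (b.equivFun.symm c)
  have hn : n ≠ 0 := Module.finrank_pos.ne'
  have hN : Continuous N := continuous_norm_equivFun_symm F D b
  -- `S` is the sphere of coordinate vectors of maximum norm `1`. It is compact and, `D` being a
  -- division algebra, the norm form has no zero on it; homogeneity carries the bounds on `S` to all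
  -- of `D`.
  let S : Set (ι → F) := Set.pi Set.univ (fun _ => {x : F | v x ≤ 1}) \
    Set.pi Set.univ (fun _ => {x : F | v x < 1})
  have hS : IsCompact S :=
    (isCompact_univ_pi fun _ => IsNonarchimedeanLocalField.isCompact_closedBall F 1).diff
      (isOpen_set_pi Set.finite_univ fun _ _ => isOpen_valuation_lt_one F)
  have hS0 : ∀ c ∈ S, N c ≠ 0 := by
    intro c hc h
    rw [Algebra.norm_eq_zero_iff, LinearEquiv.map_eq_zero_iff] at h
    subst h
    apply hc.2
    intro i _
    simp [v]
  obtain ⟨γ, C, hγ, hγC⟩ := valuation_bounds_of_isCompact F hS hN hS0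
  let m : D → ValueGroupWithZero F := fun x => Finset.univ.sup fun i => v (b.equivFun x i)
  have hm : ∀ x i, v (b.equivFun x i) ≤ m x := fun x i =>
    Finset.le_sup (f := fun i => v (b.equivFun x i)) (Finset.mem_univ i)
  have hm0 : ∀ x, x ≠ 0 → ∃ a : F, a ≠ 0 ∧ v a = m x ∧ b.equivFun (a⁻¹ • x) ∈ S := by
    intro x hx
    have : Nonempty ι := b.index_nonempty
    obtain ⟨i, -, hi⟩ := Finset.exists_mem_eq_sup Finset.univ Finset.univ_nonempty
      (fun i => v (b.equivFun x i))
    change m x = _ at hi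
    have hne : b.equivFun x i ≠ 0 := by
      intro h0
      apply hx
      rw [← LinearEquiv.map_eq_zero_iff b.equivFun]
      funext j
      have := hm x j
      rw [hi, h0, map_zero, le_zero_iff] at this
      simpa [v] using this
    refine ⟨_, hne, hi.symm, ?_, ?_⟩
    · intro j _
      have hj := hm x j
      rw [hi] at hj
      have hpos : v (b.equivFun x i) ≠ 0 := by simpa [v] using hne
      simp only [map_smul, Pi.smul_apply, smul_eq_mul, Set.mem_ofPred_eq, map_mul, map_inv₀]
      rw [inv_mul_le_iff₀ (zero_lt_iff.2 hpos), mul_one]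
      exact hj
    · intro h
      have h1 := h i (Set.mem_univ _)
      rw [map_smul, Pi.smul_apply, smul_eq_mul, inv_mul_cancel₀ hne] at h1
      exact absurd h1 (by simp)
  have hbd : ∀ x, x ≠ 0 → γ * m x ^ n ≤ v (Algebra.norm F x) ∧
      v (Algebra.norm F x) ≤ C * m x ^ n := by
    intro x hx
    obtain ⟨a, ha, hax, hS'⟩ := hm0 x hx
    have h := hγC _ hS'
    have hx' : Algebra.norm F x = N (b.equivFun (a⁻¹ • x)) * a ^ n := by
      simp only [N, LinearEquiv.symm_apply_apply]
      rw [← Algebra.norm_algebraMap (S := D), ← map_mul, ← Algebra.commutes, ← Algebra.smul_def,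
        smul_inv_smul₀ ha]
    rw [hx', map_mul, map_pow, hax]
    exact ⟨mul_le_mul_left h.1 _, mul_le_mul_left h.2 _⟩
  refine ⟨γ, C, hγ, fun x μ => ?_⟩
  rcases eq_or_ne x 0 with rfl | hx
  · constructor
    · intro _
      rw [Algebra.norm_zero, map_zero]
      exact zero_le
    · rintro ⟨i, hi⟩
      rw [map_zero, Pi.zero_apply, map_zero, le_zero_iff] at hi
      rw [hi, zero_pow hn, mul_zero]
      exact zero_le
  · constructor
    · intro h
      exact (hbd x hx).2.trans (mul_le_mul_right
        (pow_le_pow_left₀ zero_le (Finset.sup_le fun i _ => h i) n) _)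
    · rintro ⟨i, hi⟩
      exact (mul_le_mul_right (pow_le_pow_left₀ zero_le (hi.trans (hm x i)) n) _).trans
        (hbd x hx).1

/-- The values of `D` form a subgroup of the cyclic value group of `F`, hence a cyclic group. It is
nontrivial because it contains values of elements of `F`; a generator or its inverse has value below
`1`. -/
theorem exists_uniformizer : ∃ ϖ : D, ϖ ≠ 0 ∧ divisionValuation F D ϖ < 1 ∧
    ∀ x : D, x ≠ 0 → ∃ n : ℤ, divisionValuation F D x = divisionValuation F D ϖ ^ n := by
  let φ : Dˣ →* (ValueGroupWithZero F)ˣ :=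
    Units.map (divisionValuation F D : D →* ValueGroupWithZero F)
  obtain ⟨⟨g, x, rfl⟩, hg⟩ := (inferInstance : IsCyclic φ.range)
  have key : ∀ y : Dˣ, ∃ n : ℤ, divisionValuation F D y = divisionValuation F D x ^ n := by
    intro y
    obtain ⟨n, hn⟩ := hg ⟨φ y, y, rfl⟩
    refine ⟨n, ?_⟩
    have := congrArg (fun z : φ.range => ((z : (ValueGroupWithZero F)ˣ) : ValueGroupWithZero F)) hn
    simpa [φ] using this.symm
  obtain ⟨a, ha0, ha1⟩ := Valuation.IsNontrivial.exists_lt_one (v := valuation F)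
  have ha0' : a ≠ 0 := by simpa using ha0
  have ha : divisionValuation F D (algebraMap F D a) < 1 := by
    change valuation F (Algebra.norm F (algebraMap F D a)) < 1
    rw [Algebra.norm_algebraMap, map_pow]
    exact pow_lt_one₀ zero_le ha1 Module.finrank_pos.ne'
  have hx1 : divisionValuation F D x ≠ 1 := by
    intro h
    obtain ⟨n, hn⟩ := key (Units.mk0 (algebraMap F D a) (by simpa using ha0'))
    rw [h, one_zpow] at hn
    exact ha.ne hn
  rcases lt_or_gt_of_ne hx1 with h | h
  · exact ⟨x, x.ne_zero, h, fun y hy => key (Units.mk0 y hy)⟩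
  · refine ⟨((x⁻¹ : Dˣ) : D), Units.ne_zero _, ?_, fun y hy => ?_⟩
    · rw [Units.val_inv_eq_inv_val, map_inv₀]
      exact inv_lt_one_of_one_lt₀ h
    · obtain ⟨n, hn⟩ := key (Units.mk0 y hy)
      refine ⟨-n, ?_⟩
      rw [Units.val_inv_eq_inv_val, map_inv₀, inv_zpow', neg_neg]
      exact hn

variable [TopologicalSpace D] [IsModuleTopology F D]

theorem continuous_algebraNorm : Continuous (Algebra.norm F : D → F) := by
  have h : Continuous (Module.finBasis F D).equivFun :=
    IsModuleTopology.continuous_of_linearMap (Module.finBasis F D).equivFun.toLinearMap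
  refine ((continuous_norm_equivFun_symm F D (Module.finBasis F D)).comp h).congr fun x => ?_
  simp

/-- The bounds on the norm form make valuation balls and coordinate balls cofinal, so the valuation
defines the module topology. A small valuation ball is closed in a compact coordinate ball, and
multiplication by a power of `ϖ⁻¹` carries it onto the unit ball. -/
theorem exists_isLocalValuation : ∃ ϖ : D, IsLocalValuation (divisionValuation F D) ϖ := by
  have := IsModuleTopology.toContinuousAdd F D
  have := t2Space_of_isNonarchimedeanLocalField F
  obtain ⟨ϖ, h0, h1, h2⟩ := exists_uniformizer F D
  let b := Module.finBasis F D
  have hn : Module.finrank F D ≠ 0 := Module.finrank_pos.ne'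
  obtain ⟨γ, C, hγ, hb⟩ := exists_norm_form_bounds F D b
  have hbc : Continuous b.equivFun :=
    IsModuleTopology.continuous_of_linearMap b.equivFun.toLinearMap
  have hbc' : Continuous b.equivFun.symm :=
    IsModuleTopology.continuous_of_linearMap b.equivFun.symm.toLinearMap
  have hϖ : divisionValuation F D ϖ ≠ 0 := by simpa using h0
  have hball : ∀ α : ValueGroupWithZero F, α ≠ 0 → {y : F | valuation F y ≤ α} ∈ 𝓝 (0 : F) := by
    intro α hα
    rw [IsValuativeTopology.mem_nhds_zero_iff]
    exact ⟨Units.mk0 α hα, fun y hy => (show valuation F y < α from hy).le⟩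
  -- elements of small coordinates / small valuation
  have hsmall : ∀ α : ValueGroupWithZero F, α ≠ 0 → ∃ n : ℕ, ∀ x : D,
      divisionValuation F D x ≤ divisionValuation F D ϖ ^ n →
      ∀ i, valuation F (b.equivFun x i) < α := by
    intro α hα
    obtain ⟨n, hn'⟩ := exists_pow_lt₀ h1
      (Units.mk0 _ (mul_ne_zero hγ (pow_ne_zero (Module.finrank F D) hα)))
    refine ⟨n + 1, fun x hx i => ?_⟩
    by_contra hcon
    have h3 := (hb x α).2 ⟨i, not_lt.1 hcon⟩
    have h4 := (hn'.le.trans h3).trans hx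
    exact absurd h4 (not_le.2 (pow_lt_pow_right_of_lt_one₀ (zero_lt_iff.2 hϖ) h1 (Nat.lt_succ_self n)))
  refine ⟨ϖ, h0, h1, h2, ?_, ?_⟩
  · obtain ⟨n, hn'⟩ := hsmall 1 one_ne_zero
    have hc1 : IsCompact {x : D | ∀ i, valuation F (b.equivFun x i) ≤ 1} := by
      have h5 := (isCompact_univ_pi fun _ : Fin (Module.finrank F D) =>
        IsNonarchimedeanLocalField.isCompact_closedBall F 1).image hbc'
      convert h5 using 1
      ext x
      constructor
      · intro hx
        exact ⟨b.equivFun x, fun i _ => hx i, by simp⟩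
      · rintro ⟨c, hc, rfl⟩ i
        have := hc i (Set.mem_univ i)
        rwa [LinearEquiv.apply_symm_apply]
    have hc2 : IsCompact {x : D | divisionValuation F D x ≤ divisionValuation F D ϖ ^ n} := by
      refine hc1.of_isClosed_subset ?_ fun x hx i => (hn' x hx i).le
      exact (IsNonarchimedeanLocalField.isCompact_closedBall F
        (divisionValuation F D ϖ ^ n)).isClosed.preimage (continuous_algebraNorm F D)
    have hc3 := hc2.image (IsModuleTopology.continuous_of_linearMap
      (LinearMap.mulRight F ((ϖ ^ n)⁻¹)))
    convert hc3 using 1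
    have hϖn : ϖ ^ n ≠ 0 := pow_ne_zero n h0
    ext x
    constructor
    · intro hx
      refine ⟨x * ϖ ^ n, ?_, by simp [hϖn]⟩
      change divisionValuation F D (x * ϖ ^ n) ≤ divisionValuation F D ϖ ^ n
      rw [map_mul, map_pow]
      exact mul_le_of_le_one_left' hx
    · rintro ⟨y, hy, rfl⟩
      change divisionValuation F D (y * (ϖ ^ n)⁻¹) ≤ 1
      rw [map_mul, map_inv₀, map_pow]
      exact mul_inv_le_one_of_le₀ hy zero_le
  · intro s
    constructor
    · intro hs
      have h6 : b.equivFun.symm ⁻¹' s ∈ 𝓝 (0 : Fin (Module.finrank F D) → F) :=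
        hbc'.continuousAt.preimage_mem_nhds (by rwa [map_zero])
      rw [nhds_pi, Filter.mem_pi] at h6
      obtain ⟨I, -, t, ht, hts⟩ := h6
      have h7 : ∀ i, ∃ n : ℕ, ∀ x : D,
          divisionValuation F D x ≤ divisionValuation F D ϖ ^ n → b.equivFun x i ∈ t i := by
        intro i
        obtain ⟨α, hα⟩ := (IsValuativeTopology.mem_nhds_zero_iff _).1 (ht i)
        obtain ⟨n, hn'⟩ := hsmall α α.ne_zero
        exact ⟨n, fun x hx => hα (hn' x hx i)⟩
      choose k hk using h7
      refine ⟨Finset.univ.sup k, fun x hx => ?_⟩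
      have hx' : divisionValuation F D x ≤ divisionValuation F D ϖ ^ Finset.univ.sup k := hx
      rw [← b.equivFun.symm_apply_apply x]
      refine hts fun i _ => hk i x (hx'.trans ?_)
      exact pow_le_pow_right_of_le_one' h1.le (Finset.le_sup (Finset.mem_univ i))
    · rintro ⟨n, hn'⟩
      refine Filter.mem_of_superset ?_ hn'
      refine (continuous_algebraNorm F D).continuousAt.preimage_mem_nhds
        (t := {y : F | valuation F y ≤ divisionValuation F D ϖ ^ n}) ?_
      rw [Algebra.norm_zero]
      exact hball _ (pow_ne_zero n hϖ)

theorem divisionValuation_self : divisionValuation F F = valuation F := by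
  ext x
  change valuation F (Algebra.norm F x) = _
  rw [Algebra.norm_self]
  rfl

theorem exists_isLocalValuation_field : ∃ π : F, IsLocalValuation (valuation F) π := by
  rw [← divisionValuation_self]
  exact exists_isLocalValuation F F
end Topology

section
variable {R Γ : Type*} [Ring R] [LinearOrderedCommGroupWithZero Γ]
  {v : Valuation R Γ}

theorem Valuation.map_eq_one_of_sub_one_lt {x : R} (hx : v (x - 1) < 1) : v x = 1 := by
  rw [← add_sub_cancel 1 x]
  exact v.map_one_add_of_lt hx

theorem Valuation.ne_zero_of_sub_one_lt {x : R} (hx : v (x - 1) < 1) : x ≠ 0 := by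
  rintro rfl
  simp at hx

theorem Valuation.map_pow_sub_one_le {x : R} (hx : v x ≤ 1) (n : ℕ) :
    v (x ^ n - 1) ≤ v (x - 1) := by
  rw [← geom_sum_mul, map_mul]
  refine mul_le_of_le_one_left' (v.map_sum_le fun i _ => ?_)
  rw [map_pow]
  exact pow_le_one₀ zero_le hx

theorem Valuation.map_natCast_le_one (n : ℕ) : v (n : R) ≤ 1 := by
  induction n with
  | zero => simp
  | succ n ih =>
    rw [Nat.cast_succ]
    exact v.map_add_le ih v.map_one.le

/-- Products of principal units. -/
theorem Valuation.map_mul_sub_one_le {x y : R} {γ : Γ} (hx : v x ≤ 1) (hx' : v (x - 1) ≤ γ)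
    (hy : v (y - 1) ≤ γ) : v (x * y - 1) ≤ γ := by
  have : x * y - 1 = x * (y - 1) + (x - 1) := by noncomm_ring
  rw [this]
  refine v.map_add_le ?_ hx'
  rw [map_mul]
  exact (mul_le_of_le_one_left' hx).trans hy

theorem Valuation.map_natCast_eq_one {p : ℕ} (hp : v (p : R) < 1) {m : ℕ} (hm : m.Coprime p) :
    v (m : R) = 1 := by
  refine le_antisymm (v.map_natCast_le_one m) (not_lt.1 fun h => ?_)
  have h1 : ((m.gcdA p * m + m.gcdB p * p : ℤ) : R) = 1 := by
    rw [mul_comm, mul_comm (m.gcdB p), ← Nat.gcd_eq_gcd_ab, hm.gcd_eq_one]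
    simp
  have hZ : ∀ z : ℤ, v (z : R) ≤ 1 := by
    intro z
    obtain ⟨n, rfl | rfl⟩ := z.eq_nat_or_neg
    · simpa using v.map_natCast_le_one n
    · simpa using v.map_natCast_le_one n
  have h2 : v (1 : R) < 1 := by
    rw [← h1]
    push_cast
    refine v.map_add_lt ?_ ?_
    · rw [map_mul]; exact (mul_le_of_le_one_left' (hZ _)).trans_lt h
    · rw [map_mul]; exact (mul_le_of_le_one_left' (hZ _)).trans_lt hp
  simp at h2

end

/-! ### Principal units: powers, roots and topology. -/

namespace IsLocalValuation

variable {R Γ : Type*} [DivisionRing R] [TopologicalSpace R]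
    [LinearOrderedCommGroupWithZero Γ] {v : Valuation R Γ} {ϖ : R} (h : IsLocalValuation v ϖ)
include h

theorem val_ne_zero : v ϖ ≠ 0 := (v.ne_zero_iff).2 h.ne_zero

theorem val_pos : 0 < v ϖ := zero_lt_iff.2 h.val_ne_zero

theorem lt_zpow_iff (x : R) (n : ℤ) : v x < v ϖ ^ n ↔ v x ≤ v ϖ ^ (n + 1) := by
  rcases eq_or_ne x 0 with rfl | hx
  · simp [zpow_pos h.val_pos]
  obtain ⟨k, hk⟩ := h.exists_zpow x hx
  rw [hk, zpow_lt_zpow_iff_right_of_lt_one₀ h.val_pos h.lt_one,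
    zpow_le_zpow_iff_right_of_lt_one₀ h.val_pos h.lt_one]
  omega

theorem lt_pow_iff (x : R) (n : ℕ) : v x < v ϖ ^ n ↔ v x ≤ v ϖ ^ (n + 1) := by
  have := h.lt_zpow_iff x n
  rwa [zpow_natCast, ← Nat.cast_succ, zpow_natCast] at this

theorem lt_one_iff (x : R) : v x < 1 ↔ v x ≤ v ϖ := by
  simpa using h.lt_pow_iff x 0

theorem exists_mul_pow {x : R} {n : ℕ} (hx : v x ≤ v ϖ ^ n) :
    ∃ y, v y ≤ 1 ∧ x = y * ϖ ^ n := by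
  refine ⟨x * (ϖ ^ n)⁻¹, ?_, ?_⟩
  · rw [map_mul, map_inv₀, map_pow]
    exact mul_inv_le_one_of_le₀ hx zero_le
  · rw [inv_mul_cancel_right₀ (pow_ne_zero n h.ne_zero)]

theorem pow_le_pow {m n : ℕ} (hmn : m ≤ n) : v ϖ ^ n ≤ v ϖ ^ m :=
  pow_le_pow_right_of_le_one' h.lt_one.le hmn

theorem pow_lt_pow {m n : ℕ} (hmn : m < n) : v ϖ ^ n < v ϖ ^ m :=
  pow_lt_pow_right_of_lt_one₀ h.val_pos h.lt_one hmn

/-- In `x ^ p - 1 = (1 + x + ⋯ + x ^ (p - 1)) (x - 1)` the first factor is congruent to `p`, hence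
to `0`, modulo the maximal ideal. So a `p`-th power lies at least one step deeper. -/
theorem map_pow_prime_sub_one_le {p : ℕ} (hp : v (p : R) < 1) {x : R} {n : ℕ}
    (hx : v (x - 1) ≤ v ϖ ^ (n + 1)) : v (x ^ p - 1) ≤ v ϖ ^ (n + 2) := by
  have hx1 : v (x - 1) < 1 := hx.trans_lt (by simpa using h.pow_lt_pow (Nat.succ_pos n))
  have hx2 := v.map_eq_one_of_sub_one_lt hx1
  rw [← geom_sum_mul, map_mul]
  have h1 : v (∑ i ∈ Finset.range p, x ^ i) ≤ v ϖ := by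
    rw [← h.lt_one_iff]
    have : ∑ i ∈ Finset.range p, x ^ i = ∑ i ∈ Finset.range p, (x ^ i - 1) + (p : R) := by
      simp
    rw [this]
    refine v.map_add_lt (v.map_sum_lt one_ne_zero fun i _ => ?_) hp
    exact (v.map_pow_sub_one_le hx2.le i).trans_lt hx1
  calc _ ≤ v ϖ * v ϖ ^ (n + 1) := mul_le_mul' h1 hx
    _ = _ := by rw [← pow_succ']

theorem map_pow_prime_pow_sub_one_le {p : ℕ} (hp : v (p : R) < 1) {x : R}
    (hx : v (x - 1) < 1) (k : ℕ) : v (x ^ p ^ k - 1) ≤ v ϖ ^ (k + 1) := by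
  induction k with
  | zero => simpa using (h.lt_one_iff _).1 hx
  | succ k ih =>
    rw [pow_succ, pow_mul]
    exact h.map_pow_prime_sub_one_le hp ih

section Topology

variable [IsTopologicalRing R]

theorem mem_nhds (a : R) (s : Set R) :
    s ∈ 𝓝 a ↔ ∃ n : ℕ, ∀ x, v (x - a) ≤ v ϖ ^ n → x ∈ s := by
  rw [← add_zero a, ← map_add_left_nhds, Filter.mem_map, h.mem_nhds_zero]
  refine exists_congr fun n => ⟨fun hn x hx => ?_, fun hn x hx => hn (a + x) (by simpa using hx)⟩
  have := @hn (x - a) (by simpa using hx)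
  simpa using this

theorem isOpen_ball (a : R) (n : ℕ) : IsOpen {x | v (x - a) ≤ v ϖ ^ n} := by
  rw [isOpen_iff_mem_nhds]
  intro x hx
  rw [h.mem_nhds]
  refine ⟨n, fun y hy => ?_⟩
  have : y - a = (y - x) + (x - a) := by abel
  change v (y - a) ≤ _
  rw [this]
  exact v.map_add_le hy hx

theorem isClosed_ball (a : R) (n : ℕ) : IsClosed {x | v (x - a) ≤ v ϖ ^ n} := by
  rw [← isOpen_compl_iff, isOpen_iff_mem_nhds]
  intro x hx
  rw [h.mem_nhds]
  refine ⟨n, fun y hy hy' => hx ?_⟩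
  have : x - a = (y - a) - (y - x) := by abel
  change v (x - a) ≤ _
  rw [this]
  exact v.map_sub_le hy' hy

theorem t2Space : T2Space R := by
  refine IsTopologicalAddGroup.t2Space_of_zero_sep fun x hx => ?_
  obtain ⟨k, hk⟩ := h.exists_zpow x hx
  refine ⟨{y | v y ≤ v ϖ ^ (k.toNat + 1)}, (h.mem_nhds_zero _).2 ⟨_, le_rfl⟩, fun hx' => ?_⟩
  have : v x ≤ v ϖ ^ (k.toNat + 1) := hx'
  rw [hk, ← zpow_natCast, zpow_le_zpow_iff_right_of_lt_one₀ h.val_pos h.lt_one] at this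
  omega

/-- Principal units have roots of order prime to the residue characteristic. -/
theorem exists_pow_eq {p : ℕ} (hpr : p.Prime) (hp : v (p : R) < 1) {m : ℕ} (hm : m.Coprime p) {x : R}
    (hx : v (x - 1) < 1) :
    ∃ y, v (y - 1) < 1 ∧ y ^ m = x ∧ ∀ z, Commute x z → Commute y z := by
  have := h.t2Space
  -- The double centralizer is closed and contains the powers of `x`; a root found in it commutes
  -- with whatever commutes with `x`.
  let S : Set R := {y | v (y - 1) ≤ v ϖ ^ 1} ∩ Set.centralizer (Set.centralizer {x})
  have hS : IsCompact S := by
    refine h.isCompact.of_isClosed_subset ((h.isClosed_ball 1 1).inter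
      (Set.isClosed_centralizer _)) fun y hy => ?_
    have h1 : v (y - 1) ≤ v ϖ ^ 1 := hy.1
    rw [pow_one, ← h.lt_one_iff] at h1
    exact (v.map_eq_one_of_sub_one_lt h1).le
  have hx1 := v.map_eq_one_of_sub_one_lt hx
  have hcl : x ∈ (fun y : R => y ^ m) '' S := by
    rw [← (hS.image (continuous_pow m)).isClosed.closure_eq, mem_closure_iff_nhds]
    intro t ht
    rw [h.mem_nhds] at ht
    obtain ⟨n, hn⟩ := ht
    -- With `a` inverse to `m` modulo a high power of `p`, the element `x ^ a` is an approximate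
    -- `m`-th root; compactness of `S` then gives an exact one. The modulus is `p ^ (n + 1)` so that
    -- it exceeds `1` also for `n = 0`.
    obtain ⟨a, b, hab⟩ : ∃ a b : ℕ, a * m = 1 + p ^ n * b := by
      obtain ⟨a, -, ha⟩ := Nat.exists_mul_mod_eq_one_of_coprime
        (Nat.Coprime.pow_right (n + 1) hm) (Nat.one_lt_pow (Nat.succ_ne_zero n) hpr.one_lt)
      refine ⟨a, p * (m * a / p ^ (n + 1)), ?_⟩
      rw [← mul_assoc, ← pow_succ, mul_comm a m]
      conv_lhs => rw [← Nat.mod_add_div (m * a) (p ^ (n + 1)), ha]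
    refine ⟨(x ^ a) ^ m, hn _ ?_, x ^ a, ⟨?_, ?_⟩, rfl⟩
    · rw [← pow_mul, hab, pow_add, pow_one, pow_mul]
      have : x * (x ^ p ^ n) ^ b - x = x * ((x ^ p ^ n) ^ b - 1) := by rw [mul_sub, mul_one]
      rw [this, map_mul, hx1, one_mul]
      refine (v.map_pow_sub_one_le ?_ b).trans
        ((h.map_pow_prime_pow_sub_one_le hp hx n).trans (h.pow_le_pow (Nat.le_succ n)))
      rw [map_pow, hx1, one_pow]
    · change v (x ^ a - 1) ≤ _
      rw [pow_one, ← h.lt_one_iff]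
      exact (v.map_pow_sub_one_le hx1.le a).trans_lt hx
    · intro z hz
      exact (Commute.pow_left (hz x rfl : Commute x z) a).symm
  obtain ⟨y, ⟨hy1, hy2⟩, hyx⟩ := hcl
  refine ⟨y, ?_, hyx, fun z hz => ?_⟩
  · rw [h.lt_one_iff, ← pow_one (v ϖ)]
    exact hy1
  · refine (hy2 z ?_).symm
    rintro _ rfl
    exact hz

/-- Units whose residue class has finite order `m` prime to the residue characteristic lift to
roots of unity. -/
theorem exists_pow_eq_one {p : ℕ} (hpr : p.Prime) (hp : v (p : R) < 1) {m : ℕ} (hm : m.Coprime p) {x : R}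
    (hx0 : v x = 1) (hx : v (x ^ m - 1) < 1) :
    ∃ y, v (y - x) < 1 ∧ y ^ m = 1 := by
  -- `y` is a principal `m`-th root of `x ^ m` and commutes with `x`, so `x * y⁻¹` is a root of
  -- unity in the class of `x`.
  obtain ⟨y, hy1, hy2, hy3⟩ := h.exists_pow_eq hpr hp hm hx
  have hc : Commute x y⁻¹ := ((hy3 x ((Commute.refl x).pow_left m)).inv_left₀).symm
  have hy0 := v.ne_zero_of_sub_one_lt hy1
  refine ⟨x * y⁻¹, ?_, ?_⟩
  · have : x * y⁻¹ - x = x * y⁻¹ * (1 - y) := by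
      rw [mul_sub, mul_one, inv_mul_cancel_right₀ hy0]
    rw [this, map_mul, map_mul, hx0, map_inv₀, v.map_eq_one_of_sub_one_lt hy1, v.map_sub_swap]
    simpa using hy1
  · rw [hc.mul_pow, inv_pow, hy2]
    refine mul_inv_cancel₀ ?_
    rw [← hy2]
    exact pow_ne_zero m hy0

/-- The topology on units also constrains inverses, but for a principal unit `u⁻¹` is as close to
`1` as `u`. The exponent `n + 1` guarantees that `u` is principal. -/
theorem mem_nhds_one_units (s : Set Rˣ) :
    s ∈ 𝓝 (1 : Rˣ) ↔ ∃ n : ℕ, ∀ u : Rˣ, v ((u : R) - 1) ≤ v ϖ ^ (n + 1) → u ∈ s := by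
  constructor
  · intro hs
    rw [Units.isInducing_embedProduct.nhds_eq_comap, Filter.mem_comap] at hs
    obtain ⟨t, ht, hts⟩ := hs
    rw [map_one, Prod.one_eq_mk, mem_nhds_prod_iff] at ht
    obtain ⟨A, hA, B, hB, hAB⟩ := ht
    obtain ⟨n, hn⟩ := (h.mem_nhds 1 A).1 hA
    have hB' : MulOpposite.op ⁻¹' B ∈ 𝓝 (1 : R) :=
      MulOpposite.continuous_op.continuousAt.preimage_mem_nhds hB
    obtain ⟨k, hk⟩ := (h.mem_nhds 1 _).1 hB'
    refine ⟨n + k, fun u hu => hts (hAB ⟨hn _ ?_, hk _ ?_⟩)⟩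
    · exact hu.trans (h.pow_le_pow (by omega))
    · have hu1 : v ((u : R) - 1) < 1 :=
        hu.trans_lt (by simpa using h.pow_lt_pow (Nat.succ_pos (n + k)))
      have hv := v.map_eq_one_of_sub_one_lt hu1
      have h3 : ((u⁻¹ : Rˣ) : R) - 1 = ((u⁻¹ : Rˣ) : R) * (1 - u) := by
        rw [mul_sub, mul_one, Units.inv_mul]
      change v (((u⁻¹ : Rˣ) : R) - 1) ≤ _
      rw [h3, map_mul, Units.val_inv_eq_inv_val, map_inv₀, hv, inv_one, one_mul, v.map_sub_swap]
      exact hu.trans (h.pow_le_pow (by omega))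
  · rintro ⟨n, hn⟩
    refine Filter.mem_of_superset (Units.continuous_val.continuousAt.preimage_mem_nhds
      (t := {x : R | v (x - 1) ≤ v ϖ ^ (n + 1)}) ?_) hn
    exact (h.isOpen_ball 1 (n + 1)).mem_nhds (by simp)

end Topology

end IsLocalValuation

section
variable {Γ : Type*} {R K : Type u} [DivisionRing R] [TopologicalSpace R] [IsTopologicalRing R]
    [LinearOrderedCommGroupWithZero Γ] {v : Valuation R Γ} {ϖ : R} (h : IsLocalValuation v ϖ)
    [Field K] [TopologicalSpace K] [DiscreteTopology K] {G : Subgroup Rˣ}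
include h

/-- The kernel is open because `K` is discrete. This starts all the descending inductions along the
filtration. -/
theorem IsLocalValuation.exists_forall_apply_eq_zero [IsTopologicalRing K] (f : contHom K G) :
    ∃ n : ℕ, ∀ u : G, v (((u : Rˣ) : R) - 1) ≤ v ϖ ^ (n + 1) → f u = 0 := by
  have h1 : (fun u : G => f u) ⁻¹' {0} ∈ 𝓝 (1 : G) :=
    (contHom.continuous f).continuousAt.preimage_mem_nhds (by simp)
  rw [nhds_subtype_eq_comap, Filter.mem_comap] at h1
  obtain ⟨t, ht, hts⟩ := h1
  obtain ⟨n, hn⟩ := (h.mem_nhds_one_units t).1 ht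
  exact ⟨n, fun u hu => hts (hn u hu)⟩

theorem IsLocalValuation.continuous_of_forall_apply_eq_zero (f : G → K)
    (hf : ∀ x y, f (x * y) = f x + f y) (n : ℕ)
    (hn : ∀ u : G, v (((u : Rˣ) : R) - 1) ≤ v ϖ ^ (n + 1) → f u = 0) : Continuous f := by
  have h1 : {u : G | f u = 0} ∈ 𝓝 (1 : G) := by
    rw [nhds_subtype_eq_comap]
    refine Filter.mem_of_superset (Filter.preimage_mem_comap
      ((h.mem_nhds_one_units {u | v ((u : R) - 1) ≤ v ϖ ^ (n + 1)}).2 ⟨n, fun u hu => hu⟩)) ?_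
    exact fun u hu => hn u hu
  refine continuous_iff_continuousAt.2 fun x => ?_
  rw [ContinuousAt, nhds_discrete K, Filter.tendsto_pure]
  filter_upwards [(continuous_const_mul x⁻¹).continuousAt.preimage_mem_nhds
    (show {u : G | f u = 0} ∈ 𝓝 (x⁻¹ * x) by rwa [inv_mul_cancel])] with y hy
  have h2 : f (x⁻¹ * y) = 0 := hy
  rw [← mul_inv_cancel_left x y, hf, h2, add_zero]
end

/-! ### The reduced norm compared with the norm of the regular representation. -/

section ReducedNorm

open scoped Kronecker

/-- Left multiplication by `M` acts on each column separately, so its matrix is the Kronecker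
product of `M` with the identity. -/
theorem Matrix.algebraNorm_eq {L n : Type*} [Field L] [Fintype n] [DecidableEq n]
    (M : Matrix n n L) : Algebra.norm L M = M.det ^ Fintype.card n := by
  rw [Algebra.norm_eq_matrix_det (Matrix.stdBasis L n n)]
  have : Algebra.leftMulMatrix (Matrix.stdBasis L n n) M = M ⊗ₖ (1 : Matrix n n L) := by
    ext ⟨i, j⟩ ⟨k, l⟩
    have hr : ∀ A : Matrix n n L, (Matrix.stdBasis L n n).repr A (i, j) = A i j := fun _ => rfl
    rw [Algebra.leftMulMatrix_eq_repr_mul, Matrix.stdBasis_eq_single, hr,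
      Matrix.kroneckerMap_apply, Matrix.one_apply]
    by_cases hjl : j = l
    · subst hjl
      simp
    · rw [Matrix.mul_single_apply_of_ne _ _ _ _ _ hjl]
      simp [hjl]
  rw [this, Matrix.det_kronecker, Matrix.det_one, one_pow, mul_one]

theorem Algebra.norm_one_tmul {F L A : Type*} [Field F] [Field L] [Algebra F L] [Ring A] [Algebra F A]
    [FiniteDimensional F A] (x : A) :
    Algebra.norm L (1 ⊗ₜ[F] x : L ⊗[F] A) = algebraMap F L (Algebra.norm F x) := by
  rw [Algebra.norm_apply, Algebra.norm_apply, ← LinearMap.det_baseChange]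
  congr 1
  ext y
  simp

variable (F D : Type*) [Field F] [DivisionRing D] [Algebra F D] [Algebra.IsCentral F D]
  [FiniteDimensional F D]

theorem splitting_dim {d : ℕ} (hD : Module.finrank F D = d ^ 2) :
    (exists_splitting F D).choose = d := by
  have e := (exists_splitting F D).choose_spec.some
  have h := e.toLinearEquiv.finrank_eq
  rw [Module.finrank_baseChange, Module.finrank_matrix, hD, Module.finrank_self, mul_one,
    Fintype.card_fin, ← sq] at h
  exact (Nat.pow_left_injective two_ne_zero h).symm

/-- This relation replaces the fact that reduced norms lie in `F`: their `d`-th powers visibly do.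
-/
theorem algebraMap_norm_eq_reducedNorm_pow {d : ℕ} (hD : Module.finrank F D = d ^ 2) (x : D) :
    algebraMap F (AlgebraicClosure F) (Algebra.norm F x) = reducedNorm F D x ^ d := by
  rw [← Algebra.norm_one_tmul, ← Algebra.norm_eq_of_algEquiv (exists_splitting F D).choose_spec.some,
    Matrix.algebraNorm_eq, Fintype.card_fin]
  change reducedNorm F D x ^ _ = _
  rw [splitting_dim F D hD]

theorem reducedNorm_algebraMap {d : ℕ} (hD : Module.finrank F D = d ^ 2) (a : F) :
    reducedNorm F D (algebraMap F D a) = algebraMap F (AlgebraicClosure F) a ^ d := by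
  have h1 : (1 ⊗ₜ[F] algebraMap F D a : AlgebraicClosure F ⊗[F] D) =
      algebraMap (AlgebraicClosure F) _ (algebraMap F (AlgebraicClosure F) a) := by
    rw [Algebra.TensorProduct.algebraMap_apply, Algebra.algebraMap_eq_smul_one,
      Algebra.algebraMap_eq_smul_one, TensorProduct.tmul_smul, TensorProduct.smul_tmul',
      Algebra.algebraMap_eq_smul_one, smul_assoc, one_smul]
  change ((exists_splitting F D).choose_spec.some (1 ⊗ₜ[F] algebraMap F D a)).det = _
  rw [h1, AlgEquiv.commutes, Algebra.algebraMap_eq_smul_one, Matrix.det_smul, Matrix.det_one,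
    mul_one, Fintype.card_fin, splitting_dim F D hD]

/-- Linear independence would survive extension of scalars to the algebraic closure, where
Cayley–Hamilton for a `d × d` matrix gives a monic relation of degree `d`. -/
theorem not_linearIndependent_pow {d : ℕ} (hD : Module.finrank F D = d ^ 2) (x : D) :
    ¬ LinearIndependent F fun i : Fin (d + 1) => x ^ (i : ℕ) := by
  intro hli
  have h1 := Module.Flat.linearIndependent_one_tmul (S := AlgebraicClosure F) hli
  let e := (exists_splitting F D).choose_spec.some
  let M := e (1 ⊗ₜ x)
  have h3 := Matrix.aeval_self_charpoly M
  have h4 : M.charpoly.natDegree = d := by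
    rw [Matrix.charpoly_natDegree_eq_dim, Fintype.card_fin, splitting_dim F D hD]
  have h5 : Polynomial.aeval (1 ⊗ₜ[F] x : AlgebraicClosure F ⊗[F] D) M.charpoly = 0 := by
    apply e.injective
    rw [map_zero, ← h3]
    exact (Polynomial.aeval_algHom_apply e.toAlgHom _ _).symm
  rw [Polynomial.aeval_eq_sum_range, h4, ← Fin.sum_univ_eq_sum_range (fun i =>
    M.charpoly.coeff i • (1 ⊗ₜ[F] x : AlgebraicClosure F ⊗[F] D) ^ i)] at h5
  have h6 := Fintype.linearIndependent_iff.1 h1 (fun i => M.charpoly.coeff i) (by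
    refine Eq.trans (Finset.sum_congr rfl fun i _ => ?_) h5
    rw [Algebra.TensorProduct.tmul_pow, one_pow]) (Fin.last d)
  have h7 := M.charpoly_monic.coeff_natDegree
  rw [h4] at h7
  exact one_ne_zero (h7.symm.trans h6)

end ReducedNorm

section ResidueField

variable (F : Type*) [Field F] [ValuativeRel F] [TopologicalSpace F] [IsNonarchimedeanLocalField F]

theorem residue_eq_zero_iff_valuation_lt_one (x : 𝒪[F]) :
    IsLocalRing.residue 𝒪[F] x = 0 ↔ valuation F (x : F) < 1 := by
  rw [IsLocalRing.residue_eq_zero_iff, IsLocalRing.mem_maximalIdeal, mem_nonunits_iff]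
  rw [(Valuation.integer.integers (valuation F)).isUnit_iff_valuation_eq_one]
  exact (lt_iff_le_and_ne.trans (and_iff_right x.2)).symm

theorem valuation_pow_card_sub_one_lt {F : Type*} [Field F] [ValuativeRel F] [TopologicalSpace F]
    [IsNonarchimedeanLocalField F] {q : ℕ} (hf : Nat.card 𝓀[F] = q) {a : F} (ha : valuation F a = 1) :
    valuation F (a ^ (q - 1) - 1) < 1 := by
  have h := (residue_eq_zero_iff_valuation_lt_one F ((⟨a, ha.le⟩ : 𝒪[F]) ^ (q - 1) - 1)).1 (by
    have := Fintype.ofFinite 𝓀[F]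
    rw [Nat.card_eq_fintype_card] at hf
    rw [map_sub, map_pow, map_one, ← hf, FiniteField.pow_card_sub_one_eq_one, sub_self]
    rw [Ne, residue_eq_zero_iff_valuation_lt_one]
    exact ha.not_lt)
  simpa using h

variable {F} {p f : ℕ} [Fact p.Prime] (hf : Nat.card 𝓀[F] = p ^ f)
include hf

theorem charP_residueField : CharP 𝓀[F] p := by
  have := Fintype.ofFinite 𝓀[F]
  rw [Nat.card_eq_fintype_card] at hf
  exact charP_of_card_eq_prime_pow hf

theorem valuation_prime_lt_one : valuation F (p : F) < 1 := by
  have := charP_residueField hf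
  have h := (residue_eq_zero_iff_valuation_lt_one F (p : 𝒪[F])).1 (by simp)
  simpa using h

end ResidueField

/-! ### Factoring principal units through the centre. -/

section Decomposition

variable {F D : Type*} {d : ℕ}
    [Field F] [ValuativeRel F] [TopologicalSpace F] [IsNonarchimedeanLocalField F]
    [DivisionRing D] [Algebra F D]

theorem divisionValuation_algebraMap_lt_one [FiniteDimensional F D] {a : F}
    (ha : valuation F a < 1) : divisionValuation F D (algebraMap F D a) < 1 := by
  change valuation F (Algebra.norm F (algebraMap F D a)) < 1
  rw [Algebra.norm_algebraMap, map_pow]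
  exact pow_lt_one₀ zero_le ha Module.finrank_pos.ne'

theorem norm_eq_one_of_mem_oneUnitsNrdOne [Algebra.IsCentral F D] [FiniteDimensional F D]
    (hD : Module.finrank F D = d ^ 2) (n : oneUnitsNrdOne F D) :
    Algebra.norm F ((n : Dˣ) : D) = 1 := by
  have h : reducedNorm F D ((n : Dˣ) : D) = 1 := n.2.2
  apply (algebraMap F (AlgebraicClosure F)).injective
  rw [algebraMap_norm_eq_reducedNorm_pow F D hD, h, one_pow, map_one]

variable [Algebra.IsCentral F D] [FiniteDimensional F D]
    [TopologicalSpace D] [IsModuleTopology F D]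
    (hD : Module.finrank F D = d ^ 2)
    {p f : ℕ} [Fact p.Prime] (hf : Nat.card 𝓀[F] = p ^ f) (hpd : p.Coprime d)
include hD hf hpd

/-- Write `x = z ^ (d (q - 1))` with `q = p ^ f`. Then `Nrd x = N(z) ^ (q - 1)` is a principal unit
of `F`, so it equals `u ^ d = Nrd u` for some principal unit `u`, and `x u⁻¹` has reduced norm one.
-/
theorem exists_mul_eq_of_mem_oneUnitsDivision (x : oneUnitsDivision F D) :
    ∃ (n : oneUnitsNrdOne F D) (u : oneUnitsField F),
      x = nrdOneInclusion F D n * fieldInclusion F D u := by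
  have := IsModuleTopology.isTopologicalRing F D
  obtain ⟨ϖ, hϖ⟩ := exists_isLocalValuation F D
  obtain ⟨π, hπ⟩ := exists_isLocalValuation_field F
  have hp := valuation_prime_lt_one hf
  have hpD : divisionValuation F D (p : D) < 1 := by
    rw [← map_natCast (algebraMap F D)]
    exact divisionValuation_algebraMap_lt_one hp
  have hpr : p.Prime := Fact.out
  have hf0 : f ≠ 0 := by
    rintro rfl
    rw [pow_zero] at hf
    have : Fintype 𝓀[F] := Fintype.ofFinite _
    rw [Nat.card_eq_fintype_card] at hf
    exact (Fintype.one_lt_card (α := 𝓀[F])).ne' hf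
  -- The factor `d` turns the reduced norm into the norm, and `p ^ f - 1` makes that norm principal.
  have hc : (d * (p ^ f - 1)).Coprime p := by
    refine Nat.Coprime.mul_left hpd.symm ?_
    have h1 : (p ^ f - 1).Coprime (p ^ f) :=
      (Nat.coprime_self_sub_left (Nat.one_le_pow _ _ hpr.pos)).2 (Nat.coprime_one_left _)
    exact Nat.Coprime.coprime_dvd_right (dvd_pow_self p hf0) h1
  obtain ⟨z, hz, hzx, -⟩ := hϖ.exists_pow_eq hpr hpD hc x.2
  obtain ⟨u, hu, hut, -⟩ := hπ.exists_pow_eq hpr hp hpd.symm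
    (valuation_pow_card_sub_one_lt hf (a := Algebra.norm F z)
      ((divisionValuation F D).map_eq_one_of_sub_one_lt hz))
  have hu0 : u ≠ 0 := Valuation.ne_zero_of_sub_one_lt hu
  let u' : oneUnitsField F := ⟨Units.mk0 u hu0, hu⟩
  have hN : reducedNorm F D ((x : Dˣ) : D) = reducedNorm F D (algebraMap F D u) := by
    rw [← hzx, pow_mul, map_pow, map_pow, ← algebraMap_norm_eq_reducedNorm_pow F D hD,
      reducedNorm_algebraMap F D hD, ← map_pow, ← map_pow (algebraMap F (AlgebraicClosure F)) u, hut]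
  let w : oneUnitsDivision F D := x * (fieldInclusion F D u')⁻¹
  have hwx : w * fieldInclusion F D u' = x := inv_mul_cancel_right _ _
  have hw : reducedNorm F D ((w : Dˣ) : D) = 1 := by
    have h1 : reducedNorm F D (((w * fieldInclusion F D u' : oneUnitsDivision F D) : Dˣ) : D) =
        reducedNorm F D ((w : Dˣ) : D) * reducedNorm F D (algebraMap F D u) := map_mul _ _ _
    rw [hwx, hN] at h1
    refine mul_right_cancel₀ (b := reducedNorm F D (algebraMap F D u)) ?_ (h1.symm.trans (one_mul _).symm)
    rw [reducedNorm_algebraMap F D hD]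
    exact pow_ne_zero _ ((map_ne_zero _).2 hu0)
  exact ⟨⟨w, w.2, hw⟩, u', hwx.symm⟩

theorem norm_mem_oneUnitsField (x : oneUnitsDivision F D) :
    Units.map (Algebra.norm F : D →* F) x ∈ oneUnitsField F := by
  obtain ⟨n, u, rfl⟩ := exists_mul_eq_of_mem_oneUnitsDivision hD hf hpd x
  have : Units.map (Algebra.norm F : D →* F) (nrdOneInclusion F D n * fieldInclusion F D u :
      oneUnitsDivision F D) = (u : Fˣ) ^ (d ^ 2) := by
    ext
    change Algebra.norm F (((n : Dˣ) : D) * algebraMap F D ((u : Fˣ) : F)) = ((u : Fˣ) : F) ^ (d ^ 2)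
    rw [map_mul, norm_eq_one_of_mem_oneUnitsNrdOne hD, one_mul, Algebra.norm_algebraMap, hD]
  rw [this]
  exact pow_mem u.2 _

end Decomposition

/-! ### Restriction to the two factors. -/

section Restriction

variable {F D K : Type u} {d p f : ℕ} [Fact p.Prime]
    [Field F] [ValuativeRel F] [TopologicalSpace F] [IsNonarchimedeanLocalField F]
    [DivisionRing D] [Algebra F D] [Algebra.IsCentral F D] [FiniteDimensional F D]
    [TopologicalSpace D] [IsModuleTopology F D]
    [Field K] [TopologicalSpace K] [DiscreteTopology K] [CharP K p]
    (hD : Module.finrank F D = d ^ 2)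
    (hf : Nat.card 𝓀[F] = p ^ f) (hpd : p.Coprime d)
include hD hf hpd

omit [Algebra.IsCentral F D] hD hf hpd in
theorem fieldInclusion_comm (u : oneUnitsField F) (x : oneUnitsDivision F D) :
    fieldInclusion F D u * x = x * fieldInclusion F D u :=
  Subtype.ext (Units.ext (Algebra.commutes ((u : Fˣ) : F) ((x : Dˣ) : D)))

omit [Fact p.Prime] in
/-- `H¹(I₁) → H¹(I₁^{Nrd = 1}) ⊕ H¹(1 + π O)` is bijective, in terms of homomorphisms. -/
theorem contHom_comap_prod_bijective [Fact p.Prime] :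
    Function.Bijective ((contHom.comap (K := K) (nrdOneInclusion F D)).prod
      (contHom.comap (fieldInclusion F D))) := by
  have hdec := exists_mul_eq_of_mem_oneUnitsDivision hD hf hpd
  constructor
  · refine (injective_iff_map_eq_zero _).2 fun h hh => ?_
    apply contHom.ext
    intro x
    obtain ⟨n, u, rfl⟩ := hdec x
    have h1 : h (nrdOneInclusion F D n) = 0 := DFunLike.congr_fun (congrArg Prod.fst hh) n
    have h2 : h (fieldInclusion F D u) = 0 := DFunLike.congr_fun (congrArg Prod.snd hh) u
    rw [contHom.map_mul, h1, h2, add_zero, contHom.zero_apply]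
  · rintro ⟨φ, ψ⟩
    have hNc : Continuous fun x : oneUnitsDivision F D =>
        Units.map (Algebra.norm F : D →* F) x :=
      (Continuous.units_map (Algebra.norm F : D →* F) (continuous_algebraNorm F D)).comp
        continuous_subtype_val
    -- For `x = n u` the norm is `u ^ (d ^ 2)`, and `x ^ (d ^ 2)` divided by the norm is `n ^ (d ^
    -- 2)`. These are continuous functions of `x` alone, so `φ n + ψ u` is well defined and
    -- continuous after division by `d ^ 2` in `K`.
    let α : oneUnitsDivision F D → oneUnitsField F := fun x =>
      ⟨Units.map (Algebra.norm F : D →* F) x, norm_mem_oneUnitsField hD hf hpd x⟩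
    have hα : Continuous α := hNc.subtype_mk _
    have hαu : ∀ n u, α (nrdOneInclusion F D n * fieldInclusion F D u) = u ^ (d ^ 2) := by
      intro n u
      ext
      change Algebra.norm F (((n : Dˣ) : D) * algebraMap F D ((u : Fˣ) : F)) =
        ((u : Fˣ) : F) ^ (d ^ 2)
      rw [map_mul, norm_eq_one_of_mem_oneUnitsNrdOne hD, one_mul, Algebra.norm_algebraMap, hD]
    let β₀ : oneUnitsDivision F D → oneUnitsDivision F D := fun x =>
      x ^ (d ^ 2) * (fieldInclusion F D (α x))⁻¹
    have hβ₀ : Continuous β₀ := (continuous_pow _).mul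
      ((fieldInclusion F D).continuous_toFun.comp hα).inv
    have hβ₀n : ∀ n u, β₀ (nrdOneInclusion F D n * fieldInclusion F D u) =
        nrdOneInclusion F D (n ^ (d ^ 2)) := by
      intro n u
      simp only [β₀]
      have hcomm : Commute (nrdOneInclusion F D n) (fieldInclusion F D u) :=
        (fieldInclusion_comm u _).symm
      rw [hαu, hcomm.mul_pow, map_pow, map_pow, mul_inv_cancel_right]
    have hβ₁ : ∀ x, (β₀ x : Dˣ) ∈ oneUnitsNrdOne F D := by
      intro x
      obtain ⟨n, u, rfl⟩ := hdec x
      rw [hβ₀n]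
      exact (n ^ (d ^ 2)).2
    let β : oneUnitsDivision F D → oneUnitsNrdOne F D := fun x => ⟨β₀ x, hβ₁ x⟩
    have hβ : Continuous β := (continuous_subtype_val.comp hβ₀).subtype_mk _
    have hβn : ∀ n u, β (nrdOneInclusion F D n * fieldInclusion F D u) = n ^ (d ^ 2) := by
      intro n u
      exact Subtype.ext (congrArg (fun z : oneUnitsDivision F D => (z : Dˣ)) (hβ₀n n u))
    have hd0 : (d : K) ≠ 0 := by
      rw [Ne, CharP.cast_eq_zero_iff K p]
      intro hdvd
      exact (Fact.out : p.Prime).one_lt.ne' (Nat.eq_one_of_dvd_coprimes hpd dvd_rfl hdvd)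
    let F₀ : oneUnitsDivision F D → K := fun x => ((d : K) ^ 2)⁻¹ * (φ (β x) + ψ (α x))
    have hF₀ : ∀ n u, F₀ (nrdOneInclusion F D n * fieldInclusion F D u) = φ n + ψ u := by
      intro n u
      simp only [F₀]
      rw [hαu, hβn, contHom.map_pow, contHom.map_pow]
      push_cast
      field_simp
    refine ⟨contHom.mk F₀ (continuous_const.mul ((φ.2.comp hβ).add (ψ.2.comp hα))) ?_, ?_⟩
    · intro x y
      obtain ⟨n, u, rfl⟩ := hdec x
      obtain ⟨n', u', rfl⟩ := hdec y
      have hxy : nrdOneInclusion F D n * fieldInclusion F D u *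
          (nrdOneInclusion F D n' * fieldInclusion F D u') =
          nrdOneInclusion F D (n * n') * fieldInclusion F D (u * u') := by
        rw [map_mul, map_mul, mul_assoc, ← mul_assoc (fieldInclusion F D u),
          fieldInclusion_comm u, mul_assoc, mul_assoc]
      rw [hxy, hF₀, hF₀, hF₀, contHom.map_mul, contHom.map_mul]
      ring
    · refine Prod.ext (contHom.ext fun n => ?_) (contHom.ext fun u => ?_)
      · have := hF₀ n 1
        rw [map_one, mul_one, contHom.map_one, add_zero] at this
        exact this
      · have := hF₀ 1 u
        rw [map_one, one_mul, contHom.map_one, zero_add] at this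
        exact this

end Restriction

/-! ### Residue maps, and conjugation on the residue field. -/

/-- `ρ` restricts to the residue map of the valuation ring of `v` onto the residue field `k`. -/
structure IsResidueMap {R Γ k : Type*} [Ring R] [LinearOrderedCommGroupWithZero Γ] [Ring k]
    (v : Valuation R Γ) (ρ : R → k) : Prop where
  map_one : ρ 1 = 1
  map_add : ∀ x y, v x ≤ 1 → v y ≤ 1 → ρ (x + y) = ρ x + ρ y
  map_mul : ∀ x y, v x ≤ 1 → v y ≤ 1 → ρ (x * y) = ρ x * ρ y
  surjective : ∀ c, ∃ x, v x ≤ 1 ∧ ρ x = c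
  eq_zero_iff : ∀ x, v x ≤ 1 → (ρ x = 0 ↔ v x < 1)

namespace IsResidueMap

section Ring

variable {R Γ k : Type*} [Ring R] [LinearOrderedCommGroupWithZero Γ] [Ring k]
  {v : Valuation R Γ} {ρ : R → k} (hρ : IsResidueMap v ρ)
include hρ

theorem map_zero : ρ 0 = 0 := by
  rw [hρ.eq_zero_iff 0 (by simp)]
  simp

theorem map_neg {x : R} (hx : v x ≤ 1) : ρ (-x) = - ρ x := by
  rw [eq_neg_iff_add_eq_zero, ← hρ.map_add _ _ (by simpa using hx) hx, neg_add_cancel, hρ.map_zero]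

theorem map_sub {x y : R} (hx : v x ≤ 1) (hy : v y ≤ 1) : ρ (x - y) = ρ x - ρ y := by
  rw [sub_eq_add_neg, hρ.map_add _ _ hx (by simpa using hy), hρ.map_neg hy, sub_eq_add_neg]

theorem eq_iff {x y : R} (hx : v x ≤ 1) (hy : v y ≤ 1) : ρ x = ρ y ↔ v (x - y) < 1 := by
  rw [← sub_eq_zero, ← hρ.map_sub hx hy, hρ.eq_zero_iff _ (v.map_sub_le hx hy)]

theorem eq_of_sub_lt {x y : R} (hx : v x ≤ 1) (h : v (x - y) < 1) : ρ x = ρ y := by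
  refine (hρ.eq_iff hx ?_).2 h
  have : y = x - (x - y) := by abel
  rw [this]
  exact v.map_sub_le hx h.le

theorem map_pow {x : R} (hx : v x ≤ 1) (n : ℕ) : ρ (x ^ n) = ρ x ^ n := by
  induction n with
  | zero => simpa using hρ.map_one
  | succ n ih =>
    rw [pow_succ, hρ.map_mul _ _ _ hx, ih, pow_succ]
    rw [_root_.map_pow]
    exact pow_le_one₀ zero_le hx

theorem map_eq_one_of_ne_zero {x : R} (hx : v x ≤ 1) (h : ρ x ≠ 0) : v x = 1 :=
  hx.eq_or_lt.resolve_right fun h' => h ((hρ.eq_zero_iff x hx).2 h')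

theorem map_natCast (n : ℕ) : ρ n = n := by
  induction n with
  | zero => simpa using hρ.map_zero
  | succ n ih =>
    rw [Nat.cast_succ, hρ.map_add _ _ (v.map_natCast_le_one n) v.map_one.le, ih, hρ.map_one,
      Nat.cast_succ]

theorem charP [Nontrivial k] {p : ℕ} (hpr : p.Prime) (hp : v (p : R) < 1) : CharP k p := by
  rw [CharP.charP_iff_prime_eq_zero hpr, ← hρ.map_natCast, hρ.eq_zero_iff _ hp.le]
  exact hp

omit hρ in
/-- The residue map attached to a surjection from the ring of integers. -/
theorem of_surjective (r : v.integer →+* k) (hr : Function.Surjective r)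
    (h0 : ∀ x, r x = 0 ↔ v (x : R) < 1) :
    ∃ ρ : R → k, IsResidueMap v ρ ∧ ∀ x : v.integer, ρ x = r x := by
  classical
  -- The value `0` outside the valuation ring is arbitrary: `IsResidueMap` constrains only integral
  -- elements.
  have key : ∀ x : v.integer, (if h : v (x : R) ≤ 1 then r ⟨x, h⟩ else 0) = r x := fun x =>
    dif_pos x.2
  refine ⟨fun x => if h : v x ≤ 1 then r ⟨x, h⟩ else 0, ⟨?_, ?_, ?_, ?_, ?_⟩, key⟩
  · exact (key 1).trans r.map_one
  · intro x y hx hy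
    exact (key (⟨x, hx⟩ + ⟨y, hy⟩)).trans ((r.map_add _ _).trans
      (congrArg₂ _ (key ⟨x, hx⟩).symm (key ⟨y, hy⟩).symm))
  · intro x y hx hy
    exact (key (⟨x, hx⟩ * ⟨y, hy⟩)).trans ((r.map_mul _ _).trans
      (congrArg₂ _ (key ⟨x, hx⟩).symm (key ⟨y, hy⟩).symm))
  · intro c
    obtain ⟨x, rfl⟩ := hr c
    exact ⟨x, x.2, key x⟩
  · intro x hx
    rw [← h0 ⟨x, hx⟩, ← key ⟨x, hx⟩]

end Ring

section Conj

variable {R Γ k : Type*} [DivisionRing R] [LinearOrderedCommGroupWithZero Γ] [Field k]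
  {v : Valuation R Γ} {ρ : R → k} (hρ : IsResidueMap v ρ)

omit [Field k] in
theorem map_conj {a : R} (ha : a ≠ 0) (x : R) : v (a * x * a⁻¹) = v x := by
  have : v a ≠ 0 := v.ne_zero_iff.2 ha
  rw [_root_.map_mul, _root_.map_mul, map_inv₀, mul_comm (v a), mul_inv_cancel_right₀ this]

include hρ

/-- Conjugation by `a` induces an endomorphism of the residue field. -/
theorem exists_conj {a : R} (ha : a ≠ 0) :
    ∃ σ : k →+* k, ∀ x, v x ≤ 1 → σ (ρ x) = ρ (a * x * a⁻¹) := by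
  choose s hs1 hs2 using hρ.surjective
  have key : ∀ x, v x ≤ 1 → ρ (a * s (ρ x) * a⁻¹) = ρ (a * x * a⁻¹) := by
    intro x hx
    refine hρ.eq_of_sub_lt (by rw [map_conj ha]; exact hs1 _) ?_
    rw [← sub_mul, ← mul_sub, map_conj ha, ← hρ.eq_iff (hs1 _) hx, hs2]
  refine ⟨⟨⟨⟨fun c => ρ (a * s c * a⁻¹), ?_⟩, ?_⟩, ?_, ?_⟩, key⟩
  · have := key 1 (by simp)
    rw [hρ.map_one] at this
    rw [this, mul_one, mul_inv_cancel₀ ha, hρ.map_one]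
  · intro c c'
    have := key (s c * s c') (by rw [_root_.map_mul]; exact mul_le_one' (hs1 c) (hs1 c'))
    rw [hρ.map_mul _ _ (hs1 c) (hs1 c'), hs2, hs2] at this
    refine this.trans ?_
    rw [← hρ.map_mul _ _ (by rw [map_conj ha]; exact hs1 _) (by rw [map_conj ha]; exact hs1 _)]
    congr 1
    simp only [mul_assoc, inv_mul_cancel_left₀ ha]
  · have := key 0 (by simp)
    rw [hρ.map_zero] at this
    change ρ (a * s 0 * a⁻¹) = 0
    rw [this, mul_zero, zero_mul, hρ.map_zero]
  · intro c c'
    have := key (s c + s c') (v.map_add_le (hs1 c) (hs1 c'))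
    rw [hρ.map_add _ _ (hs1 c) (hs1 c'), hs2, hs2] at this
    refine this.trans ?_
    rw [← hρ.map_add _ _ (by rw [map_conj ha]; exact hs1 _) (by rw [map_conj ha]; exact hs1 _)]
    rw [mul_add, add_mul]

theorem exists_conj_equiv [Finite k] {a : R} (ha : a ≠ 0) :
    ∃ σ : k ≃+* k, ∀ x, v x ≤ 1 → σ (ρ x) = ρ (a * x * a⁻¹) := by
  obtain ⟨σ, hσ⟩ := hρ.exists_conj ha
  exact ⟨RingEquiv.ofBijective σ (Finite.injective_iff_bijective.1 σ.injective), hσ⟩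

omit hρ in
theorem conj_pow {a : R} (ha : a ≠ 0) {σ : k ≃+* k}
    (hσ : ∀ x, v x ≤ 1 → σ (ρ x) = ρ (a * x * a⁻¹)) (n : ℕ) {x : R} (hx : v x ≤ 1) :
    (σ ^ n) (ρ x) = ρ (a ^ n * x * (a ^ n)⁻¹) := by
  induction n with
  | zero => simp
  | succ n ih =>
    rw [pow_succ', RingAut.mul_apply, ih, hσ _ (by rwa [map_conj (pow_ne_zero n ha)])]
    congr 1
    rw [pow_succ', mul_inv_rev]
    simp only [mul_assoc]

/-- Conjugation by units is trivial on the commutative residue field. -/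
theorem map_conj_unit {w : R} (hw : v w = 1) {x : R} (hx : v x ≤ 1) : ρ (w * x * w⁻¹) = ρ x := by
  have hw0 : w ≠ 0 := v.ne_zero_iff.1 (by rw [hw]; exact one_ne_zero)
  have hw' : v w⁻¹ ≤ 1 := by rw [map_inv₀, hw, inv_one]
  rw [hρ.map_mul _ _ (by rw [_root_.map_mul, hw, one_mul]; exact hx) hw', hρ.map_mul _ _ hw.le hx,
    mul_comm (ρ w), mul_assoc, ← hρ.map_mul _ _ hw.le hw', mul_inv_cancel₀ hw0, hρ.map_one,
    mul_one]

end Conj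

section Center

variable {R Γ k : Type*} [DivisionRing R] [TopologicalSpace R] [IsTopologicalRing R]
  [LinearOrderedCommGroupWithZero Γ] [Field k] [Finite k]
  {v : Valuation R Γ} {ρ : R → k} (hρ : IsResidueMap v ρ) {ϖ : R} (h : IsLocalValuation v ϖ)
  {σ : k ≃+* k} (hσ : ∀ x, v x ≤ 1 → σ (ρ x) = ρ (ϖ * x * ϖ⁻¹))
include hρ h hσ

-- Every `z` is a unit times a power of `ϖ`, possibly negative. Units act trivially on the
-- commutative residue field, and `ϖ` acts through `σ`, which fixes `c`.
omit [IsTopologicalRing R] [Finite k] in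
theorem map_conj_of_fixed {c : k} (hc : σ c = c) {z : R} (hz : z ≠ 0) {y : R} (hy : v y ≤ 1)
    (hyc : ρ y = c) : ρ (z * y * z⁻¹) = c := by
  have hpos : ∀ n : ℕ, ∀ y, v y ≤ 1 → ρ y = c → ρ (ϖ ^ n * y * (ϖ ^ n)⁻¹) = c := by
    intro n y hy hyc
    rw [← conj_pow h.ne_zero hσ n hy, hyc]
    induction n with
    | zero => simp
    | succ n ih => rw [pow_succ, RingAut.mul_apply, hc, ih]
  have hneg : ∀ n : ℕ, ∀ y, v y ≤ 1 → ρ y = c → ρ ((ϖ ^ n)⁻¹ * y * ϖ ^ n) = c := by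
    intro n y hy hyc
    have hn0 : ϖ ^ n ≠ 0 := pow_ne_zero n h.ne_zero
    have hv : v ((ϖ ^ n)⁻¹ * y * ϖ ^ n) ≤ 1 := by
      have := map_conj (v := v) (inv_ne_zero hn0) y
      rw [inv_inv] at this
      rwa [this]
    apply (σ ^ n).injective
    rw [conj_pow h.ne_zero hσ n hv]
    have h1 : ϖ ^ n * ((ϖ ^ n)⁻¹ * y * ϖ ^ n) * (ϖ ^ n)⁻¹ = y := by
      simp only [mul_assoc, mul_inv_cancel₀ hn0, mul_one, mul_inv_cancel_left₀ hn0]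
    have h2 : (σ ^ n) c = c := by
      have := hpos n y hy hyc
      rwa [← conj_pow h.ne_zero hσ n hy, hyc] at this
    rw [h1, hyc, h2]
  obtain ⟨n, hn⟩ := h.exists_zpow z hz
  have hw : v (z * (ϖ ^ n)⁻¹) = 1 := by
    rw [_root_.map_mul, map_inv₀, map_zpow₀, hn, mul_inv_cancel₀ (zpow_ne_zero n h.val_ne_zero)]
  have hz' : z = z * (ϖ ^ n)⁻¹ * ϖ ^ n := by
    rw [inv_mul_cancel_right₀ (zpow_ne_zero n h.ne_zero)]
  have h3 : ρ (ϖ ^ n * y * (ϖ ^ n)⁻¹) = c := by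
    obtain ⟨m, rfl | rfl⟩ := n.eq_nat_or_neg
    · simpa using hpos m y hy hyc
    · simpa using hneg m y hy hyc
  rw [← h3]
  have h4 : z * y * z⁻¹ = z * (ϖ ^ n)⁻¹ * (ϖ ^ n * y * (ϖ ^ n)⁻¹) * (z * (ϖ ^ n)⁻¹)⁻¹ := by
    have hn0 : ϖ ^ n ≠ 0 := zpow_ne_zero n h.ne_zero
    rw [mul_inv_rev, inv_inv]
    simp only [mul_assoc, inv_mul_cancel_left₀ hn0]
  rw [h4, hρ.map_conj_unit hw (by rwa [map_conj (zpow_ne_zero n h.ne_zero)])]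

-- `β z β⁻¹ - z = (β - z β z⁻¹) (z β⁻¹)`, and the first factor lies in the maximal ideal because
-- conjugation by `z` fixes the class of `β`.
omit [IsTopologicalRing R] [Finite k] in
theorem map_commutator_lt {β : R} (hβ : v β = 1) (hc : σ (ρ β) = ρ β) {z : R} (hz : z ≠ 0) :
    v (β * z * β⁻¹ - z) < v z := by
  have hβ0 : β ≠ 0 := v.ne_zero_iff.1 (by rw [hβ]; exact one_ne_zero)
  have h1 := hρ.map_conj_of_fixed h hσ hc hz hβ.le rfl
  rw [hρ.eq_iff (by rw [map_conj hz]; exact hβ.le) hβ.le] at h1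
  have h2 : β * z * β⁻¹ - z = (β - z * β * z⁻¹) * (z * β⁻¹) := by
    rw [sub_mul]
    simp only [mul_assoc, inv_mul_cancel_left₀ hz, mul_inv_cancel₀ hβ0, mul_one]
  rw [h2, _root_.map_mul, _root_.map_mul, map_inv₀, hβ, inv_one, mul_one, v.map_sub_swap]
  exact mul_lt_of_lt_one_left (zero_lt_iff.2 (v.ne_zero_iff.2 hz)) h1

/-- A residue class fixed by conjugation lifts to a central element. -/
theorem exists_central_of_fixed {p : ℕ} [hpr : Fact p.Prime] (hp : v (p : R) < 1) {c : k}
    (hc : σ c = c) : ∃ α, v α ≤ 1 ∧ ρ α = c ∧ ∀ z, α * z = z * α := by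
  classical
  rcases eq_or_ne c 0 with rfl | hc0
  · exact ⟨0, by simp, hρ.map_zero, by simp⟩
  have := Fintype.ofFinite k
  obtain ⟨x, hx, hxc⟩ := hρ.surjective c
  have hx1 := hρ.map_eq_one_of_ne_zero hx (hxc ▸ hc0)
  have hpk : CharP k p := hρ.charP hpr.out hp
  set m := Fintype.card k - 1 with hm
  have hmp : m.Coprime p := by
    obtain ⟨n, hn, hcard⟩ := FiniteField.card k p
    have h1 : (p ^ (n : ℕ) - 1).Coprime (p ^ (n : ℕ)) :=
      (Nat.coprime_self_sub_left (Nat.one_le_pow _ _ hpr.out.pos)).2 (Nat.coprime_one_left _)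
    rw [hm, hcard]
    exact Nat.Coprime.coprime_dvd_right (dvd_pow_self p n.ne_zero) h1
  -- The candidate is a Teichmüller lift: a root of unity of order dividing `m = |k| - 1`.
  obtain ⟨α, hα1, hα2⟩ := h.exists_pow_eq_one hpr.out hp hmp hx1 (by
    rw [← hρ.eq_iff (by rw [_root_.map_pow, hx1, one_pow]) (by simp), hρ.map_pow hx, hxc,
      FiniteField.pow_card_sub_one_eq_one c hc0, hρ.map_one])
  have hαx : v α ≤ 1 := by
    have : α = (α - x) + x := by abel
    rw [this]
    exact v.map_add_le hα1.le hx
  have hαc : ρ α = c := by rw [← hxc, hρ.eq_iff hαx hx]; exact hα1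
  have hα : v α = 1 := hρ.map_eq_one_of_ne_zero hαx (hαc ▸ hc0)
  have hα0 : α ≠ 0 := v.ne_zero_iff.1 (by rw [hα]; exact one_ne_zero)
  refine ⟨α, hα.le, hαc, fun z => ?_⟩
  by_contra hcon
  let y := α * z * α⁻¹ - z
  have hy : y ≠ 0 := by
    intro hy0
    apply hcon
    rw [sub_eq_zero] at hy0
    rw [← hy0, inv_mul_cancel_right₀ hα0, hy0]
  -- The conjugates of `y` by the powers of `α` telescope to `α ^ m z α ^ (-m) - z = 0`. Each of
  -- them is `y` up to smaller terms, so `m y` is smaller than `y`, which is impossible for `m`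
  -- prime to `p`.
  have hsum : ∑ i ∈ Finset.range m, (α ^ i * y * (α ^ i)⁻¹) = 0 := by
    have h1 : ∀ i, α ^ i * y * (α ^ i)⁻¹ =
        α ^ (i + 1) * z * (α ^ (i + 1))⁻¹ - α ^ i * z * (α ^ i)⁻¹ := by
      intro i
      simp only [y]
      rw [pow_succ, mul_inv_rev, mul_sub, sub_mul]
      simp only [mul_assoc]
    rw [Finset.sum_congr rfl fun i _ => h1 i,
      Finset.sum_range_sub (fun i => α ^ i * z * (α ^ i)⁻¹), hα2]
    simp
  have hlt : v (∑ i ∈ Finset.range m, (α ^ i * y * (α ^ i)⁻¹ - y)) < v y := by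
    refine v.map_sum_lt (v.ne_zero_iff.2 hy) fun i _ => ?_
    refine hρ.map_commutator_lt h hσ (by rw [_root_.map_pow, hα, one_pow]) ?_ hy
    rw [hρ.map_pow hα.le, hαc, _root_.map_pow, hc]
  rw [Finset.sum_sub_distrib, hsum, zero_sub, Valuation.map_neg, Finset.sum_const, Finset.card_range,
    nsmul_eq_mul, _root_.map_mul, v.map_natCast_eq_one hp hmp, one_mul] at hlt
  exact lt_irrefl _ hlt

end Center

end IsResidueMap

/-- An automorphism `σ` of a finite field with `q` fixed points has order `log_q` of the
cardinality of the field. -/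
theorem FiniteField.card_eq_card_fixed_pow_orderOf {k : Type*} [Field k] [Finite k] (σ : k ≃+* k) :
    Nat.card k = Nat.card {c : k // σ c = c} ^ orderOf σ := by
  let G := Subgroup.zpowers σ
  have : Finite (k ≃+* k) := Finite.of_injective (fun e : k ≃+* k => (e : k → k)) DFunLike.coe_injective
  have := Fintype.ofFinite G
  have h1 := FixedPoints.finrank_eq_card G k
  have h2 := Module.natCard_eq_pow_finrank (K := FixedPoints.subfield G k) (V := k)
  rw [h1, ← Nat.card_eq_fintype_card, Nat.card_zpowers] at h2
  rw [h2]
  congr 1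
  refine Nat.card_congr (Equiv.subtypeEquivRight fun c => ?_)
  constructor
  · intro hc
    exact hc ⟨σ, Subgroup.mem_zpowers σ⟩
  · rintro hc ⟨τ, n, rfl⟩
    change (σ ^ n) c = c
    have hs : σ ∈ MulAction.stabilizer (k ≃+* k) c := hc
    exact (MulAction.stabilizer (k ≃+* k) c).zpow_mem hs n

/-- The compact unit ball is covered by finitely many cosets of the maximal ideal. -/
theorem IsResidueMap.finite {R Γ k : Type*} [DivisionRing R] [TopologicalSpace R]
    [IsTopologicalRing R] [LinearOrderedCommGroupWithZero Γ] [Ring k] {v : Valuation R Γ}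
    {ρ : R → k} (hρ : IsResidueMap v ρ) {ϖ : R} (h : IsLocalValuation v ϖ) : Finite k := by
  obtain ⟨t, -, ht⟩ := h.isCompact.elim_nhds_subcover (fun x => {y | v (y - x) ≤ v ϖ ^ 1})
    fun x _ => (h.isOpen_ball x 1).mem_nhds (by simp)
  refine Set.finite_univ_iff.1 ((t.finite_toSet.image ρ).subset fun c _ => ?_)
  obtain ⟨x, hx, rfl⟩ := hρ.surjective c
  have hx' : x ∈ ⋃ y ∈ t, {z | v (z - y) ≤ v ϖ ^ 1} := ht hx
  rw [Set.mem_iUnion₂] at hx'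
  obtain ⟨y, hy, hxy⟩ := hx'
  have hxy' : v (x - y) ≤ v ϖ ^ 1 := hxy
  rw [pow_one, ← h.lt_one_iff] at hxy'
  exact ⟨y, hy, (hρ.eq_of_sub_lt hx hxy').symm⟩

/-! ### Indices of balls and lattices. -/

section Index

theorem AddSubgroup.relIndex_eq_natCard_of_surjective {A B : Type*} [AddGroup A] [AddGroup B]
    {H K : AddSubgroup A} (φ : K →+ B) (hφ : Function.Surjective φ)
    (hker : ∀ x : K, φ x = 0 ↔ (x : A) ∈ H) : H.relIndex K = Nat.card B := by
  have : H.addSubgroupOf K = φ.ker := by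
    ext x
    rw [AddMonoidHom.mem_ker, hker, AddSubgroup.mem_addSubgroupOf]
  rw [AddSubgroup.relIndex, this, AddSubgroup.index_ker, AddMonoidHom.range_eq_top.2 hφ]
  exact Nat.card_congr AddSubgroup.topEquiv.toEquiv

variable {R Γ k : Type*} [DivisionRing R] [TopologicalSpace R]
    [LinearOrderedCommGroupWithZero Γ] [Ring k] {v : Valuation R Γ}
    {ρ : R → k} (hρ : IsResidueMap v ρ) {ϖ : R} (h : IsLocalValuation v ϖ)
include hρ h

theorem IsLocalValuation.relIndex_succ (j : ℤ) :
    (v.leAddSubgroup (v ϖ ^ (j + 1))).relIndex (v.leAddSubgroup (v ϖ ^ j)) =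
      Nat.card k := by
  have hϖj : ϖ ^ j ≠ 0 := zpow_ne_zero j h.ne_zero
  have hvj : 0 < v ϖ ^ j := zpow_pos h.val_pos j
  have hle : ∀ x, v (x * (ϖ ^ j)⁻¹) ≤ 1 ↔ v x ≤ v ϖ ^ j := by
    intro x
    rw [map_mul, map_inv₀, map_zpow₀, mul_inv_le_iff₀ hvj, one_mul]
  refine AddSubgroup.relIndex_eq_natCard_of_surjective
    (AddMonoidHom.mk' (fun x : v.leAddSubgroup (v ϖ ^ j) => ρ ((x : R) * (ϖ ^ j)⁻¹))
      fun x y => ?_) ?_ ?_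
  · rw [← hρ.map_add _ _ ((hle _).2 x.2) ((hle _).2 y.2), ← add_mul]
    rfl
  · intro c
    obtain ⟨x, hx, rfl⟩ := hρ.surjective c
    refine ⟨⟨x * ϖ ^ j, ?_⟩, ?_⟩
    · rw [Valuation.mem_leAddSubgroup_iff, map_mul, map_zpow₀]
      exact mul_le_of_le_one_left' hx
    · change ρ (x * ϖ ^ j * (ϖ ^ j)⁻¹) = ρ x
      rw [mul_inv_cancel_right₀ hϖj]
  · intro x
    change ρ ((x : R) * (ϖ ^ j)⁻¹) = 0 ↔ _
    rw [hρ.eq_zero_iff _ ((hle _).2 x.2), Valuation.mem_leAddSubgroup_iff, ← h.lt_zpow_iff,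
      map_mul, map_inv₀, map_zpow₀, mul_inv_lt_iff₀ hvj, one_mul]

theorem IsLocalValuation.relIndex_add (j : ℤ) (n : ℕ) :
    (v.leAddSubgroup (v ϖ ^ (j + n))).relIndex (v.leAddSubgroup (v ϖ ^ j)) =
      Nat.card k ^ n := by
  induction n with
  | zero => simp
  | succ n ih =>
    rw [pow_succ, ← ih, ← h.relIndex_succ hρ (j + n), mul_comm, Nat.cast_succ, ← add_assoc]
    refine (AddSubgroup.relIndex_mul_relIndex _ _ _ ?_ ?_).symm
    · exact v.leAddSubgroup_monotone
        (zpow_le_zpow_right_of_le_one₀ h.val_pos h.lt_one.le (by omega))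
    · exact v.leAddSubgroup_monotone
        (zpow_le_zpow_right_of_le_one₀ h.val_pos h.lt_one.le (by omega))

end Index

section Lattice

variable {F D kF k : Type*} [Field F] [ValuativeRel F] [TopologicalSpace F]
  [IsNonarchimedeanLocalField F] [DivisionRing D] [Algebra F D] [FiniteDimensional F D]
  [TopologicalSpace D] [IsModuleTopology F D] [Ring kF] [Ring k]
  {ρF : F → kF} (hρF : IsResidueMap (valuation F) ρF) {π : F}
  (hπ : IsLocalValuation (valuation F) π)
  {ρ : D → k} (hρ : IsResidueMap (divisionValuation F D) ρ) {ϖ : D}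
  (hϖ : IsLocalValuation (divisionValuation F D) ϖ)
include hρF hπ hρ hϖ

/-- The index of `πΛ` in `Λ` is the same for all commensurable lattices. It is compared for a
coordinate lattice `L` and a valuation ball `M ≤ L`, so no integral basis of `O_D` is needed. -/
theorem card_pow_eq_card_pow_finrank {E : ℕ}
    (hE : divisionValuation F D (algebraMap F D π) = divisionValuation F D ϖ ^ E) :
    Nat.card k ^ E = Nat.card kF ^ Module.finrank F D := by
  have := IsModuleTopology.isTopologicalRing F D
  have := hρ.finite hϖ
  set v := divisionValuation F D with hv
  let b := Module.finBasis F D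
  let L : AddSubgroup D :=
    { carrier := {x | ∀ i, valuation F (b.equivFun x i) ≤ 1}
      zero_mem' := by simp
      add_mem' := fun {x y} hx hy i => by
        rw [map_add]
        exact (valuation F).map_add_le (hx i) (hy i)
      neg_mem' := fun {x} hx i => by
        rw [map_neg, Pi.neg_apply, Valuation.map_neg]
        exact hx i }
  let μ : D →+ D := AddMonoidHom.mulLeft (algebraMap F D π)
  have hπ0 : algebraMap F D π ≠ 0 := (map_ne_zero _).2 hπ.ne_zero
  have hμ : Function.Injective μ := mul_right_injective₀ hπ0
  have hμv : ∀ x, v (μ x) = v ϖ ^ E * v x := fun x => by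
    rw [← hE]; exact map_mul _ _ _
  -- the index of `π L` in `L`
  have hL : (L.map μ).relIndex L = Nat.card kF ^ Module.finrank F D := by
    have h1 : (L.map μ).relIndex L = Nat.card (Fin (Module.finrank F D) → kF) := by
      refine AddSubgroup.relIndex_eq_natCard_of_surjective
        (AddMonoidHom.mk' (fun (x : L) i => ρF (b.equivFun (x : D) i)) fun x y => ?_) ?_ ?_
      · funext i
        rw [Pi.add_apply, ← hρF.map_add _ _ (x.2 i) (y.2 i), AddSubgroup.coe_add, map_add]
        rfl
      · intro c
        choose s hs1 hs2 using hρF.surjective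
        refine ⟨⟨b.equivFun.symm fun i => s (c i), fun i => ?_⟩, ?_⟩
        · rw [LinearEquiv.apply_symm_apply]
          exact hs1 _
        · funext i
          change ρF (b.equivFun (b.equivFun.symm fun i => s (c i)) i) = _
          rw [LinearEquiv.apply_symm_apply, hs2]
      · intro x
        have h2 : ((fun i => ρF (b.equivFun (x : D) i)) = 0) ↔
            ∀ i, valuation F (b.equivFun (x : D) i) < 1 := by
          rw [funext_iff]
          exact forall_congr' fun i => hρF.eq_zero_iff _ (x.2 i)
        refine h2.trans ?_
        rw [AddSubgroup.mem_map]
        constructor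
        · intro hx
          refine ⟨π⁻¹ • (x : D), fun i => ?_, ?_⟩
          · rw [map_smul, Pi.smul_apply, smul_eq_mul, map_mul, map_inv₀,
              inv_mul_le_iff₀ hπ.val_pos, mul_one, ← hπ.lt_one_iff]
            exact hx i
          · change algebraMap F D π * (π⁻¹ • (x : D)) = x
            rw [← Algebra.smul_def, smul_inv_smul₀ hπ.ne_zero]
        · rintro ⟨y, hy, hyx⟩ i
          have h3 : (x : D) = π • y := by rw [← hyx, Algebra.smul_def]; rfl
          rw [h3, map_smul, Pi.smul_apply, smul_eq_mul, map_mul]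
          exact (mul_le_of_le_one_right' (hy i)).trans_lt hπ.lt_one
    rw [h1, Nat.card_fun, Nat.card_fin]
  -- the index of `π M` in `M` for a ball `M`
  have hμB : ∀ j : ℤ, (v.leAddSubgroup (v ϖ ^ j)).map μ =
      v.leAddSubgroup (v ϖ ^ (j + E)) := by
    intro j
    ext x
    rw [AddSubgroup.mem_map]
    constructor
    · rintro ⟨y, hy, rfl⟩
      rw [Valuation.mem_leAddSubgroup_iff, hμv, zpow_add₀ hϖ.val_ne_zero, mul_comm, zpow_natCast]
      exact mul_le_mul_left hy _
    · intro hx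
      refine ⟨(algebraMap F D π)⁻¹ * x, ?_, mul_inv_cancel_left₀ hπ0 x⟩
      rw [Valuation.mem_leAddSubgroup_iff, map_mul, map_inv₀, hE,
        inv_mul_le_iff₀ (pow_pos hϖ.val_pos E), mul_comm, ← zpow_natCast,
        ← zpow_add₀ hϖ.val_ne_zero]
      exact hx
  have hlow : ∃ n : ℕ, v.leAddSubgroup (v ϖ ^ (n : ℤ)) ≤ L := by
    have hbc : Continuous b.equivFun :=
      IsModuleTopology.continuous_of_linearMap b.equivFun.toLinearMap
    have h1 : (L : Set D) ∈ 𝓝 (0 : D) := by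
      have h2 : Set.univ.pi (fun _ => {a : F | valuation F a ≤ 1}) ∈ 𝓝 (b.equivFun 0) := by
        rw [map_zero]
        exact set_pi_mem_nhds Set.finite_univ fun i _ =>
          (hπ.mem_nhds_zero _).2 ⟨0, fun a ha => by simpa using ha⟩
      refine Filter.mem_of_superset (hbc.continuousAt.preimage_mem_nhds h2) ?_
      exact fun x hx i => hx i (Set.mem_univ i)
    obtain ⟨n, hn⟩ := (hϖ.mem_nhds_zero _).1 h1
    refine ⟨n, fun x hx => hn ?_⟩
    rw [zpow_natCast] at hx
    exact hx
  have hup : ∃ m : ℕ, L ≤ v.leAddSubgroup (v ϖ ^ (-m : ℤ)) := by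
    obtain ⟨γ, C, -, hb⟩ := exists_norm_form_bounds F D b
    have h1 : ∀ x ∈ L, v x ≤ C := fun x hx => by
      have := (hb x 1).1 hx
      rwa [one_pow, mul_one] at this
    rcases eq_or_ne C 0 with hC | hC
    · refine ⟨0, fun x hx => Valuation.mem_leAddSubgroup_iff.2 ((h1 x hx).trans ?_)⟩
      rw [hC]
      exact zero_le
    · obtain ⟨m, hm⟩ := exists_pow_lt₀ hϖ.lt_one (Units.mk0 C⁻¹ (inv_ne_zero hC))
      refine ⟨m, fun x hx => Valuation.mem_leAddSubgroup_iff.2 ((h1 x hx).trans ?_)⟩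
      rw [zpow_neg, zpow_natCast]
      exact (le_inv_comm₀ (zero_lt_iff.2 hC) (pow_pos hϖ.val_pos m)).2 hm.le
  obtain ⟨n, hn⟩ := hlow
  obtain ⟨m, hm⟩ := hup
  set M := v.leAddSubgroup (v ϖ ^ (n : ℤ)) with hM
  have hMπ : (M.map μ).relIndex M = Nat.card k ^ E := by
    rw [hM, hμB]
    exact hϖ.relIndex_add hρ n E
  have hMM : M.map μ ≤ M := by
    rw [hM, hμB]
    refine v.leAddSubgroup_monotone (zpow_le_zpow_right_of_le_one₀ hϖ.val_pos hϖ.lt_one.le ?_)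
    omega
  have hLL : L.map μ ≤ L := by
    rintro _ ⟨y, hy, rfl⟩ i
    change valuation F (b.equivFun (algebraMap F D π * y) i) ≤ 1
    rw [← Algebra.smul_def, map_smul, Pi.smul_apply, smul_eq_mul, map_mul]
    exact mul_le_one' hπ.lt_one.le (hy i)
  have hfin : M.relIndex L ≠ 0 := by
    have h1 := AddSubgroup.relIndex_mul_relIndex _ _ _ hn hm
    have h2 := hϖ.relIndex_add hρ (-m) (m + n)
    have h3 : (-m : ℤ) + (m + n : ℕ) = n := by push_cast; ring
    rw [h3, ← h1] at h2
    intro h0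
    rw [h0, zero_mul] at h2
    exact pow_ne_zero _ Nat.card_pos.ne' h2.symm
  -- The index of `πM` in `L` is computed through `M` and through `πL`; since `[πL : πM] = [L : M]`
  -- is finite, it cancels.
  have h1 := AddSubgroup.relIndex_mul_relIndex _ _ _ hMM hn
  have h2 := AddSubgroup.relIndex_mul_relIndex _ _ _ (AddSubgroup.map_mono (f := μ) hn) hLL
  rw [AddSubgroup.relIndex_map_map_of_injective _ _ hμ, ← h1, hL, hMπ, mul_comm] at h2
  exact (mul_right_cancel₀ hfin h2).symm

end Lattice

/-! ### Ramification index and residue degree of a central division algebra. -/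

section Structure

variable {F D kF k : Type*} [Field F] [ValuativeRel F] [TopologicalSpace F]
  [IsNonarchimedeanLocalField F] [DivisionRing D] [Algebra F D] [FiniteDimensional F D]

theorem divisionValuation_algebraMap (a : F) :
    divisionValuation F D (algebraMap F D a) = valuation F a ^ Module.finrank F D := by
  change valuation F (Algebra.norm F (algebraMap F D a)) = _
  rw [Algebra.norm_algebraMap, map_pow]

variable [TopologicalSpace D] [IsModuleTopology F D] {π : F}
  (hπ : IsLocalValuation (valuation F) π) {ϖ : D}
  (hϖ : IsLocalValuation (divisionValuation F D) ϖ)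
include hπ hϖ

omit [IsModuleTopology F D] in
theorem exists_ramificationIndex : ∃ E : ℕ, 0 < E ∧
    divisionValuation F D (algebraMap F D π) = divisionValuation F D ϖ ^ E := by
  obtain ⟨n, hn⟩ := hϖ.exists_zpow (algebraMap F D π) ((map_ne_zero _).2 hπ.ne_zero)
  have h1 := divisionValuation_algebraMap_lt_one (D := D) hπ.lt_one
  rw [hn, zpow_lt_one_iff_right_of_lt_one₀ hϖ.val_pos hϖ.lt_one] at h1
  refine ⟨n.toNat, by omega, ?_⟩
  rw [hn, ← zpow_natCast, Int.toNat_of_nonneg h1.le]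

-- Nonzero scalars from `F` have values in powers of `v ϖ ^ E`. If `E > d`, the exponents `0, …, d`
-- are distinct modulo `E`, so no cancellation occurs and `1, ϖ, …, ϖ ^ d` would be independent over
-- `F`.
omit [IsModuleTopology F D] in
theorem ramificationIndex_le [Algebra.IsCentral F D] {d : ℕ} (hD : Module.finrank F D = d ^ 2)
    {E : ℕ} (hE : divisionValuation F D (algebraMap F D π) = divisionValuation F D ϖ ^ E) :
    E ≤ d := by
  classical
  by_contra hcon
  rw [not_le] at hcon
  apply not_linearIndependent_pow F D hD ϖ
  rw [Fintype.linearIndependent_iff]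
  intro a ha
  by_contra hne
  rw [not_forall] at hne
  obtain ⟨i₀, hi₀⟩ := hne
  set v := divisionValuation F D
  have hval : ∀ i, a i ≠ 0 → ∃ n : ℤ, v (a i • ϖ ^ (i : ℕ)) = v ϖ ^ (E * n + (i : ℕ)) := by
    intro i hi
    obtain ⟨n, hn⟩ := hπ.exists_zpow (a i) hi
    refine ⟨n, ?_⟩
    have h1 : v (algebraMap F D (a i)) = v (algebraMap F D π) ^ n := by
      rw [divisionValuation_algebraMap, divisionValuation_algebraMap, hn, ← zpow_natCast,
        ← zpow_natCast, ← zpow_mul, ← zpow_mul, mul_comm]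
    rw [Algebra.smul_def, map_mul, h1, hE, map_pow, zpow_add₀ hϖ.val_ne_zero, zpow_mul,
      zpow_natCast, zpow_natCast]
  have hv0 : ∀ i, a i ≠ 0 → v (a i • ϖ ^ (i : ℕ)) ≠ 0 := fun i hi =>
    v.ne_zero_iff.2 (smul_ne_zero hi (pow_ne_zero _ hϖ.ne_zero))
  obtain ⟨j, -, hj⟩ := Finset.exists_max_image Finset.univ
    (fun i : Fin (d + 1) => v (a i • ϖ ^ (i : ℕ))) ⟨i₀, Finset.mem_univ _⟩
  have hj0 : a j ≠ 0 := by
    intro h0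
    have := hj i₀ (Finset.mem_univ _)
    rw [h0, zero_smul, map_zero, le_zero_iff] at this
    exact hv0 i₀ hi₀ this
  have hsum : v (∑ i, a i • ϖ ^ (i : ℕ)) = v (a j • ϖ ^ (j : ℕ)) := by
    refine v.map_sum_eq_of_lt (Finset.mem_univ j) fun i hi => ?_
    rw [Finset.mem_sdiff, Finset.mem_singleton] at hi
    refine lt_of_le_of_ne (hj i (Finset.mem_univ _)) fun heq => ?_
    by_cases hai : a i = 0
    · rw [hai, zero_smul, map_zero] at heq
      exact hv0 j hj0 heq.symm
    · obtain ⟨n, hn⟩ := hval i hai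
      obtain ⟨m, hm⟩ := hval j hj0
      rw [hn, hm, zpow_right_inj₀ hϖ.val_pos hϖ.lt_one.ne] at heq
      have h3 : ((i : ℕ) : ℤ) % E = ((j : ℕ) : ℤ) % E := by
        have := congrArg (· % (E : ℤ)) heq
        simpa [Int.add_emod] using this
      rw [Int.emod_eq_of_lt (by omega) (by omega), Int.emod_eq_of_lt (by omega) (by omega)] at h3
      exact hi.2 (Fin.ext (by exact_mod_cast h3))
  rw [ha, map_zero] at hsum
  exact hv0 j hj0 hsum.symm

variable [Algebra.IsCentral F D] [Field kF] [Field k]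
  {ρF : F → kF} (hρF : IsResidueMap (valuation F) ρF)
  {ρ : D → k} (hρ : IsResidueMap (divisionValuation F D) ρ)
  {σ : k ≃+* k} (hσ : ∀ x, divisionValuation F D x ≤ 1 → σ (ρ x) = ρ (ϖ * x * ϖ⁻¹))
include hρ hσ

omit hπ in
theorem exists_algebraMap_of_fixed {p : ℕ} [Fact p.Prime] (hp : valuation F (p : F) < 1) {c : k}
    (hc : σ c = c) : ∃ a : F, valuation F a ≤ 1 ∧ ρ (algebraMap F D a) = c := by
  have := IsModuleTopology.isTopologicalRing F D
  have := hρ.finite hϖ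
  obtain ⟨α, hα1, hα2, hα3⟩ := hρ.exists_central_of_fixed hϖ hσ (p := p) (by
    rw [← map_natCast (algebraMap F D)]
    exact divisionValuation_algebraMap_lt_one hp) hc
  have hα4 : α ∈ Subalgebra.center F D := Subalgebra.mem_center_iff.2 fun z => (hα3 z).symm
  obtain ⟨a, rfl⟩ := Algebra.mem_bot.1 (Algebra.IsCentral.out hα4)
  refine ⟨a, ?_, hα2⟩
  rw [divisionValuation_algebraMap] at hα1
  exact (pow_le_one_iff_of_nonneg zero_le Module.finrank_pos.ne').1 hα1

omit [IsModuleTopology F D] [Algebra.IsCentral F D] hπ hρ in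
theorem fixed_of_commute {x : D} (hx : divisionValuation F D x ≤ 1) (hc : Commute ϖ x) :
    σ (ρ x) = ρ x := by
  rw [hσ x hx, hc.eq, mul_inv_cancel_right₀ hϖ.ne_zero]

include hρF

-- The fixed field of `σ` is the residue field of `F`: elements of `F` commute with `ϖ`, and
-- conversely fixed classes lift to the centre.
omit hπ in
theorem card_fixed {p : ℕ} [Fact p.Prime] (hp : valuation F (p : F) < 1) :
    Nat.card {c : k // σ c = c} = Nat.card kF := by
  choose s hs1 hs2 using hρF.surjective
  have hle : ∀ a : F, valuation F a ≤ 1 → divisionValuation F D (algebraMap F D a) ≤ 1 := by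
    intro a ha
    rw [divisionValuation_algebraMap]
    exact pow_le_one₀ zero_le ha
  symm
  refine Nat.card_congr (Equiv.ofBijective (fun c => ⟨ρ (algebraMap F D (s c)),
    fixed_of_commute hϖ hσ (hle _ (hs1 c)) (Algebra.commutes _ _).symm⟩) ⟨?_, ?_⟩)
  · intro c c' hcc
    have h1 : ρ (algebraMap F D (s c)) = ρ (algebraMap F D (s c')) := congrArg Subtype.val hcc
    rw [hρ.eq_iff (hle _ (hs1 c)) (hle _ (hs1 c')), ← map_sub, divisionValuation_algebraMap,
      pow_lt_one_iff_of_nonneg zero_le Module.finrank_pos.ne', ← hρF.eq_iff (hs1 c) (hs1 c'),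
      hs2, hs2] at h1
    exact h1
  · rintro ⟨c, hc⟩
    obtain ⟨a, ha, rfl⟩ := exists_algebraMap_of_fixed hϖ hρ hσ hp hc
    refine ⟨ρF a, Subtype.ext (hρ.eq_of_sub_lt (hle _ (hs1 _)) ?_)⟩
    rw [← map_sub, divisionValuation_algebraMap,
      pow_lt_one_iff_of_nonneg zero_le Module.finrank_pos.ne', ← hρF.eq_iff (hs1 _) ha, hs2]

/-- The ramification index and the residue degree of a central division algebra of dimension
`d ^ 2` are equal to `d`, and conjugation by a uniformizer has order `d` on the residue field. -/
theorem division_structure {p d : ℕ} [Fact p.Prime] (hp : valuation F (p : F) < 1)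
    (hD : Module.finrank F D = d ^ 2) :
    divisionValuation F D (algebraMap F D π) = divisionValuation F D ϖ ^ d ∧ orderOf σ = d ∧
      Nat.card k = Nat.card kF ^ d := by
  have := IsModuleTopology.isTopologicalRing F D
  have := hρ.finite hϖ
  have := hρF.finite hπ
  obtain ⟨E, hE0, hE⟩ := exists_ramificationIndex hπ hϖ
  have hEd := ramificationIndex_le hπ hϖ hD hE
  have h1 := card_pow_eq_card_pow_finrank hρF hπ hρ hϖ hE
  have h2 := FiniteField.card_eq_card_fixed_pow_orderOf σ
  rw [card_fixed hϖ hρF hρ hσ hp] at h2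
  -- `ϖ ^ E` is a unit times the central element `π`, so conjugation by it is trivial on the residue
  -- field.
  have hdvd : orderOf σ ∣ E := by
    refine orderOf_dvd_of_pow_eq_one (RingEquiv.ext fun c => ?_)
    obtain ⟨x, hx, rfl⟩ := hρ.surjective c
    rw [IsResidueMap.conj_pow hϖ.ne_zero hσ E hx]
    have hE0 : ϖ ^ E ≠ 0 := pow_ne_zero E hϖ.ne_zero
    have hw : divisionValuation F D (ϖ ^ E * (algebraMap F D π)⁻¹) = 1 := by
      rw [map_mul, map_inv₀, hE, map_pow, mul_inv_cancel₀ (pow_ne_zero E hϖ.val_ne_zero)]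
    refine Eq.trans ?_ (hρ.map_conj_unit hw hx)
    congr 1
    rw [mul_inv_rev, inv_inv]
    have hπ0 : algebraMap F D π ≠ 0 := (map_ne_zero _).2 hπ.ne_zero
    have hc : (algebraMap F D π)⁻¹ * x = x * (algebraMap F D π)⁻¹ := by
      rw [← map_inv₀]
      exact Algebra.commutes _ _
    rw [mul_assoc (ϖ ^ E) (algebraMap F D π)⁻¹ x, hc]
    simp only [mul_assoc, inv_mul_cancel_left₀ hπ0]
  rw [h2, ← pow_mul, hD] at h1
  have h3 : orderOf σ * E = d ^ 2 := Nat.pow_right_injective (Finite.one_lt_card (α := kF)) h1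
  have h4 : orderOf σ ≤ E := Nat.le_of_dvd hE0 hdvd
  -- The product of `orderOf σ` and `E` is `d ^ 2`, while `orderOf σ ≤ E ≤ d`.
  have h5 : E = d := by nlinarith
  have h6 : orderOf σ = d := by
    rw [h5, sq] at h3
    exact Nat.eq_of_mul_eq_mul_right (h5 ▸ hE0) h3
  exact ⟨h5 ▸ hE, h6, h6 ▸ h2⟩

end Structure

/-! ### Homomorphisms on the graded pieces of the filtration. -/

section Graded

variable {Γ : Type*} {R K : Type u} [DivisionRing R] [TopologicalSpace R]
  [LinearOrderedCommGroupWithZero Γ] {v : Valuation R Γ} {ϖ : R} (hϖ : IsLocalValuation v ϖ)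
  [Field K] [TopologicalSpace K] [IsTopologicalRing K]

/-- The principal unit with a given value. -/
def oneUnits.mk {x : R} (hx : v (x - 1) < 1) : oneUnits v :=
  ⟨Units.mk0 x (v.ne_zero_of_sub_one_lt hx), hx⟩

omit [TopologicalSpace R] in
@[simp] theorem oneUnits.val_mk {x : R} (hx : v (x - 1) < 1) :
    ((oneUnits.mk hx : Rˣ) : R) = x := rfl

omit [TopologicalSpace R] in
theorem oneUnits.val_sub_one_lt (z : oneUnits v) : v (((z : Rˣ) : R) - 1) < 1 := z.2

omit [TopologicalSpace R] in
theorem oneUnits.val_eq_one (z : oneUnits v) : v ((z : Rˣ) : R) = 1 :=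
  v.map_eq_one_of_sub_one_lt z.2

include hϖ

omit [IsTopologicalRing K] in
theorem IsLocalValuation.mul_pow_lt_one {x : R} (hx : v x ≤ 1) {n : ℕ} (hn : n ≠ 0) :
    v (1 + x * ϖ ^ n - 1) < 1 := by
  rw [add_sub_cancel_left, map_mul, map_pow]
  exact (mul_le_of_le_one_left' hx).trans_lt (pow_lt_one₀ zero_le hϖ.lt_one hn)

omit hϖ in
theorem contHom.apply_eq_of_sub_le (f : contHom K (oneUnits v)) {γ : Γ}
    (hf : ∀ u : oneUnits v, v (((u : Rˣ) : R) - 1) ≤ γ → f u = 0) {z z' : oneUnits v}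
    (hz : v (((z : Rˣ) : R) - ((z' : Rˣ) : R)) ≤ γ) : f z = f z' := by
  rw [← sub_eq_zero, sub_eq_add_neg, ← contHom.map_inv, ← contHom.map_mul]
  apply hf
  have : (((z * z'⁻¹ : oneUnits v) : Rˣ) : R) - 1 =
      (((z : Rˣ) : R) - ((z' : Rˣ) : R)) * ((z' : Rˣ) : R)⁻¹ := by
    rw [sub_mul, mul_inv_cancel₀ (z' : Rˣ).ne_zero]
    simp
  rw [this, map_mul, map_inv₀, oneUnits.val_eq_one z', inv_one, mul_one]
  exact hz

/-- A homomorphism which vanishes on the `n + 1`-st unit group is given on the `n`-th unit group by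
an additive map on the residue ring. -/
theorem IsResidueMap.exists_graded {k : Type*} [Ring k] {ρ : R → k} (hρ : IsResidueMap v ρ)
    (f : contHom K (oneUnits v)) {n : ℕ} (hn : n ≠ 0)
    (hf : ∀ u : oneUnits v, v (((u : Rˣ) : R) - 1) ≤ v ϖ ^ (n + 1) → f u = 0) :
    ∃ H : k →+ K, ∀ (z z' : oneUnits v) (c : R), v c ≤ 1 →
      ((z : Rˣ) : R) - ((z' : Rˣ) : R) = c * ϖ ^ n → f z = f z' + H (ρ c) := by
  choose s hs1 hs2 using hρ.surjective
  -- `z` differs from `(1 + c' ϖ ^ n) z'` by `(c - c') ϖ ^ n - c' ϖ ^ n (z' - 1)`, which lies one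
  -- step deeper. Allowing any pair `z`, `z'` lets the result compare `x * y` with `y * x`.
  have key : ∀ (z z' : oneUnits v) (c c' : R) (hc' : v c' ≤ 1), v c ≤ 1 → ρ c = ρ c' →
      ((z : Rˣ) : R) - ((z' : Rˣ) : R) = c * ϖ ^ n →
      f z = f z' + f (oneUnits.mk (hϖ.mul_pow_lt_one hc' hn)) := by
    intro z z' c c' hc' hc hcc h
    rw [add_comm, ← contHom.map_mul]
    refine contHom.apply_eq_of_sub_le f hf ?_
    have : ((z : Rˣ) : R) - (((oneUnits.mk (hϖ.mul_pow_lt_one hc' hn) * z' : oneUnits v) : Rˣ) : R)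
        = (c - c') * ϖ ^ n - c' * ϖ ^ n * (((z' : Rˣ) : R) - 1) := by
      rw [sub_mul, ← h]
      simp only [Subgroup.coe_mul, Units.val_mul, oneUnits.val_mk]
      noncomm_ring
    rw [this, pow_succ']
    refine v.map_sub_le ?_ ?_
    · rw [_root_.map_mul, _root_.map_pow]
      gcongr
      exact (hϖ.lt_one_iff _).1 ((hρ.eq_iff hc hc').1 hcc)
    · rw [_root_.map_mul, _root_.map_mul, _root_.map_pow, mul_comm]
      gcongr
      · exact (hϖ.lt_one_iff _).1 z'.2
      · exact mul_le_of_le_one_left' hc'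
  have key0 : ∀ (z z' : oneUnits v) (c : R), v c ≤ 1 →
      ((z : Rˣ) : R) - ((z' : Rˣ) : R) = c * ϖ ^ n →
      f z = f z' + f (oneUnits.mk (hϖ.mul_pow_lt_one (hs1 (ρ c)) hn)) := fun z z' c hc h =>
    key z z' c _ (hs1 _) hc (hs2 _).symm h
  refine ⟨AddMonoidHom.mk' (fun c => f (oneUnits.mk (hϖ.mul_pow_lt_one (hs1 c) hn))) ?_, key0⟩
  intro c c'
  refine (key _ _ (s (c + c') - s c') (s c) (hs1 _) (v.map_sub_le (hs1 _) (hs1 _)) ?_ ?_).trans (add_comm _ _)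
  · rw [hρ.map_sub (hs1 _) (hs1 _), hs2, hs2, hs2, add_sub_cancel_right]
  · simp only [oneUnits.val_mk]
    noncomm_ring

end Graded

/-- Vanishing of an additive map on a field with a compatible automorphism of order prime to the
characteristic. -/
theorem AddMonoidHom.eq_zero_of_twisted {k K : Type*} [Field k] [Field K] (H : k →+ K)
    (σ : k ≃+* k) (hd : ((orderOf σ : ℕ) : K) ≠ 0) {n : ℕ} (hn : n ≠ 0)
    (h1 : ∀ a b, H (a * σ b) = H (b * (σ ^ (n - 1)) a))
    (h2 : orderOf σ ∣ n → ∀ c, σ c = c → H c = 0) : H = 0 := by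
  have h3 : ∀ a, H a = H ((σ ^ (n - 1)) a) := fun a => by simpa using h1 a 1
  have hσ : ∀ b, (σ ^ (n - 1)) (σ b) = (σ ^ n) b := fun b => by
    rw [← RingAut.mul_apply, ← pow_succ, Nat.sub_add_cancel (Nat.pos_of_ne_zero hn)]
  -- Combine the relation `h1` with the invariance `h3` of `H` under `σ ^ (n - 1)`.
  have h4 : ∀ a b, H (a * (b - (σ ^ n) b)) = 0 := by
    intro a b
    obtain ⟨a, rfl⟩ := (σ ^ (n - 1)).surjective a
    rw [mul_sub, map_sub, sub_eq_zero, ← hσ, ← map_mul, ← h3, h1, mul_comm]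
  ext a
  by_cases hσn : σ ^ n = 1
  -- Here `σ ^ (n - 1)` is the inverse of `σ`, so `H` is `σ`-invariant and `orderOf σ * H a` is the
  -- value of `H` at the trace of `a`, a fixed element.
  · have h5 : ∀ a, H (σ a) = H a := fun a => by rw [h3, hσ, hσn, RingAut.one_apply]
    have h6 : ∀ i, H ((σ ^ i) a) = H a := by
      intro i
      induction i with
      | zero => simp
      | succ i ih => rw [pow_succ', RingAut.mul_apply, h5, ih]
    have h7 : H (∑ i ∈ Finset.range (orderOf σ), (σ ^ i) a) = orderOf σ * H a := by
      rw [map_sum, Finset.sum_congr rfl fun i _ => h6 i]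
      simp
    rw [h2 (orderOf_dvd_of_pow_eq_one hσn), eq_comm, mul_eq_zero] at h7
    · exact h7.resolve_left hd
    · have h8 := Finset.sum_range_succ' (fun i => (σ ^ i) a) (orderOf σ)
      rw [Finset.sum_range_succ, pow_orderOf_eq_one, pow_zero, add_left_inj] at h8
      rw [map_sum, h8]
      exact Finset.sum_congr rfl fun i _ => by rw [pow_succ', RingAut.mul_apply]
  -- Once `σ ^ n` moves some `b`, the multiples of `b - (σ ^ n) b` fill the field.
  · obtain ⟨b, hb⟩ : ∃ b, b - (σ ^ n) b ≠ 0 := by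
      by_contra! hcon
      exact hσn (RingEquiv.ext fun b => (sub_eq_zero.1 (hcon b)).symm)
    have := h4 (a * (b - (σ ^ n) b)⁻¹) b
    rwa [inv_mul_cancel_right₀ hb] at this

/-! ### Vanishing on the second unit group. -/

section Division

variable {F D K : Type u} [Field F] [ValuativeRel F] [TopologicalSpace F]
  [IsNonarchimedeanLocalField F] [DivisionRing D] [Algebra F D] [Algebra.IsCentral F D]
  [FiniteDimensional F D] [TopologicalSpace D] [IsModuleTopology F D]
  [Field K] [TopologicalSpace K] [DiscreteTopology K] [IsTopologicalRing K]
  {kF k : Type*} [Field kF] [Field k]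
  {π : F} (hπ : IsLocalValuation (valuation F) π)
  {ϖ : D} (hϖ : IsLocalValuation (divisionValuation F D) ϖ)
  {ρF : F → kF} (hρF : IsResidueMap (valuation F) ρF)
  {ρ : D → k} (hρ : IsResidueMap (divisionValuation F D) ρ)
include hπ hϖ hρF hρ

/-- On the `n`-th graded piece, commutators give the twisted relation of
`AddMonoidHom.eq_zero_of_twisted`, and when `d ∣ n` the central units kill the fixed classes. The
bound `n ≥ 2` makes `1 + b ϖ ^ (n - 1)` a principal unit. -/
theorem apply_eq_zero_of_comap_fieldInclusion_eq_zero {p d : ℕ} [Fact p.Prime] [CharP K p]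
    (hp : valuation F (p : F) < 1) (hD : Module.finrank F D = d ^ 2) (hpd : p.Coprime d)
    (f : contHom K (oneUnitsDivision F D)) (hf : contHom.comap (fieldInclusion F D) f = 0)
    (u : oneUnitsDivision F D)
    (hu : divisionValuation F D (((u : Dˣ) : D) - 1) ≤ divisionValuation F D ϖ ^ 2) : f u = 0 := by
  have := IsModuleTopology.isTopologicalRing F D
  have := hρ.finite hϖ
  have hϖ0 := hϖ.ne_zero
  obtain ⟨σ, hσ⟩ := hρ.exists_conj_equiv hϖ.ne_zero
  obtain ⟨hπϖ, hord, -⟩ := division_structure hπ hϖ hρF hρ hσ hp hD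
  obtain ⟨N, hN⟩ := hϖ.exists_forall_apply_eq_zero f
  have step : ∀ n, 2 ≤ n → (∀ u : oneUnitsDivision F D, divisionValuation F D (((u : Dˣ) : D) - 1) ≤
      divisionValuation F D ϖ ^ (n + 1) → f u = 0) → ∀ u : oneUnitsDivision F D,
      divisionValuation F D (((u : Dˣ) : D) - 1) ≤ divisionValuation F D ϖ ^ n → f u = 0 := by
    intro n hn2 hn
    have hn0 : n ≠ 0 := by omega
    obtain ⟨H, hH⟩ := hρ.exists_graded hϖ f hn0 hn
    have hH0 : H = 0 := by
      refine H.eq_zero_of_twisted σ ?_ hn0 ?_ ?_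
      · rw [hord, Ne, CharP.cast_eq_zero_iff K p]
        exact fun hdvd => (Fact.out : p.Prime).one_lt.ne' (Nat.dvd_one.1 (hpd ▸ Nat.dvd_gcd dvd_rfl hdvd))
      · intro a b
        obtain ⟨a, ha, rfl⟩ := hρ.surjective a
        obtain ⟨b, hb, rfl⟩ := hρ.surjective b
        have hb' : divisionValuation F D (ϖ * b * ϖ⁻¹) ≤ 1 := by
          rwa [IsResidueMap.map_conj hϖ0]
        have ha' : divisionValuation F D (ϖ ^ (n - 1) * a * (ϖ ^ (n - 1))⁻¹) ≤ 1 := by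
          rwa [IsResidueMap.map_conj (pow_ne_zero _ hϖ0)]
        have hab : divisionValuation F D (a * (ϖ * b * ϖ⁻¹)) ≤ 1 := by
          rw [map_mul]; exact mul_le_one' ha hb'
        have hba : divisionValuation F D (b * (ϖ ^ (n - 1) * a * (ϖ ^ (n - 1))⁻¹)) ≤ 1 := by
          rw [map_mul]; exact mul_le_one' hb ha'
        rw [hσ b hb, IsResidueMap.conj_pow hϖ0 hσ _ ha, ← hρ.map_mul _ _ ha hb',
          ← hρ.map_mul _ _ hb ha', ← sub_eq_zero, ← map_sub, ← hρ.map_sub hab hba]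
        -- For `x = 1 + a ϖ` and `y = 1 + b ϖ ^ (n - 1)`, the difference `x y - y x` is a multiple
        -- of `ϖ ^ n` whose coefficient reduces to `a σ(b) - b σ ^ (n - 1)(a)`; but `f (x y) = f (y
        -- x)`.
        let x := oneUnits.mk (hϖ.mul_pow_lt_one ha one_ne_zero)
        let y := oneUnits.mk (hϖ.mul_pow_lt_one hb (show n - 1 ≠ 0 by omega))
        have hxy := hH (x * y) (y * x) _
          ((divisionValuation F D).map_sub_le hab hba) (by
            obtain ⟨m, rfl⟩ : ∃ m, n = m + 1 := ⟨n - 1, by omega⟩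
            have hm0 := pow_ne_zero m hϖ0
            simp only [Subgroup.coe_mul, Units.val_mul, x, y, oneUnits.val_mk, sub_mul,
              Nat.add_sub_cancel]
            rw [pow_succ]
            have e1 : a * (ϖ * b * ϖ⁻¹) * (ϖ ^ m * ϖ) = a * ϖ * (b * ϖ ^ m) := by
              rw [← pow_succ, pow_succ']
              simp only [mul_assoc, inv_mul_cancel_left₀ hϖ0]
            have e2 : b * (ϖ ^ m * a * (ϖ ^ m)⁻¹) * (ϖ ^ m * ϖ) = b * ϖ ^ m * (a * ϖ) := by
              simp only [mul_assoc, inv_mul_cancel_left₀ hm0]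
            rw [e1, e2]
            noncomm_ring)
        rw [contHom.map_mul, contHom.map_mul, add_comm (f y)] at hxy
        exact left_eq_add.1 hxy
      · rw [hord]
        rintro ⟨m, rfl⟩ c hc
        have hm0 : m ≠ 0 := by rintro rfl; exact hn0 rfl
        -- `w` is a unit commuting with `ϖ`, so its class is fixed by `σ`. Dividing `c` by that
        -- class gives a fixed class with a lift `a` in `F`, and `1 + a π ^ m = 1 + (a w) ϖ ^ (d
        -- m)`.
        set w := algebraMap F D π ^ m * (ϖ ^ (d * m))⁻¹ with hw
        have hw1 : divisionValuation F D w = 1 := by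
          rw [hw, map_mul, map_inv₀, map_pow, map_pow, hπϖ, ← pow_mul,
            mul_inv_cancel₀ (pow_ne_zero _ hϖ.val_ne_zero)]
        have hwc : Commute ϖ w := by
          refine Commute.mul_right (Commute.pow_right ?_ _) (Commute.inv_right₀ (Commute.self_pow _ _))
          exact (Algebra.commutes π ϖ).symm
        have hρw : ρ w ≠ 0 := by
          rw [Ne, hρ.eq_zero_iff _ hw1.le, hw1]
          exact lt_irrefl _
        have hσw := fixed_of_commute hϖ hσ hw1.le hwc
        obtain ⟨a, ha, hac⟩ := exists_algebraMap_of_fixed hϖ hρ hσ hp (c := c * (ρ w)⁻¹)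
          (by rw [map_mul, map_inv₀, hc, hσw])
        have ha' : divisionValuation F D (algebraMap F D a) ≤ 1 := by
          rw [divisionValuation_algebraMap]
          exact pow_le_one₀ zero_le ha
        have h1 : f (fieldInclusion F D (oneUnits.mk (hπ.mul_pow_lt_one ha hm0))) = 0 :=
          DFunLike.congr_fun hf _
        rw [hH _ 1 (algebraMap F D a * w) (by rw [map_mul, hw1, mul_one]; exact ha'),
          hρ.map_mul _ _ ha' hw1.le, hac, inv_mul_cancel_right₀ hρw, contHom.map_one, zero_add] at h1
        · exact h1
        · change algebraMap F D (1 + a * π ^ m) - 1 = _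
          rw [hw, ← mul_assoc, inv_mul_cancel_right₀ (pow_ne_zero _ hϖ0), map_add, map_one,
            add_sub_cancel_left, map_mul, map_pow]
    intro u hu
    obtain ⟨c, hc, huc⟩ := hϖ.exists_mul_pow hu
    rw [hH u 1 c hc (by simpa using huc), hH0]
    simp
  have hall : ∀ j, (∀ u : oneUnitsDivision F D, divisionValuation F D (((u : Dˣ) : D) - 1) ≤
      divisionValuation F D ϖ ^ (j + 2) → f u = 0) → ∀ u : oneUnitsDivision F D,
      divisionValuation F D (((u : Dˣ) : D) - 1) ≤ divisionValuation F D ϖ ^ 2 → f u = 0 := by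
    intro j
    induction j with
    | zero => exact id
    | succ j ih => exact fun h => ih (step (j + 2) (by omega) h)
  exact hall N (fun u hu => hN u (hu.trans (hϖ.pow_le_pow (by omega)))) u hu

end Division

/-! ### Homomorphisms through quotients and from finite elementary abelian groups. -/

section Quotient

variable {A K G : Type u} [AddCommGroup A] [Field K] [TopologicalSpace K] [IsTopologicalRing K]
  [Group G] [TopologicalSpace G]

/-- If `θ : G → A` is a surjective homomorphism through which all continuous homomorphisms to `K`
factor, then continuous homomorphisms `G → K` are the same as homomorphisms `A → K`. -/
theorem contHom.nonempty_equiv_addMonoidHom (θ : G → A) (hmul : ∀ x y, θ (x * y) = θ x + θ y)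
    (hθ : Function.Surjective θ) (hc : ∀ ψ : A →+ K, Continuous fun x => ψ (θ x))
    (hk : ∀ (f : contHom K G) (x : G), θ x = 0 → f x = 0) :
    Nonempty (contHom K G ≃ₗ[K] (A →+ K)) := by
  let Φ : (A →+ K) →ₗ[K] contHom K G :=
    { toFun := fun ψ => contHom.mk (fun x => ψ (θ x)) (hc ψ) fun x y => by rw [hmul, map_add]
      map_add' := fun _ _ => rfl
      map_smul' := fun _ _ => rfl }
  have h1 : θ 1 = 0 := by simpa using hmul 1 1
  have hinv : ∀ x, θ x⁻¹ = - θ x := fun x => by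
    rw [eq_neg_iff_add_eq_zero, ← hmul, inv_mul_cancel, h1]
  refine ⟨(LinearEquiv.ofBijective Φ ⟨fun ψ ψ' h => ?_, fun f => ?_⟩).symm⟩
  · ext a
    obtain ⟨x, rfl⟩ := hθ a
    exact DFunLike.congr_fun h x
  · have hf : ∀ x y, θ x = θ y → f x = f y := by
      intro x y hxy
      rw [← sub_eq_zero, sub_eq_add_neg, ← contHom.map_inv, ← contHom.map_mul]
      apply hk
      rw [hmul, hinv, hxy, add_neg_cancel]
    choose s hs using hθ
    refine ⟨AddMonoidHom.mk' (fun a => f (s a)) fun a b => ?_, contHom.ext fun x => ?_⟩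
    · rw [← contHom.map_mul]
      apply hf
      rw [hmul, hs, hs, hs]
    · exact hf _ _ (hs _)

omit [TopologicalSpace K] [IsTopologicalRing K] in
theorem nonempty_addMonoidHom_equiv_fun_of_module {p n : ℕ} [Fact p.Prime] [Algebra (ZMod p) K]
    [Finite A] [Module (ZMod p) A] (hn : Nat.card A = p ^ n) :
    Nonempty ((A →+ K) ≃ₗ[K] (Fin n → K)) := by
  have hfin : Module.finrank (ZMod p) A = n := by
    have h : Nat.card A = Nat.card (ZMod p) ^ Module.finrank (ZMod p) A :=
      Module.natCard_eq_pow_finrank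
    rw [hn, Nat.card_zmod] at h
    exact (Nat.pow_right_injective (Fact.out : p.Prime).two_le h).symm
  let b : Module.Basis (Fin n) (ZMod p) A := Module.finBasisOfFinrankEq (ZMod p) A hfin
  let Φ : (A →+ K) →ₗ[K] (Fin n → K) :=
    { toFun := fun ψ i => ψ (b i)
      map_add' := fun _ _ => rfl
      map_smul' := fun _ _ => rfl }
  refine ⟨LinearEquiv.ofBijective Φ ⟨fun ψ ψ' h => ?_, fun c => ?_⟩⟩
  · apply AddMonoidHom.toZModLinearMap_injective p
    exact b.ext fun i => congrFun h i
  · refine ⟨(b.constr (ZMod p) c).toAddMonoidHom, funext fun i => ?_⟩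
    exact b.constr_basis (ZMod p) c i

omit [TopologicalSpace K] [IsTopologicalRing K] in
/-- Homomorphisms from a finite elementary abelian `p`-group to a field of characteristic `p`. -/
theorem nonempty_addMonoidHom_equiv_fun {p n : ℕ} [Fact p.Prime] [Algebra (ZMod p) K] [Finite A]
    (hp : ∀ a : A, p • a = 0) (hn : Nat.card A = p ^ n) :
    Nonempty ((A →+ K) ≃ₗ[K] (Fin n → K)) :=
  have := AddCommGroup.zmodModule hp
  nonempty_addMonoidHom_equiv_fun_of_module hn

end Quotient

/-- The residue ring of a local valuation is a domain. -/
theorem IsResidueMap.isDomain {R Γ k : Type*} [DivisionRing R] [LinearOrderedCommGroupWithZero Γ]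
    [Ring k] {v : Valuation R Γ} {ρ : R → k} (hρ : IsResidueMap v ρ) : IsDomain k := by
  have : Nontrivial k := by
    refine ⟨1, 0, ?_⟩
    rw [← hρ.map_one, Ne, hρ.eq_zero_iff 1 (by simp)]
    simp
  have : NoZeroDivisors k := by
    refine ⟨fun {a b} hab => ?_⟩
    obtain ⟨x, hx, rfl⟩ := hρ.surjective a
    obtain ⟨y, hy, rfl⟩ := hρ.surjective b
    rw [← hρ.map_mul _ _ hx hy, hρ.eq_zero_iff _ (by rw [_root_.map_mul]; exact mul_le_one' hx hy),
      _root_.map_mul] at hab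
    rw [hρ.eq_zero_iff _ hx, hρ.eq_zero_iff _ hy]
    by_contra! hcon
    exact absurd hab (not_lt.2 (one_le_mul hcon.1 hcon.2))
  exact NoZeroDivisors.to_isDomain k

section Residue

variable (F : Type*) [Field F] [ValuativeRel F] [TopologicalSpace F] [IsNonarchimedeanLocalField F]

theorem exists_isResidueMap_field : ∃ ρ : F → 𝓀[F], IsResidueMap (valuation F) ρ :=
  let ⟨ρ, hρ, _⟩ := IsResidueMap.of_surjective (v := valuation F) (IsLocalRing.residue 𝒪[F])
    IsLocalRing.residue_surjective (residue_eq_zero_iff_valuation_lt_one F)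
  ⟨ρ, hρ⟩

theorem exists_isResidueMap_division (D : Type*) [DivisionRing D] [Algebra F D]
    [FiniteDimensional F D] :
    ∃ ρ : D → divisionResidueRing F D, IsResidueMap (divisionValuation F D) ρ :=
  let ⟨ρ, hρ, _⟩ := IsResidueMap.of_surjective (v := divisionValuation F D)
    (Ideal.Quotient.mk (divisionMaximalIdeal F D)) Ideal.Quotient.mk_surjective
    fun _ => Ideal.Quotient.eq_zero_iff_mem
  ⟨ρ, hρ⟩

end Residue

section Division

variable {F D : Type u} [Field F] [ValuativeRel F] [TopologicalSpace F]
  [IsNonarchimedeanLocalField F] [DivisionRing D] [Algebra F D] [Algebra.IsCentral F D]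
  [FiniteDimensional F D] [TopologicalSpace D] [IsModuleTopology F D]

-- The residue ring is a finite domain, hence commutative by Wedderburn's theorem. Naming the field
-- `k` keeps its field structure apart from the quotient ring structure.
variable (F D) in
omit [Algebra.IsCentral F D] in
theorem exists_isResidueMap_division_field : ∃ (k : Type u) (_ : Field k) (ρ : D → k),
    IsResidueMap (divisionValuation F D) ρ ∧ Nat.card k = Nat.card (divisionResidueRing F D) := by
  classical
  have := IsModuleTopology.isTopologicalRing F D
  obtain ⟨ϖ, hϖ⟩ := exists_isLocalValuation F D
  obtain ⟨ρ, hρ⟩ := exists_isResidueMap_division F D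
  have := hρ.finite hϖ
  have := Fintype.ofFinite (divisionResidueRing F D)
  have := hρ.isDomain
  let _ := Fintype.divisionRingOfIsDomain (divisionResidueRing F D)
  exact ⟨divisionResidueRing F D, littleWedderburn _, ρ, ⟨hρ.1, hρ.2, hρ.3, hρ.4, hρ.5⟩, rfl⟩

theorem natCard_divisionResidueRing {p d f : ℕ} [Fact p.Prime] (hf : Nat.card 𝓀[F] = p ^ f)
    (hD : Module.finrank F D = d ^ 2) : Nat.card (divisionResidueRing F D) = p ^ (d * f) := by
  have := IsModuleTopology.isTopologicalRing F D
  obtain ⟨ϖ, hϖ⟩ := exists_isLocalValuation F D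
  obtain ⟨π, hπ⟩ := exists_isLocalValuation_field F
  obtain ⟨ρF, hρF⟩ := exists_isResidueMap_field F
  obtain ⟨k, _, ρ, hρ, hk⟩ := exists_isResidueMap_division_field F D
  have := hρ.finite hϖ
  obtain ⟨σ, hσ⟩ := hρ.exists_conj_equiv hϖ.ne_zero
  rw [← hk, (division_structure hπ hϖ hρF hρ hσ (valuation_prime_lt_one hf) hD).2.2, hf, ← pow_mul,
    mul_comm]

end Division

section Graded

variable {Γ : Type*} {R k : Type*} [DivisionRing R] [TopologicalSpace R]
  [LinearOrderedCommGroupWithZero Γ] {v : Valuation R Γ} {ϖ : R} (hϖ : IsLocalValuation v ϖ)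
  [Ring k] {ρ : R → k} (hρ : IsResidueMap v ρ)
include hϖ hρ

/-- In `x y - 1 = (x - 1) + (y - 1) + (x - 1) (y - 1)` the last term is invisible modulo `ϖ ^ 2`.
With the next lemma, this identifies `U¹ / U²` with the residue ring. -/
theorem IsResidueMap.map_mul_sub_one_mul_inv (x y : oneUnits v) :
    ρ ((((x * y : oneUnits v) : Rˣ) - 1 : R) * ϖ⁻¹) =
      ρ (((x : Rˣ) - 1 : R) * ϖ⁻¹) + ρ (((y : Rˣ) - 1 : R) * ϖ⁻¹) := by
  have h1 : ∀ z : oneUnits v, v (((z : Rˣ) - 1 : R) * ϖ⁻¹) ≤ 1 := by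
    intro z
    rw [_root_.map_mul, map_inv₀]
    exact mul_inv_le_one_of_le₀ ((hϖ.lt_one_iff _).1 z.2) zero_le
  rw [← hρ.map_add _ _ (h1 x) (h1 y)]
  refine hρ.eq_of_sub_lt (h1 _) ?_
  have : ((((x * y : oneUnits v) : Rˣ) - 1 : R) * ϖ⁻¹) - ((((x : Rˣ) - 1 : R) * ϖ⁻¹) +
      (((y : Rˣ) - 1 : R) * ϖ⁻¹)) = ((x : Rˣ) - 1 : R) * (((y : Rˣ) - 1 : R) * ϖ⁻¹) := by
    simp only [Subgroup.coe_mul, Units.val_mul]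
    noncomm_ring
  rw [this, _root_.map_mul]
  exact (mul_le_of_le_one_right' (h1 y)).trans_lt x.2

theorem IsResidueMap.sub_one_mul_inv_eq_zero_iff (x : oneUnits v) :
    ρ (((x : Rˣ) - 1 : R) * ϖ⁻¹) = 0 ↔ v (((x : Rˣ) : R) - 1) ≤ v ϖ ^ 2 := by
  have h1 : v (((x : Rˣ) - 1 : R) * ϖ⁻¹) ≤ 1 := by
    rw [_root_.map_mul, map_inv₀]
    exact mul_inv_le_one_of_le₀ ((hϖ.lt_one_iff _).1 x.2) zero_le
  rw [hρ.eq_zero_iff _ h1, ← hϖ.lt_pow_iff, _root_.map_mul, map_inv₀,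
    mul_inv_lt_iff₀ hϖ.val_pos, one_mul, pow_one]

end Graded

/-! ### Homomorphisms on principal units of reduced norm one. -/

section NrdOne

variable {F D K : Type u} [Field F] [ValuativeRel F] [TopologicalSpace F]
  [IsNonarchimedeanLocalField F] [DivisionRing D] [Algebra F D] [Algebra.IsCentral F D]
  [FiniteDimensional F D] [TopologicalSpace D] [IsModuleTopology F D]
  [Field K] [TopologicalSpace K] [DiscreteTopology K] [IsTopologicalRing K]
  {p d f : ℕ} [Fact p.Prime] [CharP K p]

/-- Continuous homomorphisms on the principal units of reduced norm `1` are the homomorphisms on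
the residue field. -/
theorem nonempty_contHom_oneUnitsNrdOne_equiv (hd : 1 < d) (hD : Module.finrank F D = d ^ 2)
    (hf : Nat.card 𝓀[F] = p ^ f) (hpd : p.Coprime d) :
    Nonempty (contHom K (oneUnitsNrdOne F D) ≃ₗ[K] (divisionResidueRing F D →+ K)) := by
  have := IsModuleTopology.isTopologicalRing F D
  obtain ⟨ϖ, hϖ⟩ := exists_isLocalValuation F D
  obtain ⟨π, hπ⟩ := exists_isLocalValuation_field F
  obtain ⟨ρF, hρF⟩ := exists_isResidueMap_field F
  -- `ρ'` goes to a field and feeds the structure theory; `ρ` goes to the residue ring itself.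
  obtain ⟨k, _, ρ', hρ', -⟩ := exists_isResidueMap_division_field F D
  obtain ⟨ρ, hρ⟩ := exists_isResidueMap_division F D
  have hp := valuation_prime_lt_one hf
  have := hρ'.finite hϖ
  obtain ⟨σ, hσ⟩ := hρ'.exists_conj_equiv hϖ.ne_zero
  obtain ⟨hπϖ, -, -⟩ := division_structure hπ hϖ hρF hρ' hσ hp hD
  have hzero := fun n : oneUnitsNrdOne F D =>
    hρ.sub_one_mul_inv_eq_zero_iff hϖ (nrdOneInclusion F D n)
  refine contHom.nonempty_equiv_addMonoidHom
    (fun n : oneUnitsNrdOne F D => ρ (((n : Dˣ) - 1 : D) * ϖ⁻¹))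
    (fun x y => hρ.map_mul_sub_one_mul_inv hϖ (nrdOneInclusion F D x) (nrdOneInclusion F D y))
    (fun c => ?_) (fun ψ => ?_) (fun g n hn => ?_)
  · obtain ⟨x, hx, rfl⟩ := hρ.surjective c
    set z := oneUnits.mk (hϖ.mul_pow_lt_one hx one_ne_zero) with hz
    -- The central factor `u` lies in `U ^ d`, hence in `U²` as `d > 1`; so `n` has the same image
    -- as `z`.
    obtain ⟨n, u, hnu⟩ := exists_mul_eq_of_mem_oneUnitsDivision hD hf hpd z
    have h1 := hρ.map_mul_sub_one_mul_inv hϖ (nrdOneInclusion F D n) (fieldInclusion F D u)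
    rw [← hnu, (hρ.sub_one_mul_inv_eq_zero_iff hϖ (fieldInclusion F D u)).2, add_zero] at h1
    · refine ⟨n, h1.symm.trans ?_⟩
      rw [hz, oneUnits.val_mk, add_sub_cancel_left, pow_one, mul_inv_cancel_right₀ hϖ.ne_zero]
    · have h2 : valuation F (((u : Fˣ) : F) - 1) ≤ valuation F π := (hπ.lt_one_iff _).1 u.2
      have h3 : divisionValuation F D (algebraMap F D (((u : Fˣ) : F) - 1)) ≤
          divisionValuation F D (algebraMap F D π) := by
        rw [divisionValuation_algebraMap, divisionValuation_algebraMap]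
        exact pow_le_pow_left₀ zero_le h2 _
      rw [map_sub, map_one, hπϖ] at h3
      exact h3.trans (hϖ.pow_le_pow hd)
  · refine hϖ.continuous_of_forall_apply_eq_zero _ (fun x y => ?_) 1 fun u hu => ?_
    · rw [← map_add]
      exact congrArg ψ (hρ.map_mul_sub_one_mul_inv hϖ (nrdOneInclusion F D x)
        (nrdOneInclusion F D y))
    · exact (congrArg ψ ((hzero u).2 hu)).trans (map_zero ψ)
  -- Extend `g` to `I₁` by zero on the central factor; the extension vanishes on `U²`.
  · obtain ⟨g', hg'⟩ := (contHom_comap_prod_bijective (K := K) hD hf hpd).2 (g, 0)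
    have h1 : contHom.comap (nrdOneInclusion F D) g' = g := congrArg Prod.fst hg'
    have h2 : contHom.comap (fieldInclusion F D) g' = 0 := congrArg Prod.snd hg'
    rw [← h1, contHom.comap_apply]
    exact apply_eq_zero_of_comap_fieldInclusion_eq_zero hπ hϖ hρF hρ' hp hD hpd g' h2 _
      ((hzero n).1 hn)

end NrdOne

/-! ### Quotients of the filtration on principal units. -/

section Filtration

variable {Γ R : Type*} [LinearOrderedCommGroupWithZero Γ]

/-- The subgroup of the principal units `u` with `v (u - 1) ≤ γ`. -/
def oneUnits.filtration [Ring R] (v : Valuation R Γ) (γ : Γ) : Subgroup (oneUnits v) where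
  carrier := {u | v (((u : Rˣ) : R) - 1) ≤ γ}
  one_mem' := by simp
  mul_mem' {x y} hx hy := v.map_mul_sub_one_le (v.map_eq_one_of_sub_one_lt x.2).le hx hy
  inv_mem' {x} hx := by
    have h : ((x⁻¹ : oneUnits v) : Rˣ) - (1 : R) = ((x⁻¹ : oneUnits v) : Rˣ) * (1 - ((x : Rˣ) : R)) := by
      rw [mul_sub, mul_one, ← Units.val_mul, ← Subgroup.coe_mul, inv_mul_cancel]
      simp
    change v _ ≤ γ
    rw [h, map_mul, v.map_eq_one_of_sub_one_lt (x⁻¹).2, one_mul, v.map_sub_swap]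
    exact hx

theorem oneUnits.mem_filtration [Ring R] {v : Valuation R Γ} {γ : Γ} {u : oneUnits v} :
    u ∈ filtration v γ ↔ v (((u : Rˣ) : R) - 1) ≤ γ := Iff.rfl

theorem oneUnits.inv_mul_mem_filtration [Ring R] {v : Valuation R Γ} {γ : Γ} {x y : oneUnits v} :
    x⁻¹ * y ∈ filtration v γ ↔ v (((y : Rˣ) : R) - ((x : Rˣ) : R)) ≤ γ := by
  have h : ((x : Rˣ) : R) * ((((x⁻¹ * y : oneUnits v) : Rˣ) : R) - 1) =
      ((y : Rˣ) : R) - ((x : Rˣ) : R) := by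
    rw [mul_sub, mul_one, ← Units.val_mul, ← Subgroup.coe_mul, mul_inv_cancel_left]
  rw [mem_filtration, ← h, map_mul, v.map_eq_one_of_sub_one_lt x.2, one_mul]

/-- The map `u ↦ u - 1` is not a homomorphism, but it matches multiplicative cosets with additive
ones. Between `U¹` and `Uⁿ⁺¹` there are `n` graded pieces. -/
theorem IsLocalValuation.natCard_quotient_filtration [DivisionRing R] [TopologicalSpace R]
    {v : Valuation R Γ} {ϖ : R} (hϖ : IsLocalValuation v ϖ) {k : Type*} [Ring k] {ρ : R → k}
    (hρ : IsResidueMap v ρ) (n : ℕ) :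
    Nat.card (oneUnits v ⧸ oneUnits.filtration v (v ϖ ^ (n + 1))) = Nat.card k ^ n := by
  rw [← hϖ.relIndex_add hρ 1 n]
  let e : oneUnits v ≃ v.leAddSubgroup (v ϖ ^ (1 : ℤ)) :=
    { toFun := fun u => ⟨((u : Rˣ) : R) - 1, by
        rw [Valuation.mem_leAddSubgroup_iff, zpow_one, ← hϖ.lt_one_iff]
        exact u.2⟩
      invFun := fun x => oneUnits.mk (x := 1 + x) (by
        have : v (x : R) ≤ v ϖ ^ (1 : ℤ) := x.2
        rw [add_sub_cancel_left, hϖ.lt_one_iff]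
        exact this.trans_eq (zpow_one _))
      left_inv := fun u => Subtype.ext (Units.ext (add_sub_cancel 1 _))
      right_inv := fun x => Subtype.ext (add_sub_cancel_left 1 _) }
  refine Nat.card_congr (Quotient.congr e fun x y => ?_)
  rw [QuotientGroup.leftRel_apply, QuotientAddGroup.leftRel_apply,
    oneUnits.inv_mul_mem_filtration, AddSubgroup.mem_addSubgroupOf,
    Valuation.mem_leAddSubgroup_iff]
  have h1 : v ϖ ^ (1 + (n : ℤ)) = v ϖ ^ (n + 1) := by
    rw [add_comm, ← Nat.cast_succ, zpow_natCast]
  have h2 : ((-e x + e y : v.leAddSubgroup (v ϖ ^ (1 : ℤ))) : R) =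
      ((y : Rˣ) : R) - ((x : Rˣ) : R) := by
    change -(((x : Rˣ) : R) - 1) + (((y : Rˣ) : R) - 1) = _
    abel
  rw [h1, h2]

/-- The quotient of the principal units by a step of the filtration, written additively. -/
def oneUnits.FiltrationQuotient [Field R] (v : Valuation R Γ) (γ : Γ) : Type _ :=
  Additive (oneUnits v ⧸ oneUnits.filtration v γ)

namespace oneUnits.FiltrationQuotient

variable [Field R] {v : Valuation R Γ} {γ : Γ}

noncomputable instance : AddCommGroup (FiltrationQuotient v γ) :=
  inferInstanceAs (AddCommGroup (Additive (oneUnits v ⧸ oneUnits.filtration v γ)))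

variable (γ) in
/-- The class of a principal unit. -/
def mk (u : oneUnits v) : FiltrationQuotient v γ :=
  Additive.ofMul (QuotientGroup.mk u : oneUnits v ⧸ oneUnits.filtration v γ)

theorem mk_mul (x y : oneUnits v) : mk γ (x * y) = mk γ x + mk γ y := rfl

theorem mk_pow (x : oneUnits v) (n : ℕ) : mk γ (x ^ n) = n • mk γ x := rfl

theorem mk_surjective : Function.Surjective (mk γ : oneUnits v → FiltrationQuotient v γ) :=
  fun a => QuotientGroup.mk_surjective (Additive.toMul a)

theorem mk_eq_zero_iff {u : oneUnits v} : mk γ u = 0 ↔ v (((u : Rˣ) : R) - 1) ≤ γ :=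
  QuotientGroup.eq_one_iff u

end oneUnits.FiltrationQuotient

end Filtration

section Quotient

open oneUnits.FiltrationQuotient oneUnits

variable {Γ : Type*} {R K : Type u} [Field R] [TopologicalSpace R] [IsTopologicalRing R]
  [LinearOrderedCommGroupWithZero Γ] {v : Valuation R Γ} {ϖ : R} (hϖ : IsLocalValuation v ϖ)
  [Field K] [TopologicalSpace K] [DiscreteTopology K] [IsTopologicalRing K]
include hϖ

theorem IsLocalValuation.nonempty_contHom_equiv_quotient {n : ℕ}
    (h : ∀ (f : contHom K (oneUnits v)) (u : oneUnits v),
      v (((u : Rˣ) : R) - 1) ≤ v ϖ ^ (n + 1) → f u = 0) :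
    Nonempty (contHom K (oneUnits v) ≃ₗ[K] (FiltrationQuotient v (v ϖ ^ (n + 1)) →+ K)) := by
  refine contHom.nonempty_equiv_addMonoidHom (FiltrationQuotient.mk _) mk_mul mk_surjective (fun ψ => ?_)
    (fun f u hu => h f u (mk_eq_zero_iff.1 hu))
  refine hϖ.continuous_of_forall_apply_eq_zero _ (fun x y => ?_) n fun u hu => ?_
  · rw [mk_mul, map_add]
  · rw [mk_eq_zero_iff.2 hu, map_zero]

end Quotient

/-! ### Principal units of a field of characteristic zero. -/

section MixedCharacteristic

open oneUnits.FiltrationQuotient oneUnits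

variable {Γ : Type*} {R K : Type u} [Field R] [TopologicalSpace R] [IsTopologicalRing R]
  [LinearOrderedCommGroupWithZero Γ] {v : Valuation R Γ} {ϖ : R} (hϖ : IsLocalValuation v ϖ)
  [Field K] [TopologicalSpace K] [DiscreteTopology K] [IsTopologicalRing K]
  {p e : ℕ} [Fact p.Prime]

omit [TopologicalSpace R] [IsTopologicalRing R] in
/-- The binomial expansion of `(1 + z) ^ p` up to terms divisible by `z ^ 2`. -/
theorem Valuation.map_one_add_pow_sub_le (v : Valuation R Γ) {z : R} (hz : v z ≤ 1) :
    v ((1 + z) ^ p - (1 + p * z)) ≤ max (v p * v z ^ 2) (v z ^ p) := by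
  obtain ⟨q, hq⟩ : ∃ q, p = q + 2 := ⟨p - 2, by have := (Fact.out : p.Prime).two_le; omega⟩
  have h : (1 + z) ^ p - (1 + p * z) =
      ∑ m ∈ Finset.range q, z ^ (m + 2) * (p.choose (m + 2) : R) + z ^ p := by
    rw [add_comm 1 z, add_pow, hq, Finset.sum_range_succ, Finset.sum_range_succ',
      Finset.sum_range_succ']
    simp
    ring
  rw [h]
  refine v.map_add_le (v.map_sum_le fun m hm => ?_) ?_
  · refine le_max_of_le_left ?_
    obtain ⟨c, hc⟩ := (Fact.out : p.Prime).dvd_choose_self (k := m + 2) (by omega)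
      (by have := Finset.mem_range.1 hm; omega)
    rw [hc, Nat.cast_mul, map_mul, map_mul, map_pow, pow_add, mul_comm]
    refine mul_le_mul' (mul_le_of_le_one_right' (v.map_natCast_le_one c)) ?_
    exact mul_le_of_le_one_left' (pow_le_one₀ zero_le hz)
  · rw [map_pow]
    exact le_max_right _ _

include hϖ

/-- With `z = (u - 1) / p`, the power `(1 + z) ^ p` agrees with `u` one step further: at level `e +
t + 1` the remaining terms have order at least `e + 2 (t + 1)` or `p (t + 1)`, and `e + 1 < p` makes
both large enough. A homomorphism to characteristic `p` kills `p`-th powers. -/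
theorem IsLocalValuation.apply_eq_zero_of_le_pow_ramification [CharP K p]
    (hp0 : (p : R) ≠ 0) (he : v (p : R) = v ϖ ^ e) (hep : e + 1 < p)
    (f : contHom K (oneUnits v)) (u : oneUnits v)
    (hu : v (((u : Rˣ) : R) - 1) ≤ v ϖ ^ (e + 1)) : f u = 0 := by
  obtain ⟨N, hN⟩ := hϖ.exists_forall_apply_eq_zero f
  have step : ∀ t, (∀ u : oneUnits v, v (((u : Rˣ) : R) - 1) ≤ v ϖ ^ (e + (t + 1) + 1) → f u = 0) →
      ∀ u : oneUnits v, v (((u : Rˣ) : R) - 1) ≤ v ϖ ^ (e + (t + 1)) → f u = 0 := by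
    intro t ht u hu
    have hz : v ((((u : Rˣ) : R) - 1) * (p : R)⁻¹) ≤ v ϖ ^ (t + 1) := by
      rw [map_mul, map_inv₀, he, mul_inv_le_iff₀ (pow_pos hϖ.val_pos e), ← pow_add, add_comm (t + 1)]
      exact hu
    set z := (((u : Rˣ) : R) - 1) * (p : R)⁻¹ with hzdef
    have hz1 : v z < 1 := hz.trans_lt (pow_lt_one₀ zero_le hϖ.lt_one (Nat.succ_ne_zero t))
    have hpz : 1 + p * z = ((u : Rˣ) : R) := by
      rw [hzdef, mul_comm, inv_mul_cancel_right₀ hp0, add_sub_cancel]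
    let x : oneUnits v := oneUnits.mk (x := 1 + z) (by rwa [add_sub_cancel_left])
    have hx : f (x ^ p) = f u := by
      refine contHom.apply_eq_of_sub_le f ht ?_
      change v ((1 + z) ^ p - _) ≤ _
      rw [← hpz]
      refine (v.map_one_add_pow_sub_le hz1.le).trans (max_le ?_ ?_)
      · rw [he]
        refine (mul_le_mul_right (pow_le_pow_left₀ zero_le hz 2) _).trans ?_
        rw [← pow_mul, ← pow_add]
        exact hϖ.pow_le_pow (by omega)
      · refine (pow_le_pow_left₀ zero_le hz p).trans ?_
        rw [← pow_mul]
        refine hϖ.pow_le_pow ?_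
        nlinarith
    rw [← hx, contHom.map_pow, CharP.cast_eq_zero, zero_mul]
  have hall : ∀ t, (∀ u : oneUnits v, v (((u : Rˣ) : R) - 1) ≤ v ϖ ^ (e + (t + 1)) → f u = 0) →
      ∀ u : oneUnits v, v (((u : Rˣ) : R) - 1) ≤ v ϖ ^ (e + 1) → f u = 0 := by
    intro t
    induction t with
    | zero => exact id
    | succ t ih => exact fun h => ih (step t h)
  exact hall N (fun u hu => hN u (hu.trans (hϖ.pow_le_pow (by omega)))) u hu

/-- Homomorphisms factor through `U¹ / Uᵉ⁺¹`, of order `p ^ (e f)`. It is killed by `p`, since both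
`p z` and `z ^ p` have order at least `e + 1`. -/
theorem IsLocalValuation.nonempty_contHom_equiv_of_mixed [Algebra (ZMod p) K] {f : ℕ}
    {k : Type*} [Ring k] {ρ : R → k} (hρ : IsResidueMap v ρ) (hk : Nat.card k = p ^ f)
    (hp0 : (p : R) ≠ 0) (he : v (p : R) = v ϖ ^ e) (hep : e + 1 < p) :
    Nonempty (contHom K (oneUnits v) ≃ₗ[K] (Fin (e * f) → K)) := by
  have : CharP K p := charP_of_injective_algebraMap (algebraMap (ZMod p) K).injective p
  obtain ⟨Φ⟩ := hϖ.nonempty_contHom_equiv_quotient (K := K) (n := e)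
    (hϖ.apply_eq_zero_of_le_pow_ramification hp0 he hep)
  have hcard : Nat.card (FiltrationQuotient v (v ϖ ^ (e + 1))) =
      p ^ (e * f) := by
    rw [mul_comm, pow_mul, ← hk, ← hϖ.natCard_quotient_filtration hρ e]
    rfl
  have : Finite (FiltrationQuotient v (v ϖ ^ (e + 1))) := by
    refine Nat.finite_of_card_ne_zero ?_
    rw [hcard]
    exact pow_ne_zero _ (Fact.out : p.Prime).ne_zero
  obtain ⟨Ψ⟩ := nonempty_addMonoidHom_equiv_fun (K := K) (p := p) (n := e * f) (fun a => by
    obtain ⟨u, rfl⟩ := mk_surjective a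
    rw [← mk_pow, mk_eq_zero_iff]
    change v (((u : Rˣ) : R) ^ p - 1) ≤ v ϖ ^ (e + 1)
    have h2 := v.map_one_add_pow_sub_le (p := p) (z := ((u : Rˣ) : R) - 1) u.2.le
    have hz := (hϖ.lt_one_iff _).1 (oneUnits.val_sub_one_lt u)
    set z := ((u : Rˣ) : R) - 1 with hzdef
    have h3 : ((u : Rˣ) : R) ^ p - 1 = ((1 + z) ^ p - (1 + p * z)) + p * z := by
      rw [hzdef, add_sub_cancel]
      ring
    have hpz : v (p * z) ≤ v ϖ ^ (e + 1) := by
      rw [map_mul, he, pow_succ]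
      exact mul_le_mul_right hz _
    rw [h3]
    refine v.map_add_le (h2.trans (max_le ?_ ?_)) hpz
    · rw [sq, ← mul_assoc, ← map_mul]
      exact (mul_le_of_le_one_right' (hz.trans hϖ.lt_one.le)).trans hpz
    · exact (pow_le_pow_left₀ zero_le hz p).trans (hϖ.pow_le_pow hep.le)) hcard
  exact ⟨Φ.trans Ψ⟩

end MixedCharacteristic

/-- An element which is not divisible by `p` is detected by a homomorphism to `ℤ / p`. -/
theorem AddCommGroup.exists_addMonoidHom_zmod_ne_zero {A : Type*} [AddCommGroup A] {p : ℕ}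
    [Fact p.Prime] {a : A} (ha : ∀ b, p • b ≠ a) : ∃ ψ : A →+ ZMod p, ψ a ≠ 0 := by
  let B : AddSubgroup A := (nsmulAddMonoidHom p).range
  have _ : Module (ZMod p) (A ⧸ B) := QuotientAddGroup.zmodModule fun x => ⟨x, rfl⟩
  have h1 : (QuotientAddGroup.mk a : A ⧸ B) ≠ 0 := by
    rw [Ne, QuotientAddGroup.eq_zero_iff]
    rintro ⟨b, hb⟩
    exact ha b hb
  by_contra! hcon
  apply h1
  rw [← Module.forall_dual_apply_eq_zero_iff (ZMod p)]
  intro φ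
  exact hcon (φ.toAddMonoidHom.comp (QuotientAddGroup.mk' B))

instance contHom.instAddCommGroup {G K : Type u} [Group G] [TopologicalSpace G] [Field K]
    [TopologicalSpace K] [IsTopologicalRing K] : AddCommGroup (contHom K G) :=
  Module.addCommMonoidToAddCommGroup K

/-! ### Principal units of a field of characteristic `p`. -/

section EqualCharacteristic

open oneUnits

variable {Γ : Type*} {R K : Type u} [Field R] [TopologicalSpace R] [IsTopologicalRing R]
  [LinearOrderedCommGroupWithZero Γ] {v : Valuation R Γ} {ϖ : R} (hϖ : IsLocalValuation v ϖ)
  [Field K] [TopologicalSpace K] [DiscreteTopology K] [IsTopologicalRing K]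

variable (K v) in
/-- The homomorphisms vanishing on a step of the filtration. -/
def contHom.vanishing (γ : Γ) : Submodule K (contHom K (oneUnits v)) where
  carrier := {f | ∀ u : oneUnits v, v (((u : Rˣ) : R) - 1) ≤ γ → f u = 0}
  zero_mem' _ _ := rfl
  add_mem' hf hg u hu := by rw [contHom.add_apply, hf u hu, hg u hu, add_zero]
  smul_mem' c f hf u hu := by rw [contHom.smul_apply, hf u hu, mul_zero]

-- In characteristic `p`, `x ^ p - 1 = (x - 1) ^ p` is zero or has order divisible by `p`, so it
-- cannot have leading term `ϖ ^ m`.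
omit [TopologicalSpace R] [IsTopologicalRing R] in
theorem oneUnits.val_ne_one_add_pow_mul {p m : ℕ} [TopologicalSpace R] [Fact p.Prime] [CharP R p]
    (hϖ : IsLocalValuation v ϖ) (hm : ¬ p ∣ m) (x : oneUnits v) :
    ¬ v (1 + ϖ ^ m - ((x : Rˣ) : R) ^ p) ≤ v ϖ ^ (m + 1) := by
  intro h
  have h1 : 1 + ϖ ^ m - ((x : Rˣ) : R) ^ p = ϖ ^ m - (((x : Rˣ) : R) - 1) ^ p := by
    rw [sub_pow_char, one_pow]
    ring
  set z := ((x : Rˣ) : R) - 1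
  rw [h1, ← hϖ.lt_pow_iff, ← map_pow] at h
  have h2 : v (z ^ p) = v (ϖ ^ m) := by
    rw [v.map_sub_swap] at h
    exact (v.map_eq_of_sub_lt h)
  rcases eq_or_ne z 0 with hz | hz
  · rw [hz, zero_pow (Fact.out : p.Prime).ne_zero, map_zero, map_pow] at h2
    exact pow_ne_zero m hϖ.val_ne_zero h2.symm
  · obtain ⟨j, hj⟩ := hϖ.exists_zpow z hz
    rw [map_pow, map_pow, hj, ← zpow_natCast, ← zpow_natCast, ← zpow_mul,
      zpow_right_inj₀ hϖ.val_pos hϖ.lt_one.ne] at h2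
    apply hm
    rw [← Int.natCast_dvd_natCast, ← h2]
    exact Dvd.intro_left j rfl

include hϖ

/-- `1 + ϖ ^ m` is not a `p`-th power in `U¹ / Uᵐ⁺¹`, so some homomorphism to `ZMod p` detects it
there. -/
theorem IsLocalValuation.exists_mem_vanishing {p m : ℕ} [Fact p.Prime] [CharP R p]
    [Algebra (ZMod p) K] (hm : ¬ p ∣ m) :
    ∃ f ∈ contHom.vanishing K v (v ϖ ^ (m + 1)), f ∉ contHom.vanishing K v (v ϖ ^ m) := by
  have hm0 : m ≠ 0 := by rintro rfl; exact hm (dvd_zero p)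
  let w : oneUnits v := oneUnits.mk (x := 1 + ϖ ^ m) (by
    rw [add_sub_cancel_left, map_pow]
    exact pow_lt_one₀ zero_le hϖ.lt_one hm0)
  obtain ⟨ψ, hψ⟩ := AddCommGroup.exists_addMonoidHom_zmod_ne_zero (p := p)
    (a := FiltrationQuotient.mk (v ϖ ^ (m + 1)) w) (by
      intro b hb
      obtain ⟨x, rfl⟩ := FiltrationQuotient.mk_surjective b
      rw [← FiltrationQuotient.mk_pow] at hb
      have h1 : FiltrationQuotient.mk (v ϖ ^ (m + 1)) ((x ^ p)⁻¹ * w) = 0 := by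
        rw [FiltrationQuotient.mk_mul, ← hb, ← FiltrationQuotient.mk_mul, inv_mul_cancel]
        rfl
      rw [FiltrationQuotient.mk_eq_zero_iff, ← oneUnits.mem_filtration,
        oneUnits.inv_mul_mem_filtration] at h1
      exact oneUnits.val_ne_one_add_pow_mul hϖ hm x h1)
  let g : oneUnits v → K := fun u => algebraMap (ZMod p) K (ψ (FiltrationQuotient.mk _ u))
  have hg : ∀ x y, g (x * y) = g x + g y := fun x y => by
    simp only [g, FiltrationQuotient.mk_mul, map_add]
  have hg0 : ∀ u : oneUnits v, v (((u : Rˣ) : R) - 1) ≤ v ϖ ^ (m + 1) → g u = 0 := fun u hu => by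
    simp only [g]
    rw [FiltrationQuotient.mk_eq_zero_iff.2 hu, map_zero, map_zero]
  refine ⟨contHom.mk g (hϖ.continuous_of_forall_apply_eq_zero g hg m hg0) hg, hg0, fun h => ?_⟩
  have h1 : g w = 0 := h w (by
    rw [oneUnits.val_mk, add_sub_cancel_left, map_pow])
  exact hψ ((map_eq_zero _).1 h1)

-- Such homomorphisms are determined by their values on representatives of a finite quotient.
omit [DiscreteTopology K] in
theorem IsLocalValuation.finite_vanishing {k : Type*} [Ring k] {ρ : R → k}
    (hρ : IsResidueMap v ρ) (n : ℕ) :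
    Module.Finite K (contHom.vanishing K v (v ϖ ^ (n + 1))) := by
  have := hρ.finite hϖ
  have := hρ.isDomain
  have : Finite (oneUnits v ⧸ oneUnits.filtration v (v ϖ ^ (n + 1))) := by
    refine Nat.finite_of_card_ne_zero ?_
    rw [hϖ.natCard_quotient_filtration hρ]
    exact pow_ne_zero _ Nat.card_pos.ne'
  let Φ : contHom.vanishing K v (v ϖ ^ (n + 1)) →ₗ[K]
      (oneUnits v ⧸ oneUnits.filtration v (v ϖ ^ (n + 1)) → K) :=
    { toFun := fun f q => f.1 q.out
      map_add' := fun _ _ => rfl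
      map_smul' := fun _ _ => rfl }
  refine Module.Finite.of_injective Φ ((injective_iff_map_eq_zero Φ).2 fun f hf => ?_)
  refine Subtype.ext (contHom.ext fun u => ?_)
  have h1 : f.1 (QuotientGroup.mk u : oneUnits v ⧸ oneUnits.filtration v (v ϖ ^ (n + 1))).out = 0 :=
    congrFun hf (QuotientGroup.mk u)
  refine Eq.trans ?_ h1
  refine contHom.apply_eq_of_sub_le f.1 f.2 ?_
  rw [← oneUnits.inv_mul_mem_filtration, ← QuotientGroup.eq, QuotientGroup.out_eq']

/-- The space is the increasing union of the finite-dimensional `W n`, so a basis is countable. It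
is infinite, because otherwise the chain would stabilize. -/
theorem IsLocalValuation.nonempty_contHom_equiv_of_equal {p : ℕ} [Fact p.Prime] [CharP R p]
    [Algebra (ZMod p) K] {k : Type*} [Ring k] {ρ : R → k} (hρ : IsResidueMap v ρ) :
    Nonempty (contHom K (oneUnits v) ≃ₗ[K] (ℕ →₀ K)) := by
  let W : ℕ → Submodule K (contHom K (oneUnits v)) := fun n =>
    contHom.vanishing K v (v ϖ ^ (n + 1))
  let b := Module.Basis.ofVectorSpace K (contHom K (oneUnits v))
  set ι := Module.Basis.ofVectorSpaceIndex K (contHom K (oneUnits v))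
  have hcount : Countable ι := by
    rw [← Set.countable_univ_iff]
    have huniv : (Set.univ : Set ι) = ⋃ n, {i | b i ∈ W n} := by
      refine (Set.eq_univ_of_forall fun i => ?_).symm
      exact Set.mem_iUnion.2 (hϖ.exists_forall_apply_eq_zero (b i))
    rw [huniv]
    refine Set.countable_iUnion fun n => Set.Finite.countable ?_
    have := hϖ.finite_vanishing (K := K) hρ n
    have hli : LinearIndependent K (fun i : {i | b i ∈ W n} => (⟨b i, i.2⟩ : W n)) :=
      LinearIndependent.of_comp (W n).subtype
        (b.linearIndependent.comp _ Subtype.val_injective)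
    exact hli.finite_of_isNoetherian
  have hinf : Infinite ι := by
    by_contra hfin
    rw [not_infinite_iff_finite] at hfin
    have := Module.Finite.of_basis b
    have hW : Monotone W := fun m n hmn f hf u hu =>
      hf u (hu.trans (hϖ.pow_le_pow (Nat.succ_le_succ hmn)))
    obtain ⟨n, hn⟩ := monotone_stabilizes_iff_noetherian.2
      (inferInstance : IsNoetherian K (contHom K (oneUnits v))) ⟨W, hW⟩
    have hp1 := (Fact.out : p.Prime).one_lt
    -- The level `p * (n + 1) + 1` is prime to `p` and lies beyond `n`; the chain grows strictly
    -- there.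
    obtain ⟨f, hf1, hf2⟩ := hϖ.exists_mem_vanishing (K := K) (p := p) (m := p * (n + 1) + 1)
      fun hdvd => hp1.ne' (Nat.dvd_one.1 ((Nat.dvd_add_right (dvd_mul_right _ _)).1 hdvd))
    have hle : n ≤ p * (n + 1) := by nlinarith
    have h1 : W n = W (p * (n + 1)) := hn _ hle
    have h2 : W n = W (p * (n + 1) + 1) := hn _ (by omega)
    have h3 : f ∈ W (p * (n + 1) + 1) := hf1
    rw [← h2, h1] at h3
    exact hf2 h3
  obtain ⟨e⟩ := nonempty_equiv_of_countable (α := ι) (β := ℕ)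
  exact ⟨b.repr.trans (Finsupp.domLCongr e)⟩

end EqualCharacteristic

/-- The absolute ramification index in terms of the valuation. -/
theorem valuation_natCast_eq_pow {F : Type*} [Field F] [ValuativeRel F] [TopologicalSpace F]
    [IsNonarchimedeanLocalField F] {π : F} (hπ : IsLocalValuation (valuation F) π) {p e : ℕ}
    (h : Ideal.span {(p : 𝒪[F])} = 𝓂[F] ^ e) : valuation F (p : F) = valuation F π ^ e := by
  let ϖ : 𝒪[F] := ⟨π, hπ.lt_one.le⟩
  have hmem : ∀ x : 𝒪[F], x ∈ 𝓂[F] ↔ valuation F (x : F) < 1 := fun x => by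
    rw [← residue_eq_zero_iff_valuation_lt_one, IsLocalRing.residue_eq_zero_iff]
  have hm : 𝓂[F] = Ideal.span {ϖ} := by
    ext x
    rw [hmem, Ideal.mem_span_singleton', hπ.lt_one_iff]
    constructor
    · intro hx
      obtain ⟨y, hy, hxy⟩ := hπ.exists_mul_pow (x := (x : F)) (n := 1) (by rwa [pow_one])
      rw [pow_one] at hxy
      exact ⟨⟨y, hy⟩, Subtype.ext hxy.symm⟩
    · rintro ⟨y, rfl⟩
      change valuation F ((y : F) * π) ≤ _
      rw [map_mul]
      exact mul_le_of_le_one_left' y.2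
  rw [hm, Ideal.span_singleton_pow] at h
  apply le_antisymm
  · obtain ⟨a, ha⟩ := Ideal.mem_span_singleton'.1 (h ▸ Ideal.mem_span_singleton_self (p : 𝒪[F]))
    have h1 : (a : F) * π ^ e = p := congrArg Subtype.val ha
    rw [← h1, map_mul, map_pow]
    exact mul_le_of_le_one_left' a.2
  · obtain ⟨a, ha⟩ := Ideal.mem_span_singleton'.1 (h ▸ Ideal.mem_span_singleton_self (ϖ ^ e))
    have h1 : (a : F) * p = π ^ e := congrArg Subtype.val ha
    rw [← map_pow, ← h1, map_mul]
    exact mul_le_of_le_one_left' a.2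

/-! ### The main theorem. -/

theorem mainTheorem4 {F D K : Type u} (p d e f : ℕ) [Fact p.Prime]
    [Field F] [ValuativeRel F] [TopologicalSpace F] [IsNonarchimedeanLocalField F]
    [DivisionRing D] [Algebra F D] [Algebra.IsCentral F D] [FiniteDimensional F D]
    [TopologicalSpace D] [IsModuleTopology F D]
    [Field K] [Algebra (ZMod p) K] [IsAlgClosure (ZMod p) K]
    [TopologicalSpace K] [DiscreteTopology K]
    (hd : 1 < d) (hD : Module.finrank F D = d ^ 2)
    (hf : Nat.card 𝓀[F] = p ^ f)
    (h : (CharZero F ∧ Ideal.span {(p : 𝒪[F])} = 𝓂[F] ^ e ∧ d * e + 1 < p) ∨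
      (CharP F p ∧ Nat.Coprime p d)) :
    Function.Bijective ((contH1Map K (nrdOneInclusion F D)).prod
      (contH1Map K (fieldInclusion F D))) ∧
    Nonempty (contH1 K (oneUnitsNrdOne F D) ≃ₗ[K] (divisionResidueRing F D →+ K)) ∧
    Nonempty ((divisionResidueRing F D →+ K) ≃ₗ[K] (Fin (d * f) → K)) ∧
    (CharZero F → Nonempty (contH1 K (oneUnitsField F) ≃ₗ[K] (Fin (e * f) → K))) ∧
    (CharP F p → Nonempty (contH1 K (oneUnitsField F) ≃ₗ[K] (ℕ →₀ K))) := by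
  have hpr : p.Prime := Fact.out
  have : CharP K p := charP_of_injective_algebraMap (algebraMap (ZMod p) K).injective p
  have := IsModuleTopology.isTopologicalRing F D
  obtain ⟨π, hπ⟩ := exists_isLocalValuation_field F
  obtain ⟨ϖ, hϖ⟩ := exists_isLocalValuation F D
  obtain ⟨ρF, hρF⟩ := exists_isResidueMap_field F
  obtain ⟨ρ, hρ⟩ := exists_isResidueMap_division F D
  have hp := valuation_prime_lt_one hf
  -- In characteristic zero `e ≥ 1`, because `p` is not a unit of `O_F`; so `p > d e + 1 > d`.
  have hpd : p.Coprime d := by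
    rcases h with ⟨-, he, hlt⟩ | ⟨-, h⟩
    · have he0 : e ≠ 0 := by
        rintro rfl
        rw [valuation_natCast_eq_pow hπ he, pow_zero] at hp
        exact lt_irrefl _ hp
      refine (Nat.Prime.coprime_iff_not_dvd hpr).2 fun hdvd => ?_
      have h1 := Nat.le_of_dvd (by omega) hdvd
      have h2 : d * 1 ≤ d * e := Nat.mul_le_mul_left d (Nat.one_le_iff_ne_zero.2 he0)
      omega
    · exact h
  refine ⟨?_, ?_, ?_, fun h0 => ?_, fun hcp => ?_⟩
  -- Naturality of `contH1Equiv` transports the bijectivity known for homomorphisms.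
  · have hcomm : ((contH1Equiv K (oneUnitsNrdOne F D)).toEquiv.prodCongr
        (contH1Equiv K (oneUnitsField F)).toEquiv) ∘ ((contH1Map K (nrdOneInclusion F D)).prod
        (contH1Map K (fieldInclusion F D))) =
        ((contHom.comap (K := K) (nrdOneInclusion F D)).prod
        (contHom.comap (fieldInclusion F D))) ∘ contH1Equiv K (oneUnitsDivision F D) :=
      funext fun x => Prod.ext (contH1Equiv_contH1Map _ x) (contH1Equiv_contH1Map _ x)
    rw [← Equiv.comp_bijective _ ((contH1Equiv K (oneUnitsNrdOne F D)).toEquiv.prodCongr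
      (contH1Equiv K (oneUnitsField F)).toEquiv), hcomm]
    exact (contHom_comap_prod_bijective hD hf hpd).comp
      (contH1Equiv K (oneUnitsDivision F D)).bijective
  · obtain ⟨Φ⟩ := nonempty_contHom_oneUnitsNrdOne_equiv (K := K) hd hD hf hpd
    exact ⟨(contH1Equiv K _).trans Φ⟩
  · have := hρ.finite hϖ
    refine nonempty_addMonoidHom_equiv_fun (p := p) (fun a => ?_) (natCard_divisionResidueRing hf hD)
    have hpD : divisionValuation F D (p : D) < 1 := by
      rw [← map_natCast (algebraMap F D)]
      exact divisionValuation_algebraMap_lt_one hp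
    rw [nsmul_eq_mul, ← hρ.map_natCast, (hρ.eq_zero_iff _ hpD.le).2 hpD, zero_mul]
  · rcases h with ⟨-, he, hlt⟩ | ⟨hcp, -⟩
    · have hep : e + 1 < p := by nlinarith
      obtain ⟨Φ⟩ := hπ.nonempty_contHom_equiv_of_mixed (K := K) hρF hf
        (Nat.cast_ne_zero.2 hpr.ne_zero) (valuation_natCast_eq_pow hπ he) hep
      exact ⟨(contH1Equiv K _).trans Φ⟩
    · exact absurd (CharP.cast_eq_zero F p) (Nat.cast_ne_zero.2 hpr.ne_zero)
  · obtain ⟨Φ⟩ := hπ.nonempty_contHom_equiv_of_equal (K := K) (p := p) hρF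
    exact ⟨(contH1Equiv K _).trans Φ⟩
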